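/- Let $D$ be a connected Lie group with Lie algebra $\mathfrak d=T_1D$ (bracket defined by right-invariant vector fields), let $\langle\cdot,\cdot\rangle$ be an invariant nondegenerate symmetric bilinear form on $\mathfrak d$ of split signature, and let $\mathfrak g\subset\mathfrak d$ be a Lie subalgebra that is maximal isotropic (so $\mathfrak g=\mathfrak g^\perp$), integrated by a closed connected subgroup $G\subset D$. Let $S=D/G$, with its smooth structure for which $p:D\to S$ is a submersion, let $\rho_S:\mathfrak d\to\mathfrak X(S)$ be the infinitesimal action induced by left multiplication, and $\rho=\rho_S|_{\mathfrak g}$. Fix * a connection splitting $s$: a smooth form $s\in\Omega^1(S,\mathfrak d)$ with $\rho_S\circ s=\mathrm{id}_{TS}$ and isotropic image; put $s^*(u)(X)=\langle s(X),u\rangle$ for $u\in\mathfrak d$, $\sigma=s^*|_{\mathfrak g}$, $L_S=\{(\rho(u),\sigma(u)) : u\in\mathfrak g\}\subset TS\oplus T^*S$ and $\phi_S=\frac12\langle ds,s\rangle+\frac16\langle[s,s],s\rangle\in\Omega^3(S)$; * an isotropic splitting $j:\mathfrak g^*\to\mathfrak d$: a linear map with $\langle j\mu,v\rangle=\mu(v)$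 for $v\in\mathfrak g$ and isotropic image; put $F(v)(\mu,\nu)=\langle[j\mu,j\nu],v\rangle$, $\chi(\mu,\nu,\kappa)=\langle[j\mu,j\nu],j\kappa\rangle$, $\bar\sigma=(\rho_S j)^*:T^*S\to\mathfrak g$ and $C_S=\{(\rho_S(j\mu),s^*(j\mu)) : \mu\in\mathfrak g^*\}$. Let $\mathcal M_s$ be the category whose objects are strong Dirac maps $J:(M,L,J^*\phi_S)\to(S,L_S,\phi_S)$, i.e. $M$ is a smooth manifold, $L\subset TM\oplus T^*M$ is a $J^*\phi_S$-twisted Dirac structure, $J$ is smooth, $(L_S)_{J(x)}=\{(dJ_x X,\beta) : (X,dJ_x^*\beta)\in L_x\}$ and $\ker dJ_x\cap (L_x\cap T_xM)=0$ for all $x$; its morphisms are the smooth forward Dirac maps $f:M\to M'$ with $J'f=J$. Let $\mathcal M^{pre}_s\subset\mathcal M_s$ be the full subcategory of presymplectic realizations, i.e. those for which $L$ is the graph of a 2-form. Let $\mathcal M_j$ be the category whose objects are Hamiltonian quasi-Poisson $\mathfrak g$-spaces $(M,\pi,\rho_M,J)$: a manifold $M$ with a bivector field $\pi$, a $\mathfrak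 g$-action $\rho_M:\mathfrak g\to\mathfrak X(M)$ and a smooth map $J:M\to S$ such that $\mathcal L_{\rho_M(v)}\pi=-\rho_M(F(v))$, $\frac12[\pi,\pi]=\rho_M(\chi)$, $dJ\circ\rho_M=\rho$ and $\pi^\sharp J^*=\rho_M\bar\sigma$; its morphisms are the smooth $\mathfrak g$-equivariant maps $f:M\to M'$ with $f_*\pi=\pi'$ and $J'f=J$. Let $\mathcal M^{tr}_j\subset\mathcal M_j$ be the full subcategory of those objects whose Lie algebroid $\mathfrak g\oplus T^*M$ is transitive, i.e. whose anchor $r(v,\alpha)=\rho_M(v)+\pi^\sharp(\alpha)$ is onto $T_xM$ at every $x\in M$. Then there is a functor $\mathcal I:\mathcal M_s\to\mathcal M_j$, the identity on underlying manifolds, moment maps and morphisms, that sends $(M,L,J)$ to $(M,\pi,\rho_M,J)$, where $\rho_M$ is determined by $dJ\circ\rho_M=\rho$ and $(\rho_M(v),J^*\sigma(v))\in L$, the backward image $C$ of $C_S$ under $J$ is transversal to $L$, and $\pi^\sharp=\mathrm{pr}_{TM}\circ(\mathrm{pr}_{TM}|_C)^*:T^*M\to C^*\cong L\to TM$. The functor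 $\mathcal I$ is an isomorphism of categories, and it restricts to an isomorphism of categories $\mathcal M^{pre}_s\to\mathcal M^{tr}_j$. -/

import Mathlib

open scoped Manifold ContDiff
open CategoryTheory

universe u

noncomputable section

namespace ManinHam

/-! ### Vector fields, differential forms and Dirac structures on a manifold -/

section Forms

variable {E : Type*} [NormedAddCommGroup E] [NormedSpace ℝ E]
  {M : Type*} [TopologicalSpace M] [ChartedSpace E M]
  {V : Type*} [NormedAddCommGroup V] [NormedSpace ℝ V]

/-- The tangent space `T_x M`. -/
abbrev Tan (E : Type*) [NormedAddCommGroup E] [NormedSpace ℝ E]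
    {M : Type*} [TopologicalSpace M] [ChartedSpace E M] (x : M) : Type _ :=
  TangentSpace 𝓘(ℝ, E) x

/-- The cotangent space `T_x^* M`. -/
abbrev Cot (E : Type*) [NormedAddCommGroup E] [NormedSpace ℝ E]
    {M : Type*} [TopologicalSpace M] [ChartedSpace E M] (x : M) : Type _ :=
  Tan E x →L[ℝ] ℝ

/-- The fibre `T_x M ⊕ T_x^* M`. -/
abbrev Gen (E : Type*) [NormedAddCommGroup E] [NormedSpace ℝ E]
    {M : Type*} [TopologicalSpace M] [ChartedSpace E M] (x : M) : Type _ :=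
  Tan E x × Cot E x

/-- `X` is a smooth vector field. -/
def SmoothVF [IsManifold 𝓘(ℝ, E) ∞ M] (X : ∀ x : M, Tan E x) : Prop :=
  ContMDiff 𝓘(ℝ, E) (𝓘(ℝ, E)).tangent ∞ (fun x => (⟨x, X x⟩ : TangentBundle 𝓘(ℝ, E) M))

/-- `α` is a smooth `V`-valued 1-form: it is smooth as a function on the tangent bundle. -/
def SmoothForm [IsManifold 𝓘(ℝ, E) ∞ M] (α : ∀ x : M, Tan E x →L[ℝ] V) : Prop :=
  ContMDiff (𝓘(ℝ, E)).tangent 𝓘(ℝ, V) ∞ (fun p : TangentBundle 𝓘(ℝ, E) M => α p.1 p.2)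

/-- A 1-form read in the preferred chart around `x₀`, i.e. pulled back along the inverse of that
chart to the model space. -/
def formInChart (α : ∀ x : M, Tan E x →L[ℝ] V) (x₀ : M) : E → (E →L[ℝ] V) := fun y =>
  (α ((extChartAt 𝓘(ℝ, E) x₀).symm y)).comp
    (mfderiv 𝓘(ℝ, E) 𝓘(ℝ, E) (extChartAt 𝓘(ℝ, E) x₀).symm y)

/-- The contraction `i_X dα` at `x`, where `dα(X, Y) = (D_X α)(Y) - (D_Y α)(X)` in the preferred
chart around `x` (the chart in which `T_x M` is identified with the model space). -/
def extd (α : ∀ x : M, Tan E x →L[ℝ] V) (x : M) (X : Tan E x) : Tan E x →L[ℝ] V :=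
  (fderiv ℝ (formInChart α x) (extChartAt 𝓘(ℝ, E) x x) X
    - (fderiv ℝ (formInChart α x) (extChartAt 𝓘(ℝ, E) x x)).flip X : E →L[ℝ] V)

/-- The differential of a real function, as a covector. -/
def dfun (f : M → ℝ) (x : M) : Cot E x := mvfderiv 𝓘(ℝ, E) f x

/-- The symmetric pairing on `TM ⊕ T^*M`. -/
def pairing {x : M} (e e' : Gen E x) : ℝ := e'.2 e.1 + e.2 e'.1

/-- The `φ`-twisted Courant bracket of `(X, α)` and `(Y, β)` at `x`:
`([X, Y], L_X β - i_Y dα + i_Y i_X φ)`, with `L_X β = d (β X) + i_X dβ`.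
The 3-form enters through `φ x X Y = i_Y i_X φ`. -/
def courant (φ : ∀ x : M, Tan E x → Tan E x → Cot E x)
    (X : ∀ x : M, Tan E x) (α : ∀ x : M, Cot E x)
    (Y : ∀ x : M, Tan E x) (β : ∀ x : M, Cot E x) (x : M) : Gen E x :=
  (VectorField.mlieBracket 𝓘(ℝ, E) X Y x,
    (dfun (fun y => β y (X y)) x + extd β x (X x)) - extd α x (Y x) + φ x (X x) (Y x))

/-- `L` is a `φ`-twisted Dirac structure: pointwise lagrangian, a smooth subbundle (through every
element passes a smooth section), with sections closed under the twisted Courant bracket. -/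
structure IsDirac [IsManifold 𝓘(ℝ, E) ∞ M] (L : ∀ x : M, Submodule ℝ (Gen E x))
    (φ : ∀ x : M, Tan E x → Tan E x → Cot E x) : Prop where
  lagrangian : ∀ (x : M) (e : Gen E x), e ∈ L x ↔ ∀ e' ∈ L x, pairing e e' = 0
  smooth : ∀ (x₀ : M), ∀ e ∈ L x₀, ∃ (X : ∀ x : M, Tan E x) (α : ∀ x : M, Cot E x),
    SmoothVF X ∧ SmoothForm α ∧ (∀ x, (X x, α x) ∈ L x) ∧ (X x₀, α x₀) = e
  integrable : ∀ (X : ∀ x : M, Tan E x) (α : ∀ x : M, Cot E x)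
    (Y : ∀ x : M, Tan E x) (β : ∀ x : M, Cot E x),
    SmoothVF X → SmoothForm α → SmoothVF Y → SmoothForm β →
    (∀ x, (X x, α x) ∈ L x) → (∀ x, (Y x, β x) ∈ L x) → ∀ x, courant φ X α Y β x ∈ L x

/-- `L` is the graph of a smooth 2-form `w`, `w x X = i_X w`. -/
def IsTwoForm [IsManifold 𝓘(ℝ, E) ∞ M] (L : ∀ x : M, Submodule ℝ (Gen E x)) : Prop :=
  ∃ w : ∀ x : M, Tan E x →ₗ[ℝ] Cot E x,
    (∀ x X, w x X X = 0) ∧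
    (∀ X : ∀ x : M, Tan E x, SmoothVF X → SmoothForm (fun x => w x (X x))) ∧
    ∀ x, L x = (w x).graph

end Forms

section Maps

variable {E : Type*} [NormedAddCommGroup E] [NormedSpace ℝ E]
  {M : Type*} [TopologicalSpace M] [ChartedSpace E M]
  {E' : Type*} [NormedAddCommGroup E'] [NormedSpace ℝ E']
  {M' : Type*} [TopologicalSpace M'] [ChartedSpace E' M']

/-- The differential of `f` at `x`. -/
def dmap (E E' : Type*) [NormedAddCommGroup E] [NormedSpace ℝ E]
    [NormedAddCommGroup E'] [NormedSpace ℝ E']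
    {M : Type*} [TopologicalSpace M] [ChartedSpace E M]
    {M' : Type*} [TopologicalSpace M'] [ChartedSpace E' M']
    (f : M → M') (x : M) : Tan E x →L[ℝ] Tan E' (f x) :=
  mfderiv 𝓘(ℝ, E) 𝓘(ℝ, E') f x

/-- The dual `β ↦ β ∘ df_x` of the differential of `f` at `x`. -/
def dmapDual (E E' : Type*) [NormedAddCommGroup E] [NormedSpace ℝ E]
    [NormedAddCommGroup E'] [NormedSpace ℝ E']
    {M : Type*} [TopologicalSpace M] [ChartedSpace E M]
    {M' : Type*} [TopologicalSpace M'] [ChartedSpace E' M']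
    (f : M → M') (x : M) : Cot E' (f x) →ₗ[ℝ] Cot E x where
  toFun β := β.comp (dmap E E' f x)
  map_add' _ _ := rfl
  map_smul' _ _ := rfl

/-- Forward image of `L ⊂ T_x M ⊕ T_x^* M`: all `(df X, β)` with `(X, f^* β) ∈ L`. -/
def forwardImage (f : M → M') (x : M) (L : Submodule ℝ (Gen E x)) :
    Submodule ℝ (Gen E' (f x)) :=
  (L.comap (LinearMap.id.prodMap (dmapDual E E' f x))).map
    ((dmap E E' f x : Tan E x →ₗ[ℝ] Tan E' (f x)).prodMap LinearMap.id)

/-- Backward image of `L' ⊂ T_{f x} M' ⊕ T_{f x}^* M'`: all `(X, f^* β)` with `(df X, β) ∈ L'`. -/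
def backwardImage (f : M → M') (x : M) (L' : Submodule ℝ (Gen E' (f x))) :
    Submodule ℝ (Gen E x) :=
  (L'.comap ((dmap E E' f x : Tan E x →ₗ[ℝ] Tan E' (f x)).prodMap LinearMap.id)).map
    (LinearMap.id.prodMap (dmapDual E E' f x))

theorem mem_forwardImage {f : M → M'} {x : M} {L : Submodule ℝ (Gen E x)} {e : Gen E' (f x)} :
    e ∈ forwardImage f x L ↔
      ∃ X : Tan E x, dmap E E' f x X = e.1 ∧ (X, dmapDual E E' f x e.2) ∈ L := by
  constructor
  · rintro ⟨⟨X, β⟩, h, rfl⟩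
    exact ⟨X, rfl, h⟩
  · rintro ⟨X, hX, h⟩
    exact ⟨(X, e.2), h, Prod.ext hX rfl⟩

theorem mem_backwardImage {f : M → M'} {x : M} {L' : Submodule ℝ (Gen E' (f x))} {e : Gen E x} :
    e ∈ backwardImage f x L' ↔
      ∃ β : Cot E' (f x), dmapDual E E' f x β = e.2 ∧ (dmap E E' f x e.1, β) ∈ L' := by
  constructor
  · rintro ⟨⟨X, β⟩, h, rfl⟩
    exact ⟨β, rfl, h⟩
  · rintro ⟨β, hβ, h⟩
    exact ⟨(e.1, β), h, Prod.ext rfl hβ⟩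

/-- The pull-back `f^* φ` of a 3-form. -/
def pullThree (f : M → M') (φ : ∀ y : M', Tan E' y → Tan E' y → Cot E' y) (x : M)
    (X Y : Tan E x) : Cot E x :=
  dmapDual E E' f x (φ (f x) (dmap E E' f x X) (dmap E E' f x Y))

end Maps

/-- Smooth finite-dimensional (Hausdorff, second countable) real manifolds. -/
structure Mfd : Type (u + 1) where
  carrier : Type u
  dim : ℕ
  [top : TopologicalSpace carrier]
  [charted : ChartedSpace (EuclideanSpace ℝ (Fin dim)) carrier]
  [smooth : IsManifold 𝓘(ℝ, EuclideanSpace ℝ (Fin dim)) ∞ carrier]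
  [t2 : T2Space carrier]
  [sc : SecondCountableTopology carrier]

attribute [instance] Mfd.top Mfd.charted Mfd.smooth Mfd.t2 Mfd.sc

/-- The model space of a manifold. -/
abbrev Mfd.Model (M : Mfd.{u}) : Type := EuclideanSpace ℝ (Fin M.dim)

/-! ### The Hamiltonian category of a Dirac manifold `(S, L_S, φ_S)` -/

section HamDirac

variable {F : Type*} [NormedAddCommGroup F] [NormedSpace ℝ F]
  {S : Type*} [TopologicalSpace S] [ChartedSpace F S]

/-- A strong Dirac map `J : (M, L, J^* φ_S) → (S, L_S, φ_S)`. -/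
@[ext]
structure StrongDirac (LS : ∀ y : S, Submodule ℝ (Gen F y))
    (φS : ∀ y : S, Tan F y → Tan F y → Cot F y) (M : Mfd.{u}) where
  L : ∀ x : M.carrier, Submodule ℝ (Gen M.Model x)
  J : M.carrier → S
  smooth_J : ContMDiff 𝓘(ℝ, M.Model) 𝓘(ℝ, F) ∞ J
  isDirac : IsDirac L (pullThree J φS)
  forward : ∀ x, LS (J x) = forwardImage J x (L x)
  transversal : ∀ (x : M.carrier) (X : Tan M.Model x),
    dmap M.Model F J x X = 0 → (X, (0 : Cot M.Model x)) ∈ L x → X = 0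

variable {LS : ∀ y : S, Submodule ℝ (Gen F y)} {φS : ∀ y : S, Tan F y → Tan F y → Cot F y}

/-- Morphisms of strong Dirac maps: smooth forward Dirac maps over `S`. -/
structure IsDiracMor {M M' : Mfd.{u}} (A : StrongDirac LS φS M) (A' : StrongDirac LS φS M')
    (f : M.carrier → M'.carrier) : Prop where
  smooth : ContMDiff 𝓘(ℝ, M.Model) 𝓘(ℝ, M'.Model) ∞ f
  comm : A'.J ∘ f = A.J
  forward : ∀ x, A'.L (f x) = forwardImage f x (A.L x)

/-- Objects of the Hamiltonian category of `(S, L_S, φ_S)`. -/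
structure HamDirac (LS : ∀ y : S, Submodule ℝ (Gen F y))
    (φS : ∀ y : S, Tan F y → Tan F y → Cot F y) where
  M : Mfd.{u}
  str : StrongDirac LS φS M

theorem isDiracMor_id {M : Mfd.{u}} (A : StrongDirac LS φS M) : IsDiracMor A A id where
  smooth := contMDiff_id
  comm := rfl
  forward x := by
    have h : dmap M.Model M.Model (id : M.carrier → M.carrier) x = ContinuousLinearMap.id ℝ _ :=
      mfderiv_id
    have h' : ∀ β, dmapDual M.Model M.Model (id : M.carrier → M.carrier) x β = β := by
      intro β
      simp only [dmapDual, h]; rfl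
    ext e
    rw [mem_forwardImage]
    constructor
    · intro he
      refine ⟨e.1, by rw [h]; rfl, ?_⟩
      rw [h']; exact he
    · rintro ⟨X, hX, he⟩
      rw [h] at hX
      rw [h'] at he
      obtain rfl : X = e.1 := hX
      exact he

theorem IsDiracMor.comp {M M' M'' : Mfd.{u}} {A : StrongDirac LS φS M} {A' : StrongDirac LS φS M'}
    {A'' : StrongDirac LS φS M''} {g : M'.carrier → M''.carrier} {f : M.carrier → M'.carrier}
    (hg : IsDiracMor A' A'' g) (hf : IsDiracMor A A' f) : IsDiracMor A A'' (g ∘ f) where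
  smooth := hg.smooth.comp hf.smooth
  comm := by rw [← Function.comp_assoc, hg.comm, hf.comm]
  forward x := by
    have h : dmap M.Model M''.Model (g ∘ f) x =
        (dmap M'.Model M''.Model g (f x)).comp (dmap M.Model M'.Model f x) :=
      mfderiv_comp x ((hg.smooth (f x)).mdifferentiableAt (by simp))
        ((hf.smooth x).mdifferentiableAt (by simp))
    have h' : ∀ β, dmapDual M.Model M''.Model (g ∘ f) x β =
        dmapDual M.Model M'.Model f x (dmapDual M'.Model M''.Model g (f x) β) := by
      intro β
      simp only [dmapDual, h]; rfl
    change A''.L (g (f x)) = _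
    rw [hg.forward (f x), hf.forward x]
    ext e
    simp only [mem_forwardImage]
    constructor
    · rintro ⟨Y, hY, X, hX, hL⟩
      refine ⟨X, ?_, ?_⟩
      · rw [h, ← hY, ← hX]; rfl
      · rw [h']; exact hL
    · rintro ⟨X, hX, hL⟩
      rw [h] at hX
      rw [h'] at hL
      exact ⟨_, hX, X, rfl, hL⟩

instance : Category (HamDirac.{u} LS φS) where
  Hom A A' := {f : A.M.carrier → A'.M.carrier // IsDiracMor A.str A'.str f}
  id A := ⟨id, isDiracMor_id A.str⟩
  comp f g := ⟨g.1 ∘ f.1, g.2.comp f.2⟩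

/-- The presymplectic realizations of `S`: the Dirac structure is a 2-form. -/
def presymplectic : ObjectProperty (HamDirac.{u} LS φS) := fun A => IsTwoForm A.str.L

end HamDirac

/-! ### Manin pairs -/

section Manin

variable {E : Type*} [NormedAddCommGroup E] [NormedSpace ℝ E]
  {D : Type*} [TopologicalSpace D] [ChartedSpace E D] [Group D]

/-- The right-invariant vector field of `u`. The Lie algebra `T_1 D` of `D` is, by the definition of
tangent spaces, the model space `E`. -/
def rightField (D : Type*) [TopologicalSpace D] [ChartedSpace E D] [Group D]
    (u : E) (a : D) : Tan E a :=
  (mfderiv 𝓘(ℝ, E) 𝓘(ℝ, E) (fun g : D => g * a) 1 : E →L[ℝ] E) u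

/-- The Lie bracket of the Lie algebra of `D`, defined by right-invariant vector fields. -/
def lieBr (D : Type*) [TopologicalSpace D] [ChartedSpace E D] [Group D] (u v : E) : E :=
  VectorField.mlieBracket 𝓘(ℝ, E) (rightField D u) (rightField D v) (1 : D)

/-- A Manin pair `(𝔡, 𝔤)`, where `𝔡` is the Lie algebra of `D`. The condition `𝔤 = 𝔤^⊥` says that
`𝔤` is isotropic of half the dimension, so that the form has split signature and `𝔤` is maximal
isotropic. -/
structure ManinPair (E : Type*) [NormedAddCommGroup E] [NormedSpace ℝ E]
    (D : Type*) [TopologicalSpace D] [ChartedSpace E D] [Group D] where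
  form : E →L[ℝ] E →L[ℝ] ℝ
  symm : ∀ u v, form u v = form v u
  nondegenerate : ∀ u, (∀ v, form u v = 0) → u = 0
  invariant : ∀ u v w, form (lieBr D u v) w = form u (lieBr D v w)
  g : Submodule ℝ E
  bracket_mem : ∀ u ∈ g, ∀ v ∈ g, lieBr D u v ∈ g
  lagrangian : ∀ u, u ∈ g ↔ ∀ v ∈ g, form u v = 0

namespace ManinPair

variable (P : ManinPair E D)

/-- The bracket of `𝔤`. -/
def gBr (u v : P.g) : P.g := ⟨lieBr D u.1 v.1, P.bracket_mem _ u.2 _ v.2⟩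

/-- `(D, G)` is a group pair integrating `(𝔡, 𝔤)`: `G` is closed and connected, and `𝔤` is the
tangent space of `G` at `1`, i.e. the set of velocities of smooth curves in `G` through `1`. -/
structure IsIntegratedBy (G : Subgroup D) : Prop where
  closed : IsClosed (G : Set D)
  connected : IsConnected (G : Set D)
  mem_g : ∀ v : E, v ∈ P.g ↔ ∃ γ : ℝ → D, ContMDiff 𝓘(ℝ, ℝ) 𝓘(ℝ, E) ∞ γ ∧ γ 0 = 1 ∧
    (∀ t, γ t ∈ G) ∧ (mfderiv 𝓘(ℝ, ℝ) 𝓘(ℝ, E) γ 0 : ℝ →L[ℝ] E) 1 = v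

/-- An isotropic splitting `j : 𝔤^* → 𝔡` of `𝔤 → 𝔡 → 𝔤^*`. -/
structure Splitting where
  j : Module.Dual ℝ P.g →ₗ[ℝ] E
  split : ∀ (μ : Module.Dual ℝ P.g) (v : P.g), P.form (j μ) v = μ v
  isotropic : ∀ μ ν, P.form (j μ) (j ν) = 0

/-- The cobracket, `F(v)(μ, ν) = F^*(μ, ν)(v) = ⟨[j μ, j ν], v⟩`. -/
def Splitting.cobr {P : ManinPair E D} (j : P.Splitting) (v : P.g)
    (μ ν : Module.Dual ℝ P.g) : ℝ :=
  P.form (lieBr D (j.j μ) (j.j ν)) v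

/-- The trivector, `χ(μ, ν, κ) = ⟨[j μ, j ν], j κ⟩`. -/
def Splitting.tri {P : ManinPair E D} (j : P.Splitting) (μ ν κ : Module.Dual ℝ P.g) : ℝ :=
  P.form (lieBr D (j.j μ) (j.j ν)) (j.j κ)

end ManinPair

variable {F : Type*} [NormedAddCommGroup F] [NormedSpace ℝ F]
  {G : Subgroup D} [ChartedSpace F (D ⧸ G)]

/-- The infinitesimal dressing action `ρ_S : 𝔡 → 𝔛(S)`, `S = D/G`, at `x`: the derivative at `1`
of `g ↦ g • x`. -/
def dressing (E F : Type*) [NormedAddCommGroup E] [NormedSpace ℝ E]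
    [NormedAddCommGroup F] [NormedSpace ℝ F]
    {D : Type*} [TopologicalSpace D] [ChartedSpace E D] [Group D]
    {G : Subgroup D} [ChartedSpace F (D ⧸ G)] (x : D ⧸ G) : E →L[ℝ] Tan F x :=
  (mfderiv 𝓘(ℝ, E) 𝓘(ℝ, F) (fun g : D => g • x) 1 : E →L[ℝ] F)

/-- A connection splitting: a smooth 1-form `s ∈ Ω¹(S, 𝔡)` with `ρ_S ∘ s = id` and isotropic
image (equivalently, an isotropic principal connection on `D → S`). -/
structure ConnSplitting (P : ManinPair E D) (F : Type*) [NormedAddCommGroup F] [NormedSpace ℝ F]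
    (G : Subgroup D) [ChartedSpace F (D ⧸ G)] [IsManifold 𝓘(ℝ, F) ∞ (D ⧸ G)] where
  s : ∀ x : D ⧸ G, Tan F x →L[ℝ] E
  smooth : SmoothForm s
  split : ∀ (x : D ⧸ G) (X : Tan F x), dressing E F x (s x X) = X
  isotropic : ∀ (x : D ⧸ G) (X Y : Tan F x), P.form (s x X) (s x Y) = 0

namespace ConnSplitting

variable {P : ManinPair E D} [IsManifold 𝓘(ℝ, F) ∞ (D ⧸ G)] (s : ConnSplitting P F G)

/-- The dual `s^* : 𝔡 → T_x^* S`, `s^*(u)(X) = ⟨s X, u⟩`; its restriction to `𝔤` is `σ`. -/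
def sDual (x : D ⧸ G) : E →ₗ[ℝ] Cot F x where
  toFun u := (P.form u).comp (s.s x)
  map_add' u v := by ext; simp
  map_smul' c u := by ext; simp

/-- The identification `(ρ_S, s^*) : 𝔡_S → TS ⊕ T^*S`. -/
def ident (x : D ⧸ G) : E →ₗ[ℝ] Gen F x :=
  (dressing E F x : E →ₗ[ℝ] Tan F x).prod (s.sDual x)

/-- The Dirac structure `L_S = {(ρ(u), σ(u)) | u ∈ 𝔤}`. -/
def LS (x : D ⧸ G) : Submodule ℝ (Gen F x) := P.g.map (s.ident x)

/-- The almost Dirac structure `C_S = {(ρ_S(j μ), s^*(j μ)) | μ ∈ 𝔤^*}`. -/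
def CS (j : P.Splitting) (x : D ⧸ G) : Submodule ℝ (Gen F x) :=
  (LinearMap.range j.j).map (s.ident x)

/-- The 3-form `φ_S = ½⟨ds, s⟩ + ⅙⟨[s, s], s⟩`, through its contractions `i_Y i_X φ_S`:
`φ_S(X, Y, Z) = ⟨[s X, s Y], s Z⟩
  + ½ (⟨ds(X, Y), s Z⟩ + ⟨ds(Y, Z), s X⟩ + ⟨ds(Z, X), s Y⟩)`. -/
def phiS (x : D ⧸ G) (X Y : Tan F x) : Cot F x :=
  (P.form (lieBr D (s.s x X) (s.s x Y))).comp (s.s x) +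
    (1 / 2 : ℝ) • ((P.form (extd s.s x X Y)).comp (s.s x) + (P.form (s.s x X)).comp (extd s.s x Y)
      - (P.form (s.s x Y)).comp (extd s.s x X))

end ConnSplitting

/-! ### Hamiltonian quasi-Poisson spaces -/

/-- The bracket `{f, g} = π(df, dg)` of a bivector field given by `π^♯`, `π(α, β) = β(π^♯ α)`. -/
def pbr {M : Mfd.{u}} (π : ∀ x : M.carrier, Cot M.Model x →ₗ[ℝ] Tan M.Model x)
    (f g : M.carrier → ℝ) (x : M.carrier) : ℝ :=
  dfun (E := M.Model) g x (π x (dfun f x))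

/-- The derivative `L_X f`. -/
def dirDer {M : Mfd.{u}} (X : ∀ x : M.carrier, Tan M.Model x) (f : M.carrier → ℝ)
    (x : M.carrier) : ℝ :=
  dfun (E := M.Model) f x (X x)

/-- `(L_X π)(df, dg)`. -/
def lieBiv {M : Mfd.{u}} (X : ∀ x : M.carrier, Tan M.Model x)
    (π : ∀ x : M.carrier, Cot M.Model x →ₗ[ℝ] Tan M.Model x)
    (f g : M.carrier → ℝ) (x : M.carrier) : ℝ :=
  dirDer X (pbr π f g) x - pbr π (dirDer X f) g x - pbr π f (dirDer X g) x

/-- `½[π, π](df, dg, dh) = {f, {g, h}} + {g, {h, f}} + {h, {f, g}}` (Schouten bracket). -/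
def halfSchouten {M : Mfd.{u}} (π : ∀ x : M.carrier, Cot M.Model x →ₗ[ℝ] Tan M.Model x)
    (f g h : M.carrier → ℝ) (x : M.carrier) : ℝ :=
  pbr π f (pbr π g h) x + pbr π g (pbr π h f) x + pbr π h (pbr π f g) x

/-- The dual `ρ_M^* : T_x^* M → 𝔤^*` of the action map at a point. -/
def rhoDual {P : ManinPair E D} {M : Mfd.{u}} {x : M.carrier} (r : P.g →ₗ[ℝ] Tan M.Model x)
    (α : Cot M.Model x) : Module.Dual ℝ P.g :=
  (α : Tan M.Model x →ₗ[ℝ] ℝ) ∘ₗ r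

variable [FiniteDimensional ℝ E]

/-- The map `σ̄ = (ρ_S j)^* : T_x^* S → 𝔤^{**} = 𝔤`. -/
def ManinPair.Splitting.sigmaBar {P : ManinPair E D} (j : P.Splitting) (x : D ⧸ G)
    (α : Cot F x) : P.g :=
  (Module.evalEquiv ℝ P.g).symm
    ((α : Tan F x →ₗ[ℝ] ℝ) ∘ₗ (dressing E F x : E →ₗ[ℝ] Tan F x) ∘ₗ j.j)

/-- A Hamiltonian quasi-Poisson `𝔤`-space structure `(π, ρ_M, J)` on `M`. The bivector field is
given by `π^♯`. -/
@[ext]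
structure HamQP {P : ManinPair E D} (j : P.Splitting) (F : Type*) [NormedAddCommGroup F]
    [NormedSpace ℝ F] (G : Subgroup D) [ChartedSpace F (D ⧸ G)] (M : Mfd.{u}) where
  π : ∀ x : M.carrier, Cot M.Model x →ₗ[ℝ] Tan M.Model x
  ρ : ∀ x : M.carrier, P.g →ₗ[ℝ] Tan M.Model x
  J : M.carrier → D ⧸ G
  skew : ∀ x (α : Cot M.Model x), α (π x α) = 0
  smooth_π : ∀ α : ∀ x : M.carrier, Cot M.Model x, SmoothForm α → SmoothVF (fun x => π x (α x))
  smooth_ρ : ∀ v, SmoothVF (fun x => ρ x v)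
  action : ∀ u v x, VectorField.mlieBracket 𝓘(ℝ, M.Model) (fun y => ρ y u) (fun y => ρ y v) x
    = ρ x (P.gBr u v)
  lie_π : ∀ (v : P.g) (f g : M.carrier → ℝ), ContMDiff 𝓘(ℝ, M.Model) 𝓘(ℝ, ℝ) ∞ f →
    ContMDiff 𝓘(ℝ, M.Model) 𝓘(ℝ, ℝ) ∞ g → ∀ x, lieBiv (fun y => ρ y v) π f g x
      = -j.cobr v (rhoDual (ρ x) (dfun f x))
          (rhoDual (ρ x) (dfun g x))
  schouten_π : ∀ f g h : M.carrier → ℝ, ContMDiff 𝓘(ℝ, M.Model) 𝓘(ℝ, ℝ) ∞ f →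
    ContMDiff 𝓘(ℝ, M.Model) 𝓘(ℝ, ℝ) ∞ g → ContMDiff 𝓘(ℝ, M.Model) 𝓘(ℝ, ℝ) ∞ h →
    ∀ x, halfSchouten π f g h x
      = j.tri (rhoDual (ρ x) (dfun f x))
          (rhoDual (ρ x) (dfun g x)) (rhoDual (ρ x) (dfun h x))
  smooth_J : ContMDiff 𝓘(ℝ, M.Model) 𝓘(ℝ, F) ∞ J
  equivariant : ∀ x (v : P.g), dmap M.Model F J x (ρ x v) = dressing E F (J x) v
  moment : ∀ x (α : Cot F (J x)), π x (dmapDual M.Model F J x α) = ρ x (j.sigmaBar (J x) α)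

/-- Morphisms of Hamiltonian quasi-Poisson spaces: smooth `𝔤`-equivariant maps `f` with
`f_* π = π'` and `J' f = J`. -/
structure IsQPMor {P : ManinPair E D} {j : P.Splitting} {M M' : Mfd.{u}}
    (B : HamQP j F G M) (B' : HamQP j F G M') (f : M.carrier → M'.carrier) : Prop where
  smooth : ContMDiff 𝓘(ℝ, M.Model) 𝓘(ℝ, M'.Model) ∞ f
  comm : B'.J ∘ f = B.J
  push : ∀ x (β : Cot M'.Model (f x)),
    dmap M.Model M'.Model f x (B.π x (dmapDual M.Model M'.Model f x β)) = B'.π (f x) β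
  equivariant : ∀ x (v : P.g), dmap M.Model M'.Model f x (B.ρ x v) = B'.ρ (f x) v

/-- Objects of the category of Hamiltonian quasi-Poisson `𝔤`-spaces. -/
structure HamQPoisson {P : ManinPair E D} (j : P.Splitting) (F : Type*) [NormedAddCommGroup F]
    [NormedSpace ℝ F] (G : Subgroup D) [ChartedSpace F (D ⧸ G)] where
  M : Mfd.{u}
  str : HamQP j F G M

section

variable {P : ManinPair E D} {j : P.Splitting}

theorem isQPMor_id {M : Mfd.{u}} (B : HamQP j F G M) : IsQPMor B B id := by
  have h : ∀ x, dmap M.Model M.Model (id : M.carrier → M.carrier) x = ContinuousLinearMap.id ℝ _ :=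
    fun _ => mfderiv_id
  refine ⟨contMDiff_id, rfl, fun x β => ?_, fun x v => ?_⟩
  · have : dmapDual M.Model M.Model (id : M.carrier → M.carrier) x β = β := by
      simp only [dmapDual, h]; rfl
    rw [this, h]; rfl
  · rw [h]; rfl

theorem IsQPMor.comp {M M' M'' : Mfd.{u}} {B : HamQP j F G M} {B' : HamQP j F G M'}
    {B'' : HamQP j F G M''} {g : M'.carrier → M''.carrier} {f : M.carrier → M'.carrier}
    (hg : IsQPMor B' B'' g) (hf : IsQPMor B B' f) : IsQPMor B B'' (g ∘ f) := by
  have h : ∀ x, dmap M.Model M''.Model (g ∘ f) x =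
      (dmap M'.Model M''.Model g (f x)).comp (dmap M.Model M'.Model f x) := fun x =>
    mfderiv_comp x ((hg.smooth (f x)).mdifferentiableAt (by simp))
      ((hf.smooth x).mdifferentiableAt (by simp))
  refine ⟨hg.smooth.comp hf.smooth, by rw [← Function.comp_assoc, hg.comm, hf.comm],
    fun x β => ?_, fun x v => ?_⟩
  · have h' : dmapDual M.Model M''.Model (g ∘ f) x β =
        dmapDual M.Model M'.Model f x (dmapDual M'.Model M''.Model g (f x) β) := by
      simp only [dmapDual, h]; rfl
    rw [h, h']
    exact (congrArg _ (hf.push x _)).trans (hg.push (f x) β)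
  · rw [h]
    exact (congrArg _ (hf.equivariant x v)).trans (hg.equivariant (f x) v)

instance : Category (HamQPoisson.{u} j F G) where
  Hom B B' := {f : B.M.carrier → B'.M.carrier // IsQPMor B.str B'.str f}
  id B := ⟨id, isQPMor_id B.str⟩
  comp f g := ⟨g.1 ∘ f.1, g.2.comp f.2⟩

/-- The anchor `r(v, α) = ρ_M(v) + π^♯(α)` of the Lie algebroid `𝔤 ⊕ T^*M`, at `x`. -/
def HamQP.anchor {M : Mfd.{u}} (B : HamQP j F G M) (x : M.carrier) :
    P.g × Cot M.Model x →ₗ[ℝ] Tan M.Model x :=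
  (B.ρ x).coprod (B.π x)

/-- The Hamiltonian quasi-Poisson spaces with transitive Lie algebroid (surjective anchor). -/
def transitive : ObjectProperty (HamQPoisson.{u} j F G) :=
  fun B => ∀ x, Function.Surjective (B.str.anchor x)

/-! ### The functor -/

variable [IsManifold 𝓘(ℝ, F) ∞ (D ⧸ G)]

/-- `(M, π, ρ_M, J)` is the Hamiltonian quasi-Poisson space associated with the strong Dirac map
`J : (M, L) → (S, L_S)`: `ρ_M` is the induced action, determined by `dJ ∘ ρ_M = ρ` and
`(ρ_M(v), J^* σ(v)) ∈ L`; the backward image `C` of `C_S` is transversal to `L`, and `π` is the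
bivector field of the pair `(L, C)`, i.e. `π^♯ = pr_{TM} ∘ (pr_{TM}|_C)^* : T^*M → C^* ≅ L → TM`. -/
structure Associated (s : ConnSplitting P F G) {M : Mfd.{u}}
    (A : StrongDirac s.LS s.phiS M) (B : HamQP j F G M) : Prop where
  moment_map : B.J = A.J
  action : ∀ x (v : P.g), dmap M.Model F A.J x (B.ρ x v) = dressing E F (A.J x) v ∧
    (B.ρ x v, dmapDual M.Model F A.J x (s.sDual (A.J x) v)) ∈ A.L x
  transversal : ∀ x, IsCompl (A.L x) (backwardImage A.J x (s.CS j (A.J x)))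
  bivector : ∀ x (α : Cot M.Model x), ∃ l ∈ A.L x,
    (∀ c ∈ backwardImage A.J x (s.CS j (A.J x)), pairing l c = α c.1) ∧ B.π x α = l.1

/-- The functor `(M, L, J) ↦ (M, T(M, L, J))` that is the identity on underlying manifolds and maps,
given by a construction `T` of Hamiltonian quasi-Poisson structures that is compatible with
morphisms. -/
def functorOf (s : ConnSplitting P F G) (T : ∀ M : Mfd.{u}, StrongDirac s.LS s.phiS M → HamQP j F G M)
    (hT : ∀ (M M' : Mfd.{u}) (A : StrongDirac s.LS s.phiS M) (A' : StrongDirac s.LS s.phiS M')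
      (f : M.carrier → M'.carrier), IsDiracMor A A' f → IsQPMor (T M A) (T M' A') f) :
    HamDirac.{u} s.LS s.phiS ⥤ HamQPoisson.{u} j F G where
  obj A := ⟨A.M, T A.M A.str⟩
  map f := ⟨f.1, hT _ _ _ _ f.1 f.2⟩

end

end Manin

/-- `Φ` is an isomorphism of categories: it has a strict inverse. -/
def IsCatIso {A B : Type*} [Category A] [Category B] (Φ : A ⥤ B) : Prop :=
  ∃ Ψ : B ⥤ A, Φ ⋙ Ψ = 𝟭 A ∧ Ψ ⋙ Φ = 𝟭 B

end ManinHam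

end

/-! Let `R = s ∘ ρ_S`, the projection of `𝔡` onto the image of `s`. Its image is isotropic by
hypothesis. Its kernel over `aG` lies in `Ad_a 𝔤`, and the form is `Ad`-invariant because `D` is
connected, so the kernel is isotropic too. Hence `⟨Ru, v⟩ + ⟨u, Rv⟩ = ⟨u, v⟩` (`form_proj_add`).
This identity drives the fibrewise linear algebra.

Both kinds of structure are encoded by one map on `𝔤 ⊕ T^*M`, namely `e(v, α) = (ρ_M v + π♯α, α +
J^*s^*(v - j ρ_M^*α))` (`genSection`). Given quasi-Poisson data, equivariance, the moment condition
and skewness make the image of `e` isotropic. An element `(X, a)` orthogonal to the image equals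
`e(v, a)`, where `v` is the `𝔤`-component of `J^*s(X)`, so the image is lagrangian. Conversely, for
a strong Dirac map an element `(X, a)` of `L` is determined by `a` and `dJ X` (`eq_of_strong`). This
yields `ρ_M` and `π♯` as unique solutions of linear conditions (`exists_rho`, `exists_pi`), and `L`
is then the image of `e`. The two passages are mutually inverse.

Integrability of `L` is the vanishing of `⟨⟦e₁, e₂⟧, e₃⟩` on the sections `e_i = e(v_i, df_i)`. The
3-form `φ_S` is exactly what cancels every term containing `R[·,·]` or a derivative of `R`
(`three_form_identity`, `pairing_courant_pullDual`). What remains involves only `ρ_M`, `π` and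
`⟨[·,·],·⟩`. Sorted by the number of arguments from `𝔤`: with three it vanishes since `𝔤` is an
isotropic subalgebra; with two it says that `ρ_M` is an action; with one it is the formula for
`L_{ρ_M(v)} π`; with none it is the formula for `½[π, π]`. The sections `e(v, df)` suffice because
every covector is a differential at its point and because the expression is cyclic on a lagrangian
subbundle, hence depends only on pointwise values (`pairing_courant_cycle`).

A map over `S` is forward Dirac exactly when it intertwines the data `(ρ_M, π)`, again by uniqueness
and by the formula for `e`. The tangent component of `e` is the anchor, so `L` projects onto `TM`,
that is, `L` is a 2-form, exactly when the Lie algebroid is transitive. Smoothness of constructed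
objects mostly comes from one principle: the solution of a smooth injective linear system is smooth
(`contMDiffAt_of_injective_apply_eq`). -/

set_option linter.unusedSectionVars false

noncomputable section

namespace ManinHam

open Filter Topology

/-! ### Calculus of vector fields and differential forms -/

section Calculus

variable {E : Type*} [NormedAddCommGroup E] [NormedSpace ℝ E]
  {M : Type*} [TopologicalSpace M] [ChartedSpace E M]
  {V W : Type*} [NormedAddCommGroup V] [NormedSpace ℝ V] [NormedAddCommGroup W] [NormedSpace ℝ W]

/-- The differential of a vector-valued function. -/
def diffl (f : M → V) (x : M) : Tan E x →L[ℝ] V := mvfderiv 𝓘(ℝ, E) f x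

theorem dfun_eq_diffl (f : M → ℝ) (x : M) : dfun (E := E) f x = diffl f x := rfl

theorem diffl_congr {f g : M → V} {x : M} (h : f =ᶠ[𝓝 x] g) :
    diffl (E := E) f x = diffl g x := by
  have h1 : mfderiv 𝓘(ℝ, E) 𝓘(ℝ, V) f x = mfderiv 𝓘(ℝ, E) 𝓘(ℝ, V) g x := h.mfderiv_eq
  ext v
  exact congrArg (fun A : E →L[ℝ] V => A v) h1

theorem diffl_const (c : V) (x : M) : diffl (E := E) (fun _ : M => c) x = 0 := mvfderiv_const c

/-- Smooth functions are differentiable. -/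
theorem mdiff {E' : Type*} [NormedAddCommGroup E'] [NormedSpace ℝ E']
    {M' : Type*} [TopologicalSpace M'] [ChartedSpace E' M'] {f : M → M'}
    (hf : ContMDiff 𝓘(ℝ, E) 𝓘(ℝ, E') ∞ f) (x : M) :
    MDifferentiableAt 𝓘(ℝ, E) 𝓘(ℝ, E') f x := (hf x).mdifferentiableAt (by simp)

theorem diffl_clm_comp (A : V →L[ℝ] W) {f : M → V} {x : M}
    (hf : MDifferentiableAt 𝓘(ℝ, E) 𝓘(ℝ, V) f x) (v : Tan E x) :
    diffl (fun y => A (f y)) x v = A (diffl f x v) := by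
  have h := (A.hasFDerivAt (x := f x)).hasMFDerivAt.comp x hf.hasMFDerivAt
  exact congrArg (fun B : E →L[ℝ] W => B v) h.mfderiv

theorem diffl_comp {E' : Type*} [NormedAddCommGroup E'] [NormedSpace ℝ E']
    {M' : Type*} [TopologicalSpace M'] [ChartedSpace E' M'] {J : M → M'} {f : M' → V} {x : M}
    (hf : MDifferentiableAt 𝓘(ℝ, E') 𝓘(ℝ, V) f (J x))
    (hJ : MDifferentiableAt 𝓘(ℝ, E) 𝓘(ℝ, E') J x) (v : Tan E x) :
    diffl (fun y => f (J y)) x v = diffl f (J x) (dmap E E' J x v) :=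
  mfderiv_comp_apply x hf hJ v

theorem diffl_eq_fderiv {f : M → V} {x : M} (hf : MDifferentiableAt 𝓘(ℝ, E) 𝓘(ℝ, V) f x) :
    (diffl f x : E →L[ℝ] V)
      = fderiv ℝ (f ∘ (extChartAt 𝓘(ℝ, E) x).symm) (extChartAt 𝓘(ℝ, E) x x) := by
  have h := hf.mvfderiv
  rw [ModelWithCorners.range_eq_univ, fderivWithin_univ] at h
  exact h

theorem differentiableAt_comp_chart_symm {f : M → V} {x : M}
    (hf : MDifferentiableAt 𝓘(ℝ, E) 𝓘(ℝ, V) f x) :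
    DifferentiableAt ℝ (f ∘ (extChartAt 𝓘(ℝ, E) x).symm) (extChartAt 𝓘(ℝ, E) x x) := by
  have h := hf.mdifferentiableWithinAt (s := Set.univ) |>.differentiableWithinAt_comp_extChartAt_symm
  rwa [Set.preimage_univ, Set.univ_inter, ModelWithCorners.range_eq_univ,
    differentiableWithinAt_univ] at h

theorem diffl_clm_apply {A : M → V →L[ℝ] W} {f : M → V} {x : M}
    (hA : MDifferentiableAt 𝓘(ℝ, E) 𝓘(ℝ, V →L[ℝ] W) A x)
    (hf : MDifferentiableAt 𝓘(ℝ, E) 𝓘(ℝ, V) f x) (v : Tan E x) :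
    diffl (fun y => A y (f y)) x v = diffl A x v (f x) + A x (diffl f x v) := by
  have h := fderiv_clm_apply (differentiableAt_comp_chart_symm hA)
    (differentiableAt_comp_chart_symm hf)
  have h1 := congrArg (fun B : E →L[ℝ] W => B v) (diffl_eq_fderiv (hA.clm_apply hf))
  refine h1.trans ((congrArg (fun B : E →L[ℝ] W => B v) h).trans ?_)
  rw [← diffl_eq_fderiv hA, ← diffl_eq_fderiv hf]
  have h2 := extChartAt_to_inv (I := 𝓘(ℝ, E)) x
  simp only [Function.comp_apply, h2]
  exact add_comm _ _

theorem diffl_add {f g : M → V} {x : M} (hf : MDifferentiableAt 𝓘(ℝ, E) 𝓘(ℝ, V) f x)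
    (hg : MDifferentiableAt 𝓘(ℝ, E) 𝓘(ℝ, V) g x) :
    diffl (fun y => f y + g y) x = diffl (E := E) f x + diffl g x := mvfderiv_fun_add hf hg

theorem diffl_sub {f g : M → V} {x : M} (hf : MDifferentiableAt 𝓘(ℝ, E) 𝓘(ℝ, V) f x)
    (hg : MDifferentiableAt 𝓘(ℝ, E) 𝓘(ℝ, V) g x) :
    diffl (fun y => f y - g y) x = diffl (E := E) f x - diffl g x := mvfderiv_fun_sub hf hg

theorem diffl_neg {f : M → V} {x : M} :
    diffl (fun y => - f y) x = -diffl (E := E) f x := mvfderiv_fun_neg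

theorem diffl_bilin (B : V →L[ℝ] V →L[ℝ] W) {f g : M → V} {x : M}
    (hf : MDifferentiableAt 𝓘(ℝ, E) 𝓘(ℝ, V) f x)
    (hg : MDifferentiableAt 𝓘(ℝ, E) 𝓘(ℝ, V) g x) (v : Tan E x) :
    diffl (fun y => B (f y) (g y)) x v = B (diffl f x v) (g x) + B (f x) (diffl g x v) := by
  have hA : MDifferentiableAt 𝓘(ℝ, E) 𝓘(ℝ, V →L[ℝ] W) (fun y => B (f y)) x :=
    ((B.hasFDerivAt (x := f x)).hasMFDerivAt.comp x hf.hasMFDerivAt).mdifferentiableAt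
  rw [diffl_clm_apply hA hg, diffl_clm_comp B hf]

variable [IsManifold 𝓘(ℝ, E) ∞ M]

theorem SmoothForm.apply {α : ∀ x : M, Tan E x →L[ℝ] V} (hα : SmoothForm α)
    {X : ∀ x : M, Tan E x} (hX : SmoothVF X) :
    ContMDiff 𝓘(ℝ, E) 𝓘(ℝ, V) ∞ (fun x => α x (X x)) :=
  ContMDiff.comp (I' := (𝓘(ℝ, E)).tangent) hα hX

theorem smoothForm_diffl {f : M → V} (hf : ContMDiff 𝓘(ℝ, E) 𝓘(ℝ, V) ∞ f) :
    SmoothForm (fun x => diffl (E := E) f x) := by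
  have h := hf.contMDiff_tangentMap (m := ∞) (by simp)
  exact (contMDiff_snd_tangentBundle_modelSpace V 𝓘(ℝ, V)).comp h

theorem SmoothForm.pullback {E' : Type*} [NormedAddCommGroup E'] [NormedSpace ℝ E']
    {M' : Type*} [TopologicalSpace M'] [ChartedSpace E' M'] [IsManifold 𝓘(ℝ, E') ∞ M']
    {s : ∀ x : M', Tan E' x →L[ℝ] V} (hs : SmoothForm s) {J : M → M'}
    (hJ : ContMDiff 𝓘(ℝ, E) 𝓘(ℝ, E') ∞ J) :
    SmoothForm (fun x => (s (J x)).comp (dmap E E' J x)) := by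
  have h := hJ.contMDiff_tangentMap (m := ∞) (by simp)
  exact ContMDiff.comp (I' := (𝓘(ℝ, E')).tangent) hs h

theorem contMDiff_tangent_proj :
    ContMDiff (𝓘(ℝ, E)).tangent 𝓘(ℝ, E) ∞ (fun p : TangentBundle 𝓘(ℝ, E) M => p.1) :=
  Bundle.contMDiff_proj (TangentSpace 𝓘(ℝ, E))

theorem SmoothForm.clm_comp {α : ∀ x : M, Tan E x →L[ℝ] V} (hα : SmoothForm α)
    {A : M → V →L[ℝ] W} (hA : ContMDiff 𝓘(ℝ, E) 𝓘(ℝ, V →L[ℝ] W) ∞ A) :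
    SmoothForm (fun x => (A x).comp (α x)) := by
  have h1 := ContMDiff.comp (I' := 𝓘(ℝ, E)) hA (contMDiff_tangent_proj (E := E) (M := M))
  exact ContMDiff.clm_apply (g := fun p : TangentBundle 𝓘(ℝ, E) M => A p.1) h1 hα

theorem SmoothForm.add {α β : ∀ x : M, Tan E x →L[ℝ] V} (hα : SmoothForm α) (hβ : SmoothForm β) :
    SmoothForm (fun x => α x + β x) := ContMDiff.add hα hβ

theorem SmoothVF.add {X Y : ∀ x : M, Tan E x} (hX : SmoothVF X) (hY : SmoothVF Y) :
    SmoothVF (fun x => X x + Y x) := ContMDiff.add_section hX hY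

end Calculus

/-! ### Forms, fields and Lie brackets in the preferred chart; Cartan's formula. -/

section Chart

theorem two_le_infty : (2 : WithTop ℕ∞) ≤ ∞ := by
  exact WithTop.coe_le_coe.2 (le_top : (2 : ℕ∞) ≤ ⊤)

variable {E : Type*} [NormedAddCommGroup E] [NormedSpace ℝ E]
  {M : Type*} [TopologicalSpace M] [ChartedSpace E M] [IsManifold 𝓘(ℝ, E) ∞ M]
  {V W : Type*} [NormedAddCommGroup V] [NormedSpace ℝ V] [NormedAddCommGroup W] [NormedSpace ℝ W]

/-- A vector field read in the preferred chart around `x₀`. -/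
def fieldInChart (X : ∀ x : M, Tan E x) (x₀ : M) : E → E := fun y =>
  (mfderiv 𝓘(ℝ, E) 𝓘(ℝ, E) (extChartAt 𝓘(ℝ, E) x₀).symm y : E →L[ℝ] E).inverse
    (X ((extChartAt 𝓘(ℝ, E) x₀).symm y))

theorem isInvertible_mfderiv_symm {x₀ : M} {y : E} (hy : y ∈ (extChartAt 𝓘(ℝ, E) x₀).target) :
    (mfderiv 𝓘(ℝ, E) 𝓘(ℝ, E) (extChartAt 𝓘(ℝ, E) x₀).symm y : E →L[ℝ] E).IsInvertible := by
  have : IsManifold 𝓘(ℝ, E) 1 M := IsManifold.of_le (n := ∞) (by simp)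
  have h := isInvertible_mfderivWithin_extChartAt_symm (I := 𝓘(ℝ, E)) hy
  rw [ModelWithCorners.range_eq_univ, mfderivWithin_univ] at h
  exact h

theorem mfderiv_symm_self (x₀ : M) :
    (mfderiv 𝓘(ℝ, E) 𝓘(ℝ, E) (extChartAt 𝓘(ℝ, E) x₀).symm (extChartAt 𝓘(ℝ, E) x₀ x₀) : E →L[ℝ] E)
      = ContinuousLinearMap.id ℝ E := by
  have : IsManifold 𝓘(ℝ, E) 1 M := IsManifold.of_le (n := ∞) (by simp)
  have h := mfderivWithin_range_extChartAt_symm (I := 𝓘(ℝ, E)) (x := x₀)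
  rw [ModelWithCorners.range_eq_univ, mfderivWithin_univ] at h
  exact h

theorem formInChart_self (α : ∀ x : M, Tan E x →L[ℝ] V) (x₀ : M) :
    formInChart α x₀ (extChartAt 𝓘(ℝ, E) x₀ x₀) = α x₀ := by
  have h1 := extChartAt_to_inv (I := 𝓘(ℝ, E)) x₀
  -- All fibres are the model space as types, but `α z` depends on `z`. The point is generalised so
  -- that the equality of base points can be substituted.
  have key : ∀ z : M, z = x₀ → ((α z : E →L[ℝ] V)) = (α x₀ : E →L[ℝ] V) := by
    rintro z rfl; rfl
  have h2 := mfderiv_symm_self (E := E) x₀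
  ext v
  unfold formInChart
  change (α ((extChartAt 𝓘(ℝ, E) x₀).symm (extChartAt 𝓘(ℝ, E) x₀ x₀)) : E →L[ℝ] V)
    ((mfderiv 𝓘(ℝ, E) 𝓘(ℝ, E) (extChartAt 𝓘(ℝ, E) x₀).symm (extChartAt 𝓘(ℝ, E) x₀ x₀) :
      E →L[ℝ] E) v) = _
  rw [h2, key _ h1]
  rfl

theorem fieldInChart_self (X : ∀ x : M, Tan E x) (x₀ : M) :
    fieldInChart X x₀ (extChartAt 𝓘(ℝ, E) x₀ x₀) = X x₀ := by
  have h1 := extChartAt_to_inv (I := 𝓘(ℝ, E)) x₀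
  have key : ∀ z : M, z = x₀ → ((X z : E)) = (X x₀ : E) := by
    rintro z rfl; rfl
  unfold fieldInChart
  rw [mfderiv_symm_self, key _ h1]
  exact congrArg (fun A : E →L[ℝ] E => A (X x₀)) (ContinuousLinearMap.inverse_id (R := ℝ) (M := E))

/-- The form is composed with the derivative of the inverse chart and the field with the inverse of
that derivative, so the two cancel. -/
theorem formInChart_fieldInChart (α : ∀ x : M, Tan E x →L[ℝ] V) (X : ∀ x : M, Tan E x) {x₀ : M}
    {y : E} (hy : y ∈ (extChartAt 𝓘(ℝ, E) x₀).target) :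
    formInChart α x₀ y (fieldInChart X x₀ y)
      = α ((extChartAt 𝓘(ℝ, E) x₀).symm y) (X ((extChartAt 𝓘(ℝ, E) x₀).symm y)) := by
  unfold formInChart fieldInChart
  obtain ⟨e, he⟩ := isInvertible_mfderiv_symm (E := E) hy
  change (α ((extChartAt 𝓘(ℝ, E) x₀).symm y) : E →L[ℝ] V)
    ((mfderiv 𝓘(ℝ, E) 𝓘(ℝ, E) (extChartAt 𝓘(ℝ, E) x₀).symm y : E →L[ℝ] E) _) = _
  rw [← he, ContinuousLinearMap.inverse_equiv]
  change (α ((extChartAt 𝓘(ℝ, E) x₀).symm y) : E →L[ℝ] V) (e (e.symm _)) = _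
  rw [e.apply_symm_apply]

theorem contMDiffAt_chart_symm (x : M) {y : E} (hy : y ∈ (extChartAt 𝓘(ℝ, E) x).target) :
    ContMDiffAt 𝓘(ℝ, E) 𝓘(ℝ, E) ∞ (extChartAt 𝓘(ℝ, E) x).symm y :=
  (contMDiffOn_extChartAt_symm x).contMDiffAt ((isOpen_extChartAt_target x).mem_nhds hy)

theorem differentiableAt_fieldInChart [FiniteDimensional ℝ E] {X : ∀ x : M, Tan E x}
    (hX : SmoothVF X) (x₀ : M) :
    DifferentiableAt ℝ (fieldInChart X x₀) (extChartAt 𝓘(ℝ, E) x₀ x₀) := by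
  have : IsManifold 𝓘(ℝ, E) 2 M := IsManifold.of_le (n := ∞) two_le_infty
  have := FiniteDimensional.complete ℝ E
  have h1 : MDifferentiableWithinAt 𝓘(ℝ, E) (𝓘(ℝ, E)).tangent
    (fun x => (⟨x, X x⟩ : TangentBundle 𝓘(ℝ, E) M)) Set.univ x₀ :=
    ((hX x₀).mdifferentiableAt (by simp)).mdifferentiableWithinAt
  have h := h1.differentiableWithinAt_mpullbackWithin_vectorField
  rw [Set.preimage_univ, Set.univ_inter, ModelWithCorners.range_eq_univ] at h
  have h2 := DifferentiableWithinAt.differentiableAt h univ_mem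
  refine h2.congr_of_eventuallyEq (Eventually.of_forall fun y => ?_)
  unfold fieldInChart
  rw [VectorField.mpullbackWithin_apply, mfderivWithin_univ]

/-- At the centre of its preferred chart the derivative of the chart is the identity, so the
push-forward in the definition of the bracket disappears. -/
theorem mlieBracket_eq_fieldInChart (X Y : ∀ x : M, Tan E x) (x : M) :
    VectorField.mlieBracket 𝓘(ℝ, E) X Y x
      = VectorField.lieBracket ℝ (fieldInChart X x) (fieldInChart Y x) (extChartAt 𝓘(ℝ, E) x x) := by
  have : IsManifold 𝓘(ℝ, E) 1 M := IsManifold.of_le (n := ∞) (by simp)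
  rw [← VectorField.mlieBracketWithin_univ, VectorField.mlieBracketWithin_apply,
    mfderiv_extChartAt_self, Set.preimage_univ, Set.univ_inter, ModelWithCorners.range_eq_univ]
  have h : ∀ Z : ∀ x : M, Tan E x, VectorField.mpullbackWithin 𝓘(ℝ, E) 𝓘(ℝ, E)
    (extChartAt 𝓘(ℝ, E) x).symm Z Set.univ = fieldInChart Z x := by
    intro Z
    ext y
    unfold fieldInChart
    rw [VectorField.mpullbackWithin_apply, mfderivWithin_univ]
  rw [h, h, ← VectorField.lieBracketWithin_univ]
  exact congrArg (fun A : E →L[ℝ] E => A (VectorField.lieBracketWithin ℝ (fieldInChart X x)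
    (fieldInChart Y x) Set.univ (extChartAt 𝓘(ℝ, E) x x)))
    (ContinuousLinearMap.inverse_id (R := ℝ) (M := E))

theorem contDiffOn_formInChart [FiniteDimensional ℝ E] {α : ∀ x : M, Tan E x →L[ℝ] V}
    (hα : SmoothForm α) (x₀ : M) :
    ContDiffOn ℝ ∞ (formInChart α x₀) (extChartAt 𝓘(ℝ, E) x₀).target := by
  rw [contDiffOn_clm_apply]
  intro v
  rw [← contMDiffOn_iff_contDiffOn]
  -- `SmoothForm` is a condition on the tangent bundle. It is tested here on the constant field `v`,
  -- carried to `M` by the tangent map of the inverse chart.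
  have h1 : ContMDiff 𝓘(ℝ, E) (𝓘(ℝ, E)).tangent ∞
      (fun z : E => (⟨z, v⟩ : TangentBundle 𝓘(ℝ, E) E)) :=
    contMDiff_vectorSpace_iff_contDiff.2 (contDiff_const (c := v))
  have ho := isOpen_extChartAt_target (I := 𝓘(ℝ, E)) x₀
  have h2 := (contMDiffOn_extChartAt_symm (I := 𝓘(ℝ, E)) (n := ∞)
    x₀).contMDiffOn_tangentMapWithin (m := ∞) (by simp) ho.uniqueMDiffOn
  have h3 := (ContMDiff.comp_contMDiffOn (I' := (𝓘(ℝ, E)).tangent) hα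
    (ContMDiffOn.comp (I' := (𝓘(ℝ, E)).tangent) h2 h1.contMDiffOn (fun z hz => hz)))
  refine h3.congr fun z hz => ?_
  have h4 := mfderivWithin_of_isOpen (I := 𝓘(ℝ, E)) (I' := 𝓘(ℝ, E))
    (f := (extChartAt 𝓘(ℝ, E) x₀).symm) ho hz
  exact congrArg (fun A : E →L[ℝ] E =>
    (α ((extChartAt 𝓘(ℝ, E) x₀).symm z) : E →L[ℝ] V) (A v)) h4.symm

theorem contDiffAt_formInChart [FiniteDimensional ℝ E] {α : ∀ x : M, Tan E x →L[ℝ] V}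
    (hα : SmoothForm α) (x₀ : M) :
    ContDiffAt ℝ ∞ (formInChart α x₀) (extChartAt 𝓘(ℝ, E) x₀ x₀) :=
  (contDiffOn_formInChart hα x₀).contDiffAt
    ((isOpen_extChartAt_target x₀).mem_nhds (mem_extChartAt_target x₀))

theorem diffl_form_apply [FiniteDimensional ℝ E] {α : ∀ x : M, Tan E x →L[ℝ] V}
    (hα : SmoothForm α) {X : ∀ x : M, Tan E x} (hX : SmoothVF X) (x : M) (v : Tan E x) :
    diffl (fun y => α y (X y)) x v
      = fderiv ℝ (formInChart α x) (extChartAt 𝓘(ℝ, E) x x) v (X x)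
        + α x (fderiv ℝ (fieldInChart X x) (extChartAt 𝓘(ℝ, E) x x) v) := by
  have h0 := congrArg (fun B : E →L[ℝ] V => B v) (diffl_eq_fderiv (mdiff (hα.apply hX) x))
  refine h0.trans ?_
  have h1 : (fun y => α y (X y)) ∘ (extChartAt 𝓘(ℝ, E) x).symm
      =ᶠ[𝓝 (extChartAt 𝓘(ℝ, E) x x)] fun y => formInChart α x y (fieldInChart X x y) := by
    filter_upwards [(isOpen_extChartAt_target x).mem_nhds (mem_extChartAt_target x)] with y hy
    exact (formInChart_fieldInChart α X hy).symm
  rw [h1.fderiv_eq, fderiv_clm_apply ((contDiffAt_formInChart hα x).differentiableAt (by simp))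
    (differentiableAt_fieldInChart hX x)]
  have h2 := formInChart_self α x
  have h3 := fieldInChart_self X x
  simp only [h2, h3]
  exact add_comm _ _

/-- The invariant formula `dα(X, Y) = X (α Y) - Y (α X) - α [X, Y]`. -/
theorem extd_apply [FiniteDimensional ℝ E] {α : ∀ x : M, Tan E x →L[ℝ] V}
    (hα : SmoothForm α) {X Y : ∀ x : M, Tan E x} (hX : SmoothVF X) (hY : SmoothVF Y) (x : M) :
    extd α x (X x) (Y x) = diffl (fun y => α y (Y y)) x (X x) - diffl (fun y => α y (X y)) x (Y x)
      - α x (VectorField.mlieBracket 𝓘(ℝ, E) X Y x) := by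
  rw [diffl_form_apply hα hX, diffl_form_apply hα hY, mlieBracket_eq_fieldInChart,
    VectorField.lieBracket, fieldInChart_self, fieldInChart_self]
  have h : ∀ A : E →L[ℝ] V, ∀ a b : E, A (a - b) = A a - A b := fun A a b => map_sub A a b
  have h' := h (α x) (fderiv ℝ (fieldInChart Y x) (extChartAt 𝓘(ℝ, E) x x) (X x))
    (fderiv ℝ (fieldInChart X x) (extChartAt 𝓘(ℝ, E) x x) (Y x))
  refine Eq.trans ?_ (congrArg (fun z => _ - z) h'.symm)
  change (fderiv ℝ (formInChart α x) (extChartAt 𝓘(ℝ, E) x x) (X x)) (Y x)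
    - (fderiv ℝ (formInChart α x) (extChartAt 𝓘(ℝ, E) x x) (Y x)) (X x) = _
  generalize (α x) (fderiv ℝ (fieldInChart Y x) (extChartAt 𝓘(ℝ, E) x x) (X x)) = p
  generalize (α x) (fderiv ℝ (fieldInChart X x) (extChartAt 𝓘(ℝ, E) x x) (Y x)) = q
  abel

/-- `d² = 0`: in the chart this is the symmetry of the second derivative. -/
theorem extd_diffl {f : M → V} (hf : ContMDiff 𝓘(ℝ, E) 𝓘(ℝ, V) ∞ f) (x : M) (X : Tan E x) :
    extd (fun y => diffl f y) x X = 0 := by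
  have hg : ContDiffOn ℝ ∞ (f ∘ (extChartAt 𝓘(ℝ, E) x).symm) (extChartAt 𝓘(ℝ, E) x).target := by
    rw [← contMDiffOn_iff_contDiffOn]
    exact hf.comp_contMDiffOn (contMDiffOn_extChartAt_symm x)
  have ht := (isOpen_extChartAt_target (I := 𝓘(ℝ, E)) x).mem_nhds (mem_extChartAt_target x)
  have h1 : formInChart (fun y => diffl f y) x =ᶠ[𝓝 (extChartAt 𝓘(ℝ, E) x x)]
      fderiv ℝ (f ∘ (extChartAt 𝓘(ℝ, E) x).symm) := by
    filter_upwards [ht] with y hy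
    have h := mfderiv_comp y (mdiff hf ((extChartAt 𝓘(ℝ, E) x).symm y))
      ((contMDiffAt_chart_symm x hy).mdifferentiableAt (by simp))
    rw [mfderiv_eq_fderiv] at h
    exact h.symm
  have h2 : IsSymmSndFDerivAt ℝ (f ∘ (extChartAt 𝓘(ℝ, E) x).symm) (extChartAt 𝓘(ℝ, E) x x) :=
    (hg.contDiffAt ht).isSymmSndFDerivAt (by simpa using two_le_infty)
  unfold extd
  rw [h1.fderiv_eq]
  ext Y
  exact sub_eq_zero.2 (h2 X Y)

/-- Vector fields act as derivations through their Lie bracket. -/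
theorem diffl_mlieBracket [FiniteDimensional ℝ E] {f : M → V}
    (hf : ContMDiff 𝓘(ℝ, E) 𝓘(ℝ, V) ∞ f)
    {X Y : ∀ x : M, Tan E x} (hX : SmoothVF X) (hY : SmoothVF Y) (x : M) :
    diffl f x (VectorField.mlieBracket 𝓘(ℝ, E) X Y x) =
      diffl (fun y => diffl f y (Y y)) x (X x) - diffl (fun y => diffl f y (X y)) x (Y x) := by
  have h := extd_apply (smoothForm_diffl hf) hX hY x
  rw [extd_diffl hf] at h
  exact (sub_eq_zero.1 h.symm).symm

end Chart

/-! ### Smooth linear systems and testing on global functions. -/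

section Local

variable {E : Type*} [NormedAddCommGroup E] [NormedSpace ℝ E]
  {M : Type*} [TopologicalSpace M] [ChartedSpace E M]
  {V W : Type*} [NormedAddCommGroup V] [NormedSpace ℝ V] [NormedAddCommGroup W] [NormedSpace ℝ W]

/-- A family of continuous linear maps on a finite-dimensional space is smooth when its values
are. -/
theorem contMDiffAt_clm_of_apply [FiniteDimensional ℝ V] {A : M → V →L[ℝ] W} {x : M}
    (h : ∀ v, ContMDiffAt 𝓘(ℝ, E) 𝓘(ℝ, W) ∞ (fun y => A y v) x) :
    ContMDiffAt 𝓘(ℝ, E) 𝓘(ℝ, V →L[ℝ] W) ∞ A x := by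
  let b := Module.finBasis ℝ V
  have hA : A = fun y => ∑ i, (ContinuousLinearMap.smulRightL ℝ V W
      (LinearMap.toContinuousLinearMap (b.coord i))) (A y (b i)) := by
    ext y v
    conv_lhs => rw [← b.sum_repr v, map_sum]
    simp
  rw [hA]
  refine ContMDiffAt.sum fun i _ => ?_
  exact (ContinuousLinearMap.contMDiff _).contMDiffAt.comp x (h (b i))

theorem contMDiff_clm_of_apply [FiniteDimensional ℝ V] {A : M → V →L[ℝ] W}
    (h : ∀ v, ContMDiff 𝓘(ℝ, E) 𝓘(ℝ, W) ∞ (fun y => A y v)) :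
    ContMDiff 𝓘(ℝ, E) 𝓘(ℝ, V →L[ℝ] W) ∞ A :=
  fun x => contMDiffAt_clm_of_apply fun v => h v x

/-- Solutions of smooth injective linear systems are smooth. -/
theorem contMDiffAt_of_injective_apply_eq [FiniteDimensional ℝ V] [FiniteDimensional ℝ W]
    {A : M → V →L[ℝ] W} {c : M → V} {b : M → W} {x : M}
    (hA : ContMDiffAt 𝓘(ℝ, E) 𝓘(ℝ, V →L[ℝ] W) ∞ A x)
    (hb : ContMDiffAt 𝓘(ℝ, E) 𝓘(ℝ, W) ∞ b x)
    (hinj : Function.Injective (A x)) (h : ∀ᶠ y in 𝓝 x, A y (c y) = b y) :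
    ContMDiffAt 𝓘(ℝ, E) 𝓘(ℝ, V) ∞ c x := by
  have := FiniteDimensional.complete ℝ V
  -- For a left inverse `B` of `A x`, the operator `B ∘ A y` is the identity at `y = x`, hence
  -- invertible nearby, and there `c = (B ∘ A)⁻¹ (B b)`.
  obtain ⟨B, hB⟩ := LinearMap.exists_leftInverse_of_injective (A x : V →ₗ[ℝ] W)
    (LinearMap.ker_eq_bot.2 hinj)
  let B' : W →L[ℝ] V := LinearMap.toContinuousLinearMap B
  have h1 : B'.comp (A x) = ContinuousLinearMap.id ℝ V := by
    ext v; exact LinearMap.congr_fun hB v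
  have hBA : ContMDiffAt 𝓘(ℝ, E) 𝓘(ℝ, V →L[ℝ] V) ∞ (fun y => B'.comp (A y)) x :=
    (ContinuousLinearMap.contMDiff (ContinuousLinearMap.compL ℝ V W V B')).contMDiffAt.comp x hA
  have hinv : ContDiffAt ℝ ∞ (ContinuousLinearMap.inverse : (V →L[ℝ] V) → (V →L[ℝ] V))
      (B'.comp (A x)) := by
    rw [h1]
    exact contDiffAt_map_inverse (ContinuousLinearEquiv.refl ℝ V)
  have h2 : ContMDiffAt 𝓘(ℝ, E) 𝓘(ℝ, V →L[ℝ] V) ∞ (fun y => (B'.comp (A y)).inverse) x :=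
    hinv.contMDiffAt.comp x hBA
  have h3 : ContMDiffAt 𝓘(ℝ, E) 𝓘(ℝ, V) ∞ (fun y => B' (b y)) x :=
    (ContinuousLinearMap.contMDiff B').contMDiffAt.comp x hb
  refine (h2.clm_apply h3).congr_of_eventuallyEq ?_
  have ho : ∀ᶠ y in 𝓝 x, (B'.comp (A y)).IsInvertible := by
    have := hBA.continuousAt.eventually
      ((ContinuousLinearEquiv.isOpen (𝕜 := ℝ) (E := V) (F := V)).mem_nhds
        (x := B'.comp (A x)) ⟨ContinuousLinearEquiv.refl ℝ V, h1.symm⟩)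
    exact this
  filter_upwards [h, ho] with y hy ⟨e, he⟩
  rw [← hy, ← he, ContinuousLinearMap.inverse_equiv]
  change c y = e.symm (B'.comp (A y) (c y))
  rw [← he]
  exact (e.symm_apply_apply _).symm

variable [IsManifold 𝓘(ℝ, E) ∞ M]

theorem mfderiv_chart_self (x : M) :
    (mfderiv 𝓘(ℝ, E) 𝓘(ℝ, E) (extChartAt 𝓘(ℝ, E) x) x : E →L[ℝ] E) = ContinuousLinearMap.id ℝ E := by
  have : IsManifold 𝓘(ℝ, E) 1 M := IsManifold.of_le (n := ∞) (by simp)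
  exact mfderiv_extChartAt_self

theorem contMDiffAt_field_iff_chart {X : ∀ x : M, Tan E x} {x : M} :
    ContMDiffAt 𝓘(ℝ, E) (𝓘(ℝ, E)).tangent ∞ (fun x => (⟨x, X x⟩ : TangentBundle 𝓘(ℝ, E) M)) x ↔
      ContMDiffAt 𝓘(ℝ, E) 𝓘(ℝ, E) ∞ (fun y => diffl (extChartAt 𝓘(ℝ, E) x) y (X y)) x := by
  have : IsManifold 𝓘(ℝ, E) 1 M := IsManifold.of_le (n := ∞) (by simp)
  rw [Bundle.contMDiffAt_section]
  refine Filter.EventuallyEq.contMDiffAt_iff ?_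
  filter_upwards [(chartAt E x).open_source.mem_nhds (mem_chart_source E x)] with y hy
  have h := TangentBundle.continuousLinearMapAt_trivializationAt (I := 𝓘(ℝ, E)) hy
  rw [← Bundle.Trivialization.continuousLinearMapAt_apply_of_mem (R := ℝ) _ (by simpa using hy)]
  exact congrArg (fun A : E →L[ℝ] E => A (X y)) h

variable [FiniteDimensional ℝ E] [T2Space M]

/-- Global smooth functions agreeing with the preferred chart near its centre. -/
theorem exists_contMDiff_eq_chart (x : M) : ∃ g : M → E, ContMDiff 𝓘(ℝ, E) 𝓘(ℝ, E) ∞ g ∧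
    g =ᶠ[𝓝 x] extChartAt 𝓘(ℝ, E) x := by
  let f : SmoothBumpFunction 𝓘(ℝ, E) x := Classical.arbitrary _
  refine ⟨fun y => f y • extChartAt 𝓘(ℝ, E) x y, f.contMDiff_smul (contMDiffOn_extChartAt), ?_⟩
  filter_upwards [f.eventuallyEq_one] with y hy
  rw [hy]
  simp

/-- Every covector is the differential of a global smooth function. -/
theorem exists_dfun_eq (x : M) (α : Cot E x) : ∃ f : M → ℝ, ContMDiff 𝓘(ℝ, E) 𝓘(ℝ, ℝ) ∞ f ∧
    dfun f x = α := by
  obtain ⟨g, hg, hgx⟩ := exists_contMDiff_eq_chart (E := E) x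
  let α' : E →L[ℝ] ℝ := α
  refine ⟨fun y => α' (g y), (ContinuousLinearMap.contMDiff α').comp hg, ?_⟩
  have h1 : (diffl g x : E →L[ℝ] E) = ContinuousLinearMap.id ℝ E :=
    (diffl_congr hgx).trans (mfderiv_chart_self x)
  ext v
  refine (diffl_clm_comp α' (mdiff hg x) v).trans ?_
  exact congrArg (fun A : E →L[ℝ] E => α' (A v)) h1

/-- Every covector is the differential of a global function, by a bump function, and covectors
separate tangent vectors. Identities between vector fields can thus be checked as identities between
derivations. -/
theorem tan_ext {x : M} {X Y : Tan E x}
    (h : ∀ f : M → ℝ, ContMDiff 𝓘(ℝ, E) 𝓘(ℝ, ℝ) ∞ f → diffl f x X = diffl f x Y) : X = Y := by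
  have h1 : ∀ α : E →L[ℝ] ℝ, α X = α Y := by
    intro α
    obtain ⟨f, hf, rfl⟩ := exists_dfun_eq (E := E) x α
    exact h f hf
  have h2 : ∀ a b : E, (∀ α : E →L[ℝ] ℝ, α a = α b) → a = b := fun a b hab =>
    (SeparatingDual.eq_iff_forall_dual_eq (R := ℝ)).2 hab
  exact h2 X Y h1

/-- The components of the field in a chart are its derivatives of the coordinate functions, which a
bump function extends to all of `M` without changing them near `x`. -/
theorem contMDiffAt_field_of_diffl {X : ∀ x : M, Tan E x} {x : M}
    (h : ∀ f : M → ℝ, ContMDiff 𝓘(ℝ, E) 𝓘(ℝ, ℝ) ∞ f →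
      ContMDiffAt 𝓘(ℝ, E) 𝓘(ℝ, ℝ) ∞ (fun y => diffl f y (X y)) x) :
    ContMDiffAt 𝓘(ℝ, E) (𝓘(ℝ, E)).tangent ∞ (fun x => (⟨x, X x⟩ : TangentBundle 𝓘(ℝ, E) M)) x := by
  rw [contMDiffAt_field_iff_chart]
  obtain ⟨g, hg, hgx⟩ := exists_contMDiff_eq_chart (E := E) x
  let b := Module.finBasis ℝ E
  let ℓ : ∀ i, E →L[ℝ] ℝ := fun i => LinearMap.toContinuousLinearMap (b.coord i)
  have h1 : ContMDiffAt 𝓘(ℝ, E) 𝓘(ℝ, E) ∞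
      (fun y => ∑ i, (diffl (fun z => ℓ i (g z)) y (X y)) • b i) x := by
    refine ContMDiffAt.sum fun i _ => ?_
    exact (h _ ((ContinuousLinearMap.contMDiff (ℓ i)).comp hg)).smul contMDiffAt_const
  refine h1.congr_of_eventuallyEq ?_
  filter_upwards [hgx.eventually_nhds] with y hy
  rw [← diffl_congr hy]
  conv_lhs => rw [← b.sum_repr (diffl g y (X y))]
  refine Finset.sum_congr rfl fun i _ => ?_
  rw [diffl_clm_comp (ℓ i) (mdiff hg y)]
  rfl

end Local

/-! ### Partial derivatives on a product of manifolds. -/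

section Partial

variable {E : Type*} [NormedAddCommGroup E] [NormedSpace ℝ E]
  {M : Type*} [TopologicalSpace M] [ChartedSpace E M] [IsManifold 𝓘(ℝ, E) ∞ M]
  {E' : Type*} [NormedAddCommGroup E'] [NormedSpace ℝ E']
  {N : Type*} [TopologicalSpace N] [ChartedSpace E' N] [IsManifold 𝓘(ℝ, E') ∞ N]
  {V : Type*} [NormedAddCommGroup V] [NormedSpace ℝ V]

/-- A function of two variables read in the preferred charts around `x₀` and `y₀`. -/
def inCharts (E E' : Type*) [NormedAddCommGroup E] [NormedSpace ℝ E]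
    [NormedAddCommGroup E'] [NormedSpace ℝ E'] {M : Type*} [TopologicalSpace M] [ChartedSpace E M]
    {N : Type*} [TopologicalSpace N] [ChartedSpace E' N]
    (H : M → N → V) (x₀ : M) (y₀ : N) : E × E' → V := fun q =>
  H ((extChartAt 𝓘(ℝ, E) x₀).symm q.1) ((extChartAt 𝓘(ℝ, E') y₀).symm q.2)

variable {H : M → N → V}

theorem contDiffAt_inCharts
    (hH : ContMDiff (𝓘(ℝ, E).prod 𝓘(ℝ, E')) 𝓘(ℝ, V) ∞ (fun q : M × N => H q.1 q.2))
    (x₀ : M) (y₀ : N) {q : E × E'} (h1 : q.1 ∈ (extChartAt 𝓘(ℝ, E) x₀).target)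
    (h2 : q.2 ∈ (extChartAt 𝓘(ℝ, E') y₀).target) :
    ContDiffAt ℝ ∞ (inCharts E E' H x₀ y₀) q := by
  rw [← contMDiffAt_iff_contDiffAt, modelWithCornersSelf_prod, ← chartedSpaceSelf_prod]
  exact hH.contMDiffAt.comp q (ContMDiffAt.prodMap (contMDiffAt_chart_symm x₀ h1)
    (contMDiffAt_chart_symm y₀ h2))

theorem diffl_left_eq
    (hH : ContMDiff (𝓘(ℝ, E).prod 𝓘(ℝ, E')) 𝓘(ℝ, V) ∞ (fun q : M × N => H q.1 q.2))
    (x₀ : M) (y₀ : N) {y : N} (hy : y ∈ (extChartAt 𝓘(ℝ, E') y₀).source) (u : Tan E x₀) :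
    diffl (fun x => H x y) x₀ u = fderiv ℝ (inCharts E E' H x₀ y₀)
      (extChartAt 𝓘(ℝ, E) x₀ x₀, extChartAt 𝓘(ℝ, E') y₀ y) (u, 0) := by
  have hs : ContMDiff 𝓘(ℝ, E) 𝓘(ℝ, V) ∞ (fun x => H x y) :=
    hH.comp (contMDiff_id.prodMk contMDiff_const)
  have h0 := congrArg (fun B : E →L[ℝ] V => B u) (diffl_eq_fderiv (mdiff hs x₀))
  refine h0.trans ?_
  have hd := (contDiffAt_inCharts hH x₀ y₀ (q := (extChartAt 𝓘(ℝ, E) x₀ x₀,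
    extChartAt 𝓘(ℝ, E') y₀ y)) (mem_extChartAt_target x₀)
    ((extChartAt 𝓘(ℝ, E') y₀).map_source hy)).differentiableAt (by simp)
  have h1 : (fun x => H x y) ∘ (extChartAt 𝓘(ℝ, E) x₀).symm
      = fun p => inCharts E E' H x₀ y₀ (p, extChartAt 𝓘(ℝ, E') y₀ y) := by
    ext p
    simp only [inCharts, Function.comp_apply, (extChartAt 𝓘(ℝ, E') y₀).left_inv hy]
  rw [h1]
  have h2 := hd.hasFDerivAt.comp (extChartAt 𝓘(ℝ, E) x₀ x₀)
    (hasFDerivAt_prodMk_left (𝕜 := ℝ) (extChartAt 𝓘(ℝ, E) x₀ x₀) (extChartAt 𝓘(ℝ, E') y₀ y))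
  exact congrArg (fun B : E →L[ℝ] V => B u) h2.fderiv

/-- In product charts this is a value of the full derivative of `H`, restricted to a slice. -/
theorem contMDiff_diffl_left
    (hH : ContMDiff (𝓘(ℝ, E).prod 𝓘(ℝ, E')) 𝓘(ℝ, V) ∞ (fun q : M × N => H q.1 q.2))
    (x₀ : M) (u : Tan E x₀) :
    ContMDiff 𝓘(ℝ, E') 𝓘(ℝ, V) ∞ (fun y => diffl (fun x => H x y) x₀ u) := by
  intro y₀
  have h1 := (contDiffAt_inCharts hH x₀ y₀ (q := (extChartAt 𝓘(ℝ, E) x₀ x₀,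
    extChartAt 𝓘(ℝ, E') y₀ y₀)) (mem_extChartAt_target x₀) (mem_extChartAt_target y₀)).fderiv_right
    (m := ∞) (by simp)
  have h2 : ContDiffAt ℝ ∞ (fun p => fderiv ℝ (inCharts E E' H x₀ y₀)
      (extChartAt 𝓘(ℝ, E) x₀ x₀, p) ((u, 0) : E × E')) (extChartAt 𝓘(ℝ, E') y₀ y₀) :=
    (h1.comp _ (contDiffAt_const.prodMk contDiffAt_id)).clm_apply contDiffAt_const
  have h3 := h2.contMDiffAt.comp y₀ (contMDiffAt_extChartAt (I := 𝓘(ℝ, E')) (n := ∞) (x := y₀))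
  refine h3.congr_of_eventuallyEq ?_
  filter_upwards [extChartAt_source_mem_nhds (I := 𝓘(ℝ, E')) y₀] with y hy
  exact diffl_left_eq hH x₀ y₀ hy u

theorem diffl_diffl_left
    (hH : ContMDiff (𝓘(ℝ, E).prod 𝓘(ℝ, E')) 𝓘(ℝ, V) ∞ (fun q : M × N => H q.1 q.2))
    (x₀ : M) (y₀ : N) (u : Tan E x₀) (v : Tan E' y₀) :
    diffl (fun y => diffl (fun x => H x y) x₀ u) y₀ v
      = fderiv ℝ (fderiv ℝ (inCharts E E' H x₀ y₀)) (extChartAt 𝓘(ℝ, E) x₀ x₀,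
        extChartAt 𝓘(ℝ, E') y₀ y₀) (0, v) (u, 0) := by
  have h0 := congrArg (fun B : E' →L[ℝ] V => B v)
    (diffl_eq_fderiv (mdiff (contMDiff_diffl_left hH x₀ u) y₀))
  refine h0.trans ?_
  have h1 : (fun y => diffl (fun x => H x y) x₀ u) ∘ (extChartAt 𝓘(ℝ, E') y₀).symm
      =ᶠ[𝓝 (extChartAt 𝓘(ℝ, E') y₀ y₀)] fun p => fderiv ℝ (inCharts E E' H x₀ y₀)
      (extChartAt 𝓘(ℝ, E) x₀ x₀, p) ((u, 0) : E × E') := by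
    filter_upwards [(isOpen_extChartAt_target y₀).mem_nhds (mem_extChartAt_target y₀)] with p hp
    have h := diffl_left_eq hH x₀ y₀ ((extChartAt 𝓘(ℝ, E') y₀).map_target hp) u
    rwa [(extChartAt 𝓘(ℝ, E') y₀).right_inv hp] at h
  rw [h1.fderiv_eq]
  have hd := ((contDiffAt_inCharts hH x₀ y₀ (q := (extChartAt 𝓘(ℝ, E) x₀ x₀,
    extChartAt 𝓘(ℝ, E') y₀ y₀)) (mem_extChartAt_target x₀) (mem_extChartAt_target y₀)).fderiv_right
    (m := ∞) (by simp)).differentiableAt (by simp)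
  have h2 := hd.hasFDerivAt.comp (extChartAt 𝓘(ℝ, E') y₀ y₀)
    (hasFDerivAt_prodMk_right (𝕜 := ℝ) (extChartAt 𝓘(ℝ, E) x₀ x₀) (extChartAt 𝓘(ℝ, E') y₀ y₀))
  have h3 := h2.clm_apply (hasFDerivAt_const ((u, 0) : E × E') (extChartAt 𝓘(ℝ, E') y₀ y₀))
  refine (congrArg (fun B : E' →L[ℝ] V => B v) h3.fderiv).trans ?_
  rw [ContinuousLinearMap.comp_zero, zero_add]
  rfl

/-- Mixed partial derivatives commute. -/
theorem diffl_diffl_comm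
    (hH : ContMDiff (𝓘(ℝ, E).prod 𝓘(ℝ, E')) 𝓘(ℝ, V) ∞ (fun q : M × N => H q.1 q.2))
    (x₀ : M) (y₀ : N) (u : Tan E x₀) (v : Tan E' y₀) :
    diffl (fun y => diffl (fun x => H x y) x₀ u) y₀ v
      = diffl (fun x => diffl (fun y => H x y) y₀ v) x₀ u := by
  have hH' : ContMDiff (𝓘(ℝ, E').prod 𝓘(ℝ, E)) 𝓘(ℝ, V) ∞ (fun q : N × M => H q.2 q.1) :=
    hH.comp (contMDiff_snd.prodMk contMDiff_fst)
  have h := contDiffAt_inCharts hH x₀ y₀ (q := (extChartAt 𝓘(ℝ, E) x₀ x₀,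
    extChartAt 𝓘(ℝ, E') y₀ y₀)) (mem_extChartAt_target x₀) (mem_extChartAt_target y₀)
  rw [diffl_diffl_left hH, (h.isSymmSndFDerivAt (by simpa using two_le_infty)).eq]
  have h0 := congrArg (fun B : E →L[ℝ] V => B u)
    (diffl_eq_fderiv (mdiff (contMDiff_diffl_left (H := fun y x => H x y) hH' y₀ v) x₀))
  refine Eq.symm (h0.trans ?_)
  have h1 : (fun x => diffl (fun y => H x y) y₀ v) ∘ (extChartAt 𝓘(ℝ, E) x₀).symm
      =ᶠ[𝓝 (extChartAt 𝓘(ℝ, E) x₀ x₀)] fun p => fderiv ℝ (inCharts E E' H x₀ y₀)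
      (p, extChartAt 𝓘(ℝ, E') y₀ y₀) ((0, v) : E × E') := by
    filter_upwards [(isOpen_extChartAt_target x₀).mem_nhds (mem_extChartAt_target x₀)] with p hp
    have hd := (contDiffAt_inCharts hH x₀ y₀ (q := (p,
      extChartAt 𝓘(ℝ, E') y₀ y₀)) hp (mem_extChartAt_target y₀)).differentiableAt (by simp)
    have hs : ContMDiff 𝓘(ℝ, E') 𝓘(ℝ, V) ∞ (fun y => H ((extChartAt 𝓘(ℝ, E) x₀).symm p) y) :=
      hH.comp (contMDiff_const.prodMk contMDiff_id)
    refine (congrArg (fun B : E' →L[ℝ] V => B v) (diffl_eq_fderiv (mdiff hs y₀))).trans ?_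
    exact congrArg (fun B : E' →L[ℝ] V => B v) (hd.hasFDerivAt.comp _
      (hasFDerivAt_prodMk_right (𝕜 := ℝ) p (extChartAt 𝓘(ℝ, E') y₀ y₀))).fderiv
  rw [h1.fderiv_eq]
  have hd := (h.fderiv_right (m := ∞) (by simp)).differentiableAt (by simp)
  have h2 := hd.hasFDerivAt.comp (extChartAt 𝓘(ℝ, E) x₀ x₀)
    (hasFDerivAt_prodMk_left (𝕜 := ℝ) (extChartAt 𝓘(ℝ, E) x₀ x₀) (extChartAt 𝓘(ℝ, E') y₀ y₀))
  have h3 := h2.clm_apply (hasFDerivAt_const ((0, v) : E × E') (extChartAt 𝓘(ℝ, E) x₀ x₀))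
  refine (congrArg (fun B : E →L[ℝ] V => B u) h3.fderiv).trans ?_
  rw [ContinuousLinearMap.comp_zero, zero_add]
  rfl

end Partial

/-! ### Brackets of fields related to an infinitesimal action. -/

section Related

variable {E : Type*} [NormedAddCommGroup E] [NormedSpace ℝ E] [FiniteDimensional ℝ E]
  {M : Type*} [TopologicalSpace M] [ChartedSpace E M] [IsManifold 𝓘(ℝ, E) ∞ M]
  {F : Type*} [NormedAddCommGroup F] [NormedSpace ℝ F] [FiniteDimensional ℝ F]
  {N : Type*} [TopologicalSpace N] [ChartedSpace F N] [IsManifold 𝓘(ℝ, F) ∞ N] [T2Space N]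
  {K : Type*} [NormedAddCommGroup K] [NormedSpace ℝ K] [FiniteDimensional ℝ K]

/-- Brackets of vector fields that are related to an action of a Lie algebra `K`. -/
theorem dmap_mlieBracket (r : ∀ y : N, K →L[ℝ] Tan F y) (hr : ∀ u, SmoothVF (fun y => r y u))
    (br : K → K → K) (hbr : ∀ u v y, VectorField.mlieBracket 𝓘(ℝ, F) (fun z => r z u)
      (fun z => r z v) y = r y (br u v))
    {J : M → N} (hJ : ContMDiff 𝓘(ℝ, E) 𝓘(ℝ, F) ∞ J)
    {X X' : ∀ x : M, Tan E x} (hX : SmoothVF X) (hX' : SmoothVF X') {w w' : M → K}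
    (hw : ContMDiff 𝓘(ℝ, E) 𝓘(ℝ, K) ∞ w) (hw' : ContMDiff 𝓘(ℝ, E) 𝓘(ℝ, K) ∞ w')
    (h : ∀ x, dmap E F J x (X x) = r (J x) (w x)) (h' : ∀ x, dmap E F J x (X' x) = r (J x) (w' x))
    (x : M) :
    dmap E F J x (VectorField.mlieBracket 𝓘(ℝ, E) X X' x)
      = r (J x) (br (w x) (w' x) + (diffl w' x (X x) - diffl w x (X' x))) := by
  refine tan_ext fun f hf => ?_
  -- With `g` one has `X(f ∘ J) = g(J)(w)`. A second derivative gives one term from the fields `r`,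
  -- which assemble to their bracket, and one from the coefficients `w`.
  let g : N → K →L[ℝ] ℝ := fun y => (diffl f y).comp (r y)
  have hg : ContMDiff 𝓘(ℝ, F) 𝓘(ℝ, K →L[ℝ] ℝ) ∞ g :=
    contMDiff_clm_of_apply fun u => (smoothForm_diffl hf).apply (hr u)
  have hgJ : ContMDiff 𝓘(ℝ, E) 𝓘(ℝ, K →L[ℝ] ℝ) ∞ (fun x => g (J x)) := hg.comp hJ
  have hfJ : ContMDiff 𝓘(ℝ, E) 𝓘(ℝ, ℝ) ∞ (fun x => f (J x)) := hf.comp hJ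
  have key : ∀ {Y : ∀ x : M, Tan E x} {z : M → K},
      (∀ x, dmap E F J x (Y x) = r (J x) (z x)) →
      (fun x => diffl (fun y => f (J y)) x (Y x)) = fun x => g (J x) (z x) := by
    intro Y z hY
    ext x
    rw [diffl_comp (mdiff hf _) (mdiff hJ x), hY]
    rfl
  have key2 : ∀ {z : M → K} (_ : ContMDiff 𝓘(ℝ, E) 𝓘(ℝ, K) ∞ z) {Y : ∀ x : M, Tan E x} {z' : M → K}
      (_ : ∀ x, dmap E F J x (Y x) = r (J x) (z' x)),
      diffl (fun x => g (J x) (z x)) x (Y x) =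
        diffl (fun y => diffl f y (r y (z x))) (J x) (r (J x) (z' x))
          + g (J x) (diffl z x (Y x)) := by
    intro z hz Y z' hY
    rw [diffl_clm_apply (mdiff hgJ x) (mdiff hz x), diffl_comp (mdiff hg _) (mdiff hJ x), hY]
    congr 1
    exact (diffl_clm_comp (ContinuousLinearMap.apply ℝ ℝ (z x)) (mdiff hg (J x)) _).symm
  rw [← diffl_comp (mdiff hf _) (mdiff hJ x), diffl_mlieBracket hfJ hX hX' x, key h, key h',
    key2 hw h', key2 hw' h, map_add, map_add, ← hbr, diffl_mlieBracket hf (hr _) (hr _)]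
  change _ = _ + g (J x) _
  rw [map_sub]
  abel

end Related

/-! ### Functions with vanishing differential on a connected manifold. -/

section Constant

variable {E : Type*} [NormedAddCommGroup E] [NormedSpace ℝ E]
  {M : Type*} [TopologicalSpace M] [ChartedSpace E M]

theorem mfderiv_eq_id {f : M → M} (h : f = id) (a : M) :
    (mfderiv 𝓘(ℝ, E) 𝓘(ℝ, E) f a : E →L[ℝ] E) = ContinuousLinearMap.id ℝ E := by
  subst h
  exact mfderiv_id

variable [IsManifold 𝓘(ℝ, E) ∞ M]

/-- A zero derivative on a ball inside the chart target gives local constancy, and connectedness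
makes it global. -/
theorem eq_of_diffl_eq_zero [ConnectedSpace M] {f : M → ℝ}
    (hf : ContMDiff 𝓘(ℝ, E) 𝓘(ℝ, ℝ) ∞ f) (h : ∀ a, diffl (E := E) f a = 0) (a b : M) : f a = f b := by
  have hl : IsLocallyConstant f := by
    rw [IsLocallyConstant.iff_eventually_eq]
    intro a
    let φ := extChartAt 𝓘(ℝ, E) a
    obtain ⟨ε, hε, hball⟩ := Metric.isOpen_iff.1 (isOpen_extChartAt_target (I := 𝓘(ℝ, E)) a) (φ a)
      (mem_extChartAt_target a)
    have hd : ∀ y ∈ Metric.ball (φ a) ε, HasFDerivWithinAt (f ∘ φ.symm) (0 : E →L[ℝ] ℝ)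
        (Metric.ball (φ a) ε) y := by
      intro y hy
      have h1 := (mdiff hf (φ.symm y)).hasMFDerivAt.comp y
        ((contMDiffAt_chart_symm a (hball hy)).mdifferentiableAt (by simp)).hasMFDerivAt
      have h2 : mfderiv 𝓘(ℝ, E) 𝓘(ℝ, ℝ) f (φ.symm y) = 0 := h _
      rw [h2] at h1
      exact HasFDerivAt.hasFDerivWithinAt h1.hasFDerivAt
    have hc : ∀ y ∈ Metric.ball (φ a) ε, f (φ.symm y) = f (φ.symm (φ a)) := fun y hy =>
      (convex_ball (φ a) ε).is_const_of_fderivWithin_eq_zero (𝕜 := ℝ)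
        (fun z hz => (hd z hz).differentiableWithinAt)
        (fun z hz => (hd z hz).fderivWithin (Metric.isOpen_ball.uniqueDiffWithinAt hz))
        hy (Metric.mem_ball_self hε)
    have hn : ∀ᶠ y in 𝓝 a, φ y ∈ Metric.ball (φ a) ε :=
      (continuousAt_extChartAt a).eventually (Metric.ball_mem_nhds _ hε)
    filter_upwards [hn, extChartAt_source_mem_nhds (I := 𝓘(ℝ, E)) a] with y hy hys
    have := hc _ hy
    rwa [φ.left_inv hys, φ.left_inv (mem_extChartAt_source a)] at this
  exact hl.apply_eq_of_preconnectedSpace a b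

end Constant

/-! ### Invariant vector fields, the adjoint action and invariance of the form. -/

section LieGroup

variable {E : Type*} [NormedAddCommGroup E] [NormedSpace ℝ E]
  {D : Type*} [TopologicalSpace D] [ChartedSpace E D] [Group D]
  {V : Type*} [NormedAddCommGroup V] [NormedSpace ℝ V]

/-- The left-invariant vector field of `u`. -/
def leftField (D : Type*) [TopologicalSpace D] [ChartedSpace E D] [Group D]
    (u : E) (a : D) : Tan E a :=
  (mfderiv 𝓘(ℝ, E) 𝓘(ℝ, E) (fun g : D => a * g) 1 : E →L[ℝ] E) u

/-- `u ↦ u^r(a)` as a continuous linear map. -/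
def rightFieldL (E : Type*) [NormedAddCommGroup E] [NormedSpace ℝ E]
    {D : Type*} [TopologicalSpace D] [ChartedSpace E D] [Group D] (a : D) : E →L[ℝ] Tan E a :=
  (mfderiv 𝓘(ℝ, E) 𝓘(ℝ, E) (fun g : D => g * a) 1 : E →L[ℝ] E)

/-- The adjoint action. -/
def adjoint (E : Type*) [NormedAddCommGroup E] [NormedSpace ℝ E]
    {D : Type*} [TopologicalSpace D] [ChartedSpace E D] [Group D] (a : D) : E →L[ℝ] E :=
  (mfderiv 𝓘(ℝ, E) 𝓘(ℝ, E) (fun g : D => a * g * a⁻¹) 1 : E →L[ℝ] E)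

theorem mfderiv_one_comp {f : D → D} (hf : MDifferentiableAt 𝓘(ℝ, E) 𝓘(ℝ, E) f 1) (h1 : f 1 = 1)
    {F : Type*} [NormedAddCommGroup F] [NormedSpace ℝ F]
    {N : Type*} [TopologicalSpace N] [ChartedSpace F N] {k : D → N}
    (hk : MDifferentiableAt 𝓘(ℝ, E) 𝓘(ℝ, F) k 1) (u : E) :
    (mfderiv 𝓘(ℝ, E) 𝓘(ℝ, F) (fun g => k (f g)) 1 : E →L[ℝ] F) u =
      (mfderiv 𝓘(ℝ, E) 𝓘(ℝ, F) k 1 : E →L[ℝ] F)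
        ((mfderiv 𝓘(ℝ, E) 𝓘(ℝ, E) f 1 : E →L[ℝ] E) u) :=
  mfderiv_comp_apply_of_eq (I' := 𝓘(ℝ, E)) (1 : D) (f := f) (y := 1) hk hf h1 u

theorem adjoint_one (u : E) : adjoint E (1 : D) u = u := by
  have h2 : (fun g : D => 1 * g * 1⁻¹) = id := by
    ext g; simp
  unfold adjoint
  rw [h2, mfderiv_id]
  rfl

theorem lieBr_swap (u v : E) : lieBr D u v = -lieBr D v u := VectorField.mlieBracket_swap_apply

theorem rightField_one (u : E) : rightField D u 1 = u := by
  have h : (mfderiv 𝓘(ℝ, E) 𝓘(ℝ, E) (fun g : D => g * 1) 1 : E →L[ℝ] E)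
      = ContinuousLinearMap.id ℝ E := mfderiv_eq_id (funext mul_one) 1
  exact congrArg (fun A : E →L[ℝ] E => A u) h

variable [LieGroup 𝓘(ℝ, E) ∞ D]

theorem contMDiff_mulRight (a : D) : ContMDiff 𝓘(ℝ, E) 𝓘(ℝ, E) ∞ (fun g : D => g * a) :=
  contMDiff_mul_right

theorem contMDiff_mulLeft (a : D) : ContMDiff 𝓘(ℝ, E) 𝓘(ℝ, E) ∞ (fun g : D => a * g) :=
  contMDiff_mul_left

theorem mfderiv_comp_rightField {F : Type*} [NormedAddCommGroup F] [NormedSpace ℝ F]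
    {N : Type*} [TopologicalSpace N] [ChartedSpace F N] {f : D → N} {a : D}
    (hf : MDifferentiableAt 𝓘(ℝ, E) 𝓘(ℝ, F) f a) (u : E) :
    ((mfderiv 𝓘(ℝ, E) 𝓘(ℝ, F) f a : E →L[ℝ] F) (rightField D u a) : F)
      = (mfderiv 𝓘(ℝ, E) 𝓘(ℝ, F) (fun g => f (g * a)) 1 : E →L[ℝ] F) u := by
  have h := mfderiv_comp_apply_of_eq (I' := 𝓘(ℝ, E)) (1 : D) (f := fun g : D => g * a) (y := a)
    hf (mdiff (contMDiff_mulRight a) 1) (one_mul a) u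
  exact h.symm

theorem mfderiv_comp_leftField {F : Type*} [NormedAddCommGroup F] [NormedSpace ℝ F]
    {N : Type*} [TopologicalSpace N] [ChartedSpace F N] {f : D → N} {a : D}
    (hf : MDifferentiableAt 𝓘(ℝ, E) 𝓘(ℝ, F) f a) (u : E) :
    ((mfderiv 𝓘(ℝ, E) 𝓘(ℝ, F) f a : E →L[ℝ] F) (leftField D u a) : F)
      = (mfderiv 𝓘(ℝ, E) 𝓘(ℝ, F) (fun g => f (a * g)) 1 : E →L[ℝ] F) u := by
  have h := mfderiv_comp_apply_of_eq (I' := 𝓘(ℝ, E)) (1 : D) (f := fun g : D => a * g) (y := a)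
    hf (mdiff (contMDiff_mulLeft a) 1) (mul_one a) u
  exact h.symm

theorem diffl_rightField {f : D → V} {a : D} (hf : MDifferentiableAt 𝓘(ℝ, E) 𝓘(ℝ, V) f a) (u : E) :
    diffl f a (rightField D u a) = diffl (E := E) (fun g => f (g * a)) 1 u :=
  mfderiv_comp_rightField hf u

theorem diffl_leftField {f : D → V} {a : D} (hf : MDifferentiableAt 𝓘(ℝ, E) 𝓘(ℝ, V) f a) (u : E) :
    diffl f a (leftField D u a) = diffl (E := E) (fun g => f (a * g)) 1 u :=
  mfderiv_comp_leftField hf u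

theorem contMDiff_conj (a : D) : ContMDiff 𝓘(ℝ, E) 𝓘(ℝ, E) ∞ (fun g : D => a * g * a⁻¹) :=
  (contMDiff_mulRight a⁻¹).comp (contMDiff_mulLeft a)

/-- Differentiate `(a g a⁻¹) a = a g` at `g = 1`. -/
theorem rightField_adjoint (a : D) (u : E) : rightField D (adjoint E a u) a = leftField D u a := by
  have h := mfderiv_one_comp (mdiff (contMDiff_conj a) 1) (by simp)
    (mdiff (contMDiff_mulRight a) 1) u
  have h2 : (fun g : D => a * g * a⁻¹ * a) = fun g => a * g := by
    ext g; simp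
  rw [h2] at h
  exact h.symm

theorem adjoint_adjoint_inv (a : D) (u : E) : adjoint E a (adjoint E a⁻¹ u) = u := by
  have h := mfderiv_one_comp (mdiff (contMDiff_conj a⁻¹) 1) (by simp)
    (mdiff (contMDiff_conj a) 1) u
  have h2 : (fun g : D => a * (a⁻¹ * g * a⁻¹⁻¹) * a⁻¹) = id := by
    ext g; simp [mul_assoc]
  rw [h2, mfderiv_id] at h
  exact h.symm

theorem mfderiv_mulRight_rightField (a : D) (u : E) :
    ((mfderiv 𝓘(ℝ, E) 𝓘(ℝ, E) (fun g : D => g * a⁻¹) a : E →L[ℝ] E) (rightField D u a) : E) = u := by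
  rw [mfderiv_comp_rightField (mdiff (contMDiff_mulRight a⁻¹) a)]
  exact congrArg (fun A : E →L[ℝ] E => A u)
    (mfderiv_eq_id (funext fun g => mul_inv_cancel_right g a) 1)

theorem rightField_injective (a : D) : Function.Injective (rightFieldL E a) := by
  intro u v h
  rw [← mfderiv_mulRight_rightField a u, ← mfderiv_mulRight_rightField a v]
  exact congrArg (mfderiv 𝓘(ℝ, E) 𝓘(ℝ, E) (fun g : D => g * a⁻¹) a : E →L[ℝ] E) h

variable [FiniteDimensional ℝ E]

theorem rightField_surjective (a : D) : Function.Surjective (rightFieldL E a) := by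
  let A : E →L[ℝ] E := rightFieldL E a
  have h : Function.Injective (A : E →ₗ[ℝ] E) := rightField_injective a
  exact LinearMap.injective_iff_surjective.1 h

variable [T2Space D]

/-- Applied to a function `f`, the field is the partial derivative at `g = 1` of `f(g a)`, which is
smooth in `a`. -/
theorem smoothVF_rightField (u : E) : SmoothVF (rightField D u) := by
  intro a
  refine contMDiffAt_field_of_diffl fun f hf => ?_
  have h : (fun a => diffl f a (rightField D u a)) = fun a =>
      diffl (E := E) (fun g => f (g * a)) 1 u :=
    funext fun a => diffl_rightField (mdiff hf a) u
  rw [h]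
  exact contMDiff_diffl_left (H := fun g a => f (g * a)) (hf.comp (contMDiff_mul 𝓘(ℝ, E) ∞)) 1 u a

theorem smoothVF_leftField (u : E) : SmoothVF (leftField D u) := by
  intro a
  refine contMDiffAt_field_of_diffl fun f hf => ?_
  have h : (fun a => diffl f a (leftField D u a)) = fun a =>
      diffl (E := E) (fun g => f (a * g)) 1 u :=
    funext fun a => diffl_leftField (mdiff hf a) u
  rw [h]
  exact contMDiff_diffl_left (H := fun g a => f (a * g))
    (hf.comp (contMDiff_snd.mul contMDiff_fst)) 1 u a

theorem contMDiff_diffl_rightField {f : D → V} (hf : ContMDiff 𝓘(ℝ, E) 𝓘(ℝ, V) ∞ f) (u : E) :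
    ContMDiff 𝓘(ℝ, E) 𝓘(ℝ, V) ∞ (fun a => diffl f a (rightField D u a)) :=
  (smoothForm_diffl hf).apply (smoothVF_rightField u)

/-- Right translation by `a` preserves right-invariant fields and replaces `f` near `a` by `g ↦ f(g
a)` near `1`, so both sides are computed at the identity, where the bracket of `𝔡` is defined. -/
theorem mlieBracket_rightField (u v : E) (a : D) :
    VectorField.mlieBracket 𝓘(ℝ, E) (rightField D u) (rightField D v) a
      = rightField D (lieBr D u v) a := by
  refine tan_ext fun f hf => ?_
  have hfa : ContMDiff 𝓘(ℝ, E) 𝓘(ℝ, ℝ) ∞ (fun g => f (g * a)) := hf.comp (contMDiff_mulRight a)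
  have h0 : ∀ (v : E) (g : D), diffl f (g * a) (rightField D v (g * a))
      = diffl (fun g => f (g * a)) g (rightField D v g) := by
    intro v g
    rw [diffl_rightField (mdiff hf _), diffl_rightField (mdiff hfa _)]
    simp only [mul_assoc]
  have h1 : ∀ u v : E, diffl (fun b => diffl f b (rightField D v b)) a (rightField D u a)
      = diffl (fun b => diffl (fun g => f (g * a)) b (rightField D v b)) (1 : D)
        (rightField D u 1) := by
    intro u v
    rw [diffl_rightField (mdiff (contMDiff_diffl_rightField hf v) a), rightField_one]
    simp only [h0]
  rw [diffl_mlieBracket hf (smoothVF_rightField u) (smoothVF_rightField v), h1, h1,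
    ← diffl_mlieBracket hfa (smoothVF_rightField u) (smoothVF_rightField v),
    diffl_rightField (mdiff hf a)]
  rfl

/-- The two iterated derivatives are the mixed partial derivatives of `(g, b) ↦ f(g a b)` at `(1,
1)`, because left and right translations commute. -/
theorem mlieBracket_rightField_leftField (w u : E) (a : D) :
    VectorField.mlieBracket 𝓘(ℝ, E) (rightField D w) (leftField D u) a = 0 := by
  refine tan_ext fun f hf => ?_
  rw [diffl_mlieBracket hf (smoothVF_rightField w) (smoothVF_leftField u), map_zero,
    diffl_rightField (mdiff ((smoothForm_diffl hf).apply (smoothVF_leftField u)) a),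
    diffl_leftField (mdiff (contMDiff_diffl_rightField hf w) a)]
  have h1 : (fun g => diffl f (g * a) (leftField D u (g * a)))
      = fun g => diffl (E := E) (fun b => f (g * a * b)) 1 u :=
    funext fun g => diffl_leftField (mdiff hf _) u
  have h2 : (fun b => diffl f (a * b) (rightField D w (a * b)))
      = fun b => diffl (E := E) (fun g => f (g * a * b)) 1 w := by
    funext b
    rw [diffl_rightField (mdiff hf _) w]
    simp only [mul_assoc]
  rw [h1, h2, sub_eq_zero]
  exact (diffl_diffl_comm (H := fun g b => f (g * a * b))
    (hf.comp ((contMDiff_fst.mul contMDiff_const).mul contMDiff_snd)) 1 1 w u).symm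

theorem lieBr_add_left (u u' v : E) : lieBr D (u + u') v = lieBr D u v + lieBr D u' v := by
  have := FiniteDimensional.complete ℝ E
  have : IsManifold 𝓘(ℝ, E) 2 D := IsManifold.of_le (n := ∞) two_le_infty
  have h : rightField D (u + u') = rightField D u + rightField D u' := by
    ext a; exact map_add (rightFieldL E a) u u'
  unfold lieBr
  rw [h]
  exact VectorField.mlieBracket_add_left
    ((smoothVF_rightField u 1).mdifferentiableAt (by simp))
    ((smoothVF_rightField u' 1).mdifferentiableAt (by simp))

theorem lieBr_add_right (u v v' : E) : lieBr D u (v + v') = lieBr D u v + lieBr D u v' := by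
  rw [lieBr_swap, lieBr_add_left, lieBr_swap u v, lieBr_swap u v', neg_add]

theorem lieBr_neg_left (u v : E) : lieBr D (-u) v = -lieBr D u v := by
  have h0 : lieBr D (0 : E) v = 0 := by simpa using lieBr_add_left (D := D) 0 0 v
  have h := lieBr_add_left (D := D) u (-u) v
  rw [add_neg_cancel, h0] at h
  exact (neg_eq_of_add_eq_zero_right h.symm).symm

theorem lieBr_neg_right (u v : E) : lieBr D u (-v) = -lieBr D u v := by
  rw [lieBr_swap, lieBr_neg_left, lieBr_swap u v]

/-- By `rightField_adjoint`, `Ad_a u` is the coefficient vector of a smooth field in the frame of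
right-invariant fields, that is, the solution of a smooth injective linear system. -/
theorem contMDiff_adjoint (u : E) :
    ContMDiff 𝓘(ℝ, E) 𝓘(ℝ, E) ∞ (fun a : D => adjoint E a u) := by
  intro a
  obtain ⟨g, hg, hga⟩ := exists_contMDiff_eq_chart (E := E) a
  let A : D → E →L[ℝ] E := fun y => (diffl g y).comp (rightFieldL E y)
  have hA : ContMDiff 𝓘(ℝ, E) 𝓘(ℝ, E →L[ℝ] E) ∞ A :=
    contMDiff_clm_of_apply fun v => contMDiff_diffl_rightField hg v
  have hb := (smoothForm_diffl hg).apply (smoothVF_leftField (D := D) u)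
  refine contMDiffAt_of_injective_apply_eq (hA a) (hb a) ?_ (Eventually.of_forall fun y => ?_)
  · have h1 : (diffl g a : E →L[ℝ] E) = ContinuousLinearMap.id ℝ E :=
      (diffl_congr hga).trans (mfderiv_chart_self a)
    have h2 : A a = rightFieldL E a := congrArg (fun B : E →L[ℝ] E => B.comp (rightFieldL E a)) h1
    rw [h2]
    exact rightField_injective a
  · exact congrArg (diffl g y) (rightField_adjoint y u)

/-- Write the left-invariant field of `u` as the right-invariant one with variable coefficient `Ad_b
u`, and expand its bracket with the right-invariant field of `w`, which is zero. The minus sign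
comes from defining the bracket by right-invariant fields. -/
theorem diffl_adjoint (u w : E) (a : D) :
    diffl (fun b => adjoint E b u) a (rightField D w a) = -lieBr D w (adjoint E a u) := by
  have h := dmap_mlieBracket (E := E) (M := D) (fun a => rightFieldL E a)
    (fun u => smoothVF_rightField u) (lieBr D) (fun u v a => mlieBracket_rightField u v a)
    contMDiff_id (smoothVF_rightField w) (smoothVF_leftField u) (w := fun _ => w)
    contMDiff_const (contMDiff_adjoint u)
    (fun x => congrArg (fun A : E →L[ℝ] E => A (rightField D w x)) mfderiv_id)
    (fun x => (congrArg (fun A : E →L[ℝ] E => A (leftField D u x)) mfderiv_id).trans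
      (rightField_adjoint x u).symm) a
  rw [mlieBracket_rightField_leftField, map_zero, diffl_const] at h
  have h2 := rightField_injective (E := E) a (h.symm.trans (map_zero _).symm)
  rw [zero_apply, sub_zero] at h2
  exact (neg_eq_of_add_eq_zero_right h2).symm

/-- An `ad`-invariant form on the Lie algebra of a connected group is `Ad`-invariant. -/
theorem form_adjoint [ConnectedSpace D] (P : ManinPair E D) (a : D) (u v : E) :
    P.form (adjoint E a u) (adjoint E a v) = P.form u v := by
  have hs : ContMDiff 𝓘(ℝ, E) 𝓘(ℝ, ℝ) ∞ (fun a : D => P.form (adjoint E a u) (adjoint E a v)) :=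
    ((ContinuousLinearMap.contMDiff P.form).comp (contMDiff_adjoint u)).clm_apply
      (contMDiff_adjoint v)
  have h := eq_of_diffl_eq_zero hs (fun a => ?_) a 1
  · rwa [adjoint_one, adjoint_one] at h
  · ext X
    -- Right-invariant fields span every tangent space, so it is enough to differentiate along them.
    -- There the two terms cancel by `ad`-invariance.
    obtain ⟨w, rfl⟩ := rightField_surjective (E := E) a X
    have h1 := diffl_bilin P.form (mdiff (contMDiff_adjoint (D := D) u) a)
      (mdiff (contMDiff_adjoint (D := D) v) a) (rightField D w a)
    refine h1.trans ?_
    rw [diffl_adjoint, diffl_adjoint, lieBr_swap w (adjoint E a u), neg_neg, P.invariant, map_neg]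
    exact add_neg_cancel _

end LieGroup

/-! ### The homogeneous space `D/G`, local sections and the dressing action. -/

section Homogeneous

variable {E : Type*} [NormedAddCommGroup E] [NormedSpace ℝ E]
  {D : Type*} [TopologicalSpace D] [ChartedSpace E D] [Group D]
  {F : Type*} [NormedAddCommGroup F] [NormedSpace ℝ F]
  {V : Type*} [NormedAddCommGroup V] [NormedSpace ℝ V]
  {G : Subgroup D} [ChartedSpace F (D ⧸ G)]

/-- The quotient map is open and its equivalence relation `a⁻¹ b ∈ G` is closed. -/
theorem t2Space_quotient [LieGroup 𝓘(ℝ, E) ∞ D] (hG : IsClosed (G : Set D)) : T2Space (D ⧸ G) := by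
  have : IsTopologicalGroup D := topologicalGroup_of_lieGroup 𝓘(ℝ, E) ∞
  rw [t2Space_iff_of_isOpenQuotientMap (QuotientGroup.isOpenQuotientMap_mk (N := G))]
  have h : {q : D × D | (QuotientGroup.mk q.1 : D ⧸ G) = QuotientGroup.mk q.2}
      = (fun q : D × D => q.1⁻¹ * q.2) ⁻¹' (G : Set D) := by
    ext q
    exact QuotientGroup.eq
  rw [h]
  exact hG.preimage (by fun_prop)

/-- A submersion `D → D/G` has local smooth sections. -/
theorem exists_local_section
    (hp : Manifold.IsSubmersion 𝓘(ℝ, E) 𝓘(ℝ, F) ∞ (QuotientGroup.mk : D → D ⧸ G)) (a : D) :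
    ∃ τ : D ⧸ G → D, ContMDiffAt 𝓘(ℝ, F) 𝓘(ℝ, E) ∞ τ (QuotientGroup.mk a) ∧
      τ (QuotientGroup.mk a) = a ∧ ∀ᶠ y in 𝓝 (QuotientGroup.mk a : D ⧸ G),
        (QuotientGroup.mk (τ y) : D ⧸ G) = y := by
  obtain ⟨C, _, _, hC⟩ := hp
  have h := hC a
  let φ := h.domChart
  let ψ := h.codChart
  -- In adapted charts the projection is `F × C → F`. The section freezes the `C`-coordinate at its
  -- value for `a`.
  let c : C := (h.equiv (φ a)).2
  let k : D ⧸ G → E := fun y => h.equiv.symm (ψ y, c)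
  have hw : ∀ z ∈ φ.target, ψ (QuotientGroup.mk (φ.symm z)) = (h.equiv z).1 := by
    intro z hz
    have hz' : z ∈ (h.domChart.extend 𝓘(ℝ, E)).target := by simpa using hz
    simpa using h.writtenInCharts hz'
  have hka : k (QuotientGroup.mk a) = φ a := by
    have h1 := hw (φ a) (φ.map_source h.mem_domChart_source)
    rw [φ.left_inv h.mem_domChart_source] at h1
    change h.equiv.symm (ψ (QuotientGroup.mk a), (h.equiv (φ a)).2) = φ a
    rw [h1]
    exact h.equiv.symm_apply_apply _
  have hψ : ContMDiffAt 𝓘(ℝ, F) 𝓘(ℝ, F) ∞ ψ (QuotientGroup.mk a) :=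
    contMDiffAt_of_mem_maximalAtlas h.codChart_mem_maximalAtlas h.mem_codChart_source
  have hk : ContMDiffAt 𝓘(ℝ, F) 𝓘(ℝ, E) ∞ k (QuotientGroup.mk a) :=
    (ContinuousLinearMap.contMDiff (h.equiv.symm : F × C →L[ℝ] E)).contMDiffAt.comp _
      (hψ.prodMk_space contMDiffAt_const)
  have hs : ContMDiffAt 𝓘(ℝ, E) 𝓘(ℝ, E) ∞ φ.symm (φ a) :=
    contMDiffAt_symm_of_mem_maximalAtlas h.domChart_mem_maximalAtlas
      (φ.map_source h.mem_domChart_source)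
  have hkt : ∀ᶠ y in 𝓝 (QuotientGroup.mk a : D ⧸ G), k y ∈ φ.target :=
    hk.continuousAt.eventually (by
      rw [hka]
      exact φ.open_target.mem_nhds (φ.map_source h.mem_domChart_source))
  refine ⟨fun y => φ.symm (k y), ContMDiffAt.comp_of_eq hs hk hka, ?_, ?_⟩
  · simp only [hka]
    exact φ.left_inv h.mem_domChart_source
  · filter_upwards [hkt, ψ.open_source.mem_nhds h.mem_codChart_source] with y hy hyψ
    have h1 := hw (k y) hy
    have h2 : (h.equiv (k y)).1 = ψ y := by
      change (h.equiv (h.equiv.symm (ψ y, c))).1 = ψ y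
      rw [h.equiv.apply_symm_apply]
    rw [h2] at h1
    exact ψ.injOn (h.mapsto_domChart_source_codChart_source (φ.map_target hy)) hyψ h1

/-- Tangent vectors in the kernel of the projection are velocities of curves in `G`. -/
theorem exists_curve_of_mem_ker
    (hp : Manifold.IsSubmersion 𝓘(ℝ, E) 𝓘(ℝ, F) ∞ (QuotientGroup.mk : D → D ⧸ G)) (v : E)
    (hv : (mfderiv 𝓘(ℝ, E) 𝓘(ℝ, F) (QuotientGroup.mk : D → D ⧸ G) 1 : E →L[ℝ] F) v = 0) :
    ∃ γ : ℝ → D, ContMDiff 𝓘(ℝ, ℝ) 𝓘(ℝ, E) ∞ γ ∧ γ 0 = 1 ∧ (∀ t, γ t ∈ G) ∧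
      (mfderiv 𝓘(ℝ, ℝ) 𝓘(ℝ, E) γ 0 : ℝ →L[ℝ] E) 1 = v := by
  have hpd : MDifferentiableAt 𝓘(ℝ, E) 𝓘(ℝ, F) (QuotientGroup.mk : D → D ⧸ G) 1 :=
    mdiff hp.contMDiff 1
  obtain ⟨C, _, _, hC⟩ := hp
  have h := hC 1
  let φ := h.domChart
  let ψ := h.codChart
  have h1s : (1 : D) ∈ φ.source := h.mem_domChart_source
  have hw : ∀ z ∈ φ.target, ψ (QuotientGroup.mk (φ.symm z)) = (h.equiv z).1 := by
    intro z hz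
    have hz' : z ∈ (h.domChart.extend 𝓘(ℝ, E)).target := by simpa using hz
    simpa using h.writtenInCharts hz'
  have hφ : MDifferentiableAt 𝓘(ℝ, E) 𝓘(ℝ, E) φ 1 :=
    (contMDiffAt_of_mem_maximalAtlas h.domChart_mem_maximalAtlas h1s).mdifferentiableAt (by simp)
  have hψ : MDifferentiableAt 𝓘(ℝ, F) 𝓘(ℝ, F) ψ (QuotientGroup.mk 1) :=
    (contMDiffAt_of_mem_maximalAtlas h.codChart_mem_maximalAtlas
      h.mem_codChart_source).mdifferentiableAt (by simp)
  let v' : E := (mfderiv 𝓘(ℝ, E) 𝓘(ℝ, E) φ 1 : E →L[ℝ] E) v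
  -- In adapted charts the projection is the first coordinate, so a vector in its kernel has no
  -- first component and the line in direction `v'` stays in the fibre.
  have hv' : (h.equiv v').1 = 0 := by
    have e1 : (fun g : D => ψ (QuotientGroup.mk g)) =ᶠ[𝓝 1] fun g => (h.equiv (φ g)).1 := by
      filter_upwards [φ.open_source.mem_nhds h1s] with g hg
      have := hw (φ g) (φ.map_source hg)
      rwa [φ.left_inv hg] at this
    have e2 := diffl_congr (E := E) e1
    let A : E →L[ℝ] F := (ContinuousLinearMap.fst ℝ F C).comp (h.equiv : E →L[ℝ] F × C)
    have e3 := diffl_clm_comp A hφ v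
    have e4 := mfderiv_comp_apply (1 : D) hψ hpd v
    have e5 : ((mfderiv 𝓘(ℝ, F) 𝓘(ℝ, F) ψ (QuotientGroup.mk 1) : F →L[ℝ] F)
      ((mfderiv 𝓘(ℝ, E) 𝓘(ℝ, F) (QuotientGroup.mk : D → D ⧸ G) 1 : E →L[ℝ] F) v)) = 0 := by
      rw [hv, map_zero]
    have e6 : diffl (E := E) (fun g : D => ψ (QuotientGroup.mk g)) 1 v = 0 := e4.trans e5
    rw [e2] at e6
    exact e3.symm.trans e6
  obtain ⟨ε, hε, hball⟩ := Metric.isOpen_iff.1 φ.open_target (φ 1) (φ.map_source h1s)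
  obtain ⟨δ, hδ, hδv⟩ : ∃ δ > 0, δ * ‖v'‖ < ε := by
    -- The summand `1` also covers `v' = 0`.
    refine ⟨ε / (‖v'‖ + 1), by positivity, ?_⟩
    rw [div_mul_eq_mul_div, div_lt_iff₀ (by positivity)]
    nlinarith [norm_nonneg v']
  -- The curve must be defined on all of `ℝ`. The factor `δ sin(t/δ)` is bounded by `δ`, so `κ`
  -- never leaves the chart, and it has derivative `1` at `0`.
  let κ : ℝ → E := fun t => φ 1 + (δ * Real.sin (t / δ)) • v'
  have hκt : ∀ t, κ t ∈ φ.target := by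
    intro t
    apply hball
    rw [Metric.mem_ball, dist_eq_norm, add_sub_cancel_left, norm_smul, Real.norm_eq_abs, abs_mul,
      abs_of_pos hδ]
    refine lt_of_le_of_lt ?_ hδv
    have := Real.abs_sin_le_one (t / δ)
    have h0 : δ * |Real.sin (t / δ)| ≤ δ := by nlinarith
    exact mul_le_mul_of_nonneg_right h0 (norm_nonneg _)
  have hκ : ContDiff ℝ ∞ κ := by
    have : ContDiff ℝ ∞ (fun t : ℝ => δ * Real.sin (t / δ)) :=
      contDiff_const.mul (Real.contDiff_sin.comp (contDiff_id.div_const δ))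
    exact contDiff_const.add (this.smul contDiff_const)
  have hκ0 : κ 0 = φ 1 := by simp [κ]
  have hκd : HasDerivAt κ v' 0 := by
    have h1 : HasDerivAt (fun t : ℝ => δ * Real.sin (t / δ)) (δ * (Real.cos (0 / δ) * (1 / δ))) 0 :=
      (((hasDerivAt_id' (0 : ℝ)).div_const δ).sin).const_mul δ
    have h2 := (h1.smul_const v').const_add (φ 1)
    rwa [zero_div, Real.cos_zero, one_mul, mul_one_div_cancel hδ.ne', one_smul] at h2
  have hs : ∀ z ∈ φ.target, ContMDiffAt 𝓘(ℝ, E) 𝓘(ℝ, E) ∞ φ.symm z := fun z hz =>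
    contMDiffAt_symm_of_mem_maximalAtlas h.domChart_mem_maximalAtlas hz
  refine ⟨fun t => φ.symm (κ t), fun t => (hs _ (hκt t)).comp t hκ.contMDiff.contMDiffAt, ?_, ?_, ?_⟩
  · simp only [hκ0]
    exact φ.left_inv h1s
  · intro t
    have h1 := hw _ (hκt t)
    have h2 := hw (φ 1) (φ.map_source h1s)
    rw [φ.left_inv h1s] at h2
    have h3 : (h.equiv (κ t)).1 = (h.equiv (φ 1)).1 := by
      change (h.equiv (φ 1 + (δ * Real.sin (t / δ)) • v')).1 = _
      rw [map_add, map_smul, Prod.fst_add, Prod.smul_fst, hv', smul_zero, add_zero]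
    -- Equal coordinates in the chart `ψ` give equal cosets, and the coset of `1` is `G`.
    have h4 := ψ.injOn (h.mapsto_domChart_source_codChart_source (φ.map_target (hκt t)))
      h.mem_codChart_source (h1.trans (h3.trans h2.symm))
    have h5 := QuotientGroup.eq.1 h4.symm
    simpa using h5
  · have e1 := mfderiv_comp_apply_of_eq (I' := 𝓘(ℝ, E)) (0 : ℝ) (f := κ) (y := φ 1)
      ((hs _ (φ.map_source h1s)).mdifferentiableAt (by simp))
      (hκd.hasFDerivAt.hasMFDerivAt.mdifferentiableAt) hκ0 (1 : ℝ)
    have e2 : (mfderiv 𝓘(ℝ, ℝ) 𝓘(ℝ, E) κ 0 : ℝ →L[ℝ] E) 1 = v' := by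
      rw [hκd.hasFDerivAt.hasMFDerivAt.mfderiv]
      exact one_smul ℝ v'
    have e3 := mfderiv_comp_apply (I' := 𝓘(ℝ, E)) (1 : D) (f := φ) (g := φ.symm)
      ((hs _ (φ.map_source h1s)).mdifferentiableAt (by simp)) hφ v
    have e4 : (φ.symm ∘ φ : D → D) =ᶠ[𝓝 1] id := by
      filter_upwards [φ.open_source.mem_nhds h1s] with g hg
      exact φ.left_inv hg
    rw [e4.mfderiv_eq] at e3
    refine (e1.trans ((congrArg _ e2).trans (e3.symm.trans ?_)))
    exact congrArg (fun A : E →L[ℝ] E => A v) mfderiv_id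

/-- Locally `f` is its lift to `D` composed with a smooth section of the submersion. -/
theorem contMDiff_of_comp_mk {F' : Type*} [NormedAddCommGroup F'] [NormedSpace ℝ F']
    {N : Type*} [TopologicalSpace N] [ChartedSpace F' N]
    (hp : Manifold.IsSubmersion 𝓘(ℝ, E) 𝓘(ℝ, F) ∞ (QuotientGroup.mk : D → D ⧸ G)) {f : D ⧸ G → N}
    (hf : ContMDiff 𝓘(ℝ, E) 𝓘(ℝ, F') ∞ (fun a : D => f (QuotientGroup.mk a))) :
    ContMDiff 𝓘(ℝ, F) 𝓘(ℝ, F') ∞ f := by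
  intro y
  obtain ⟨a, rfl⟩ := QuotientGroup.mk_surjective y
  obtain ⟨τ, hτ, hτa, hτp⟩ := exists_local_section hp a
  refine (ContMDiffAt.comp (QuotientGroup.mk a) (hf (τ (QuotientGroup.mk a))) hτ
    ).congr_of_eventuallyEq ?_
  filter_upwards [hτp] with z hz
  exact (congrArg f hz).symm

variable [LieGroup 𝓘(ℝ, E) ∞ D]

theorem contMDiff_smul_quotient
    (hp : Manifold.IsSubmersion 𝓘(ℝ, E) 𝓘(ℝ, F) ∞ (QuotientGroup.mk : D → D ⧸ G)) (a : D) :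
    ContMDiff 𝓘(ℝ, F) 𝓘(ℝ, F) ∞ (fun y : D ⧸ G => a • y) :=
  contMDiff_of_comp_mk hp (hp.contMDiff.comp (contMDiff_mulLeft a))

theorem dressing_mk
    (hp : Manifold.IsSubmersion 𝓘(ℝ, E) 𝓘(ℝ, F) ∞ (QuotientGroup.mk : D → D ⧸ G)) (a : D) (u : E) :
    dressing E F (QuotientGroup.mk a : D ⧸ G) u
      = (mfderiv 𝓘(ℝ, E) 𝓘(ℝ, F) (QuotientGroup.mk : D → D ⧸ G) a : E →L[ℝ] F)
        (rightField D u a) :=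
  (mfderiv_comp_rightField (mdiff hp.contMDiff a) u).symm

theorem diffl_dressing
    (hp : Manifold.IsSubmersion 𝓘(ℝ, E) 𝓘(ℝ, F) ∞ (QuotientGroup.mk : D → D ⧸ G)) {f : D ⧸ G → V}
    (hf : ContMDiff 𝓘(ℝ, F) 𝓘(ℝ, V) ∞ f) (a : D) (u : E) :
    diffl f (QuotientGroup.mk a) (dressing E F (QuotientGroup.mk a : D ⧸ G) u)
      = diffl (fun b : D => f (QuotientGroup.mk b)) a (rightField D u a) := by
  rw [dressing_mk hp]
  exact (diffl_comp (mdiff hf _) (mdiff hp.contMDiff a) _).symm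

/-- The kernel of the dressing action is isotropic. -/
theorem form_eq_zero_of_dressing_eq_zero [FiniteDimensional ℝ E] [T2Space D] [ConnectedSpace D]
    (P : ManinPair E D) (hG : P.IsIntegratedBy G)
    (hp : Manifold.IsSubmersion 𝓘(ℝ, E) 𝓘(ℝ, F) ∞ (QuotientGroup.mk : D → D ⧸ G))
    (y : D ⧸ G) {u v : E} (hu : dressing E F y u = 0) (hv : dressing E F y v = 0) :
    P.form u v = 0 := by
  obtain ⟨a, rfl⟩ := QuotientGroup.mk_surjective y
  -- The right-invariant field of `u` at `a` is the left-invariant field of `Ad_{a⁻¹} u`.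
  -- Translating by `a⁻¹` moves the kernel condition to the base point, where the kernel lies in
  -- `𝔤`; so the kernel over `aG` lies in `Ad_a 𝔤`.
  have key : ∀ u : E, dressing E F (QuotientGroup.mk a : D ⧸ G) u = 0 → adjoint E a⁻¹ u ∈ P.g := by
    intro u hu
    rw [hG.mem_g]
    refine exists_curve_of_mem_ker hp _ ?_
    have h0 : dressing E F (QuotientGroup.mk a : D ⧸ G) u
        = (mfderiv 𝓘(ℝ, E) 𝓘(ℝ, F) (QuotientGroup.mk : D → D ⧸ G) a : E →L[ℝ] F)
          (leftField D (adjoint E a⁻¹ u) a) := by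
      rw [dressing_mk hp, ← rightField_adjoint, adjoint_adjoint_inv]
    rw [mfderiv_comp_leftField (mdiff hp.contMDiff a)] at h0
    have hd : MDifferentiableAt 𝓘(ℝ, E) 𝓘(ℝ, F)
        (fun g : D => (QuotientGroup.mk (a * g) : D ⧸ G)) 1 :=
      mdiff (hp.contMDiff.comp (contMDiff_mulLeft a)) 1
    have h1 := mfderiv_comp_apply (I' := 𝓘(ℝ, F)) (1 : D)
      (mdiff (contMDiff_smul_quotient hp a⁻¹) (QuotientGroup.mk (a * 1))) hd (adjoint E a⁻¹ u)
    have h2 : (fun y : D ⧸ G => a⁻¹ • y) ∘ (fun g : D => (QuotientGroup.mk (a * g) : D ⧸ G))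
        = QuotientGroup.mk := by
      ext g
      change (QuotientGroup.mk (a⁻¹ * (a * g)) : D ⧸ G) = _
      rw [inv_mul_cancel_left]
    rw [h2] at h1
    refine h1.trans ?_
    have h3 : (mfderiv 𝓘(ℝ, E) 𝓘(ℝ, F) (fun g : D => (QuotientGroup.mk (a * g) : D ⧸ G)) 1 :
      E →L[ℝ] F) (adjoint E a⁻¹ u) = 0 := h0.symm.trans hu
    exact (congrArg (mfderiv 𝓘(ℝ, F) 𝓘(ℝ, F) (fun y : D ⧸ G => a⁻¹ • y)
      (QuotientGroup.mk (a * 1)) : F →L[ℝ] F) h3).trans (map_zero _)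
  rw [← adjoint_adjoint_inv a u, ← adjoint_adjoint_inv a v, form_adjoint]
  exact (P.lagrangian _).1 (key u hu) _ (key v hv)

variable [IsManifold 𝓘(ℝ, F) ∞ (D ⧸ G)] [FiniteDimensional ℝ E] [T2Space D]
  [FiniteDimensional ℝ F] [T2Space (D ⧸ G)]

/-- Applied to a function and lifted to `D`, the dressing field becomes the corresponding
right-invariant field, and smoothness descends along the submersion. -/
theorem smoothVF_dressing
    (hp : Manifold.IsSubmersion 𝓘(ℝ, E) 𝓘(ℝ, F) ∞ (QuotientGroup.mk : D → D ⧸ G)) (u : E) :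
    SmoothVF (fun y : D ⧸ G => dressing E F y u) := by
  intro y
  refine contMDiffAt_field_of_diffl fun f hf => ?_
  refine contMDiff_of_comp_mk hp (f := fun y => diffl f y (dressing E F y u)) ?_ y
  simp only [diffl_dressing hp hf]
  exact contMDiff_diffl_rightField (hf.comp hp.contMDiff) u

/-- Dressing fields are related by the projection to right-invariant fields, which also define the
bracket of `𝔡`; hence there is no sign. -/
theorem mlieBracket_dressing
    (hp : Manifold.IsSubmersion 𝓘(ℝ, E) 𝓘(ℝ, F) ∞ (QuotientGroup.mk : D → D ⧸ G)) (u v : E)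
    (y : D ⧸ G) :
    VectorField.mlieBracket 𝓘(ℝ, F) (fun y : D ⧸ G => dressing E F y u)
      (fun y => dressing E F y v) y = dressing E F y (lieBr D u v) := by
  refine tan_ext fun f hf => ?_
  obtain ⟨a, rfl⟩ := QuotientGroup.mk_surjective y
  have hfp : ContMDiff 𝓘(ℝ, E) 𝓘(ℝ, ℝ) ∞ (fun b : D => f (QuotientGroup.mk b)) :=
    hf.comp hp.contMDiff
  have hd : ∀ u : E, ContMDiff 𝓘(ℝ, F) 𝓘(ℝ, ℝ) ∞ (fun y => diffl f y (dressing E F y u)) :=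
    fun u => (smoothForm_diffl hf).apply (smoothVF_dressing hp u)
  rw [diffl_mlieBracket hf (smoothVF_dressing hp u) (smoothVF_dressing hp v),
    diffl_dressing hp (hd u), diffl_dressing hp (hd v)]
  simp only [diffl_dressing hp hf]
  rw [← mlieBracket_rightField, diffl_mlieBracket hfp (smoothVF_rightField u)
    (smoothVF_rightField v)]

end Homogeneous

/-! ### Algebraic identity for the 3-form of a splitting. -/

section Algebra

variable {E : Type*} [NormedAddCommGroup E] [NormedSpace ℝ E]
  {D : Type*} [TopologicalSpace D] [ChartedSpace E D] [Group D] (P : ManinPair E D)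

theorem ManinPair.form_lieBr_swap (u v w : E) :
    P.form (lieBr D u v) w = -P.form (lieBr D v u) w := by
  rw [lieBr_swap, map_neg]; rfl

theorem ManinPair.form_lieBr_cycle (u v w : E) :
    P.form (lieBr D u v) w = P.form (lieBr D v w) u := by
  rw [P.invariant, P.symm]

variable [FiniteDimensional ℝ E] [LieGroup 𝓘(ℝ, E) ∞ D] [T2Space D]

theorem lieBr_sub_left (u u' v : E) : lieBr D (u - u') v = lieBr D u v - lieBr D u' v := by
  rw [sub_eq_add_neg, lieBr_add_left, lieBr_neg_left, sub_eq_add_neg]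

theorem lieBr_sub_right (u v v' : E) : lieBr D u (v - v') = lieBr D u v - lieBr D u v' := by
  rw [sub_eq_add_neg, lieBr_add_right, lieBr_neg_right, sub_eq_add_neg]

/-- The 3-form of a connection splitting in terms of the projection `R = s ∘ ρ_S` and its
derivative `d`. -/
theorem ManinPair.three_form_identity (R : E →L[ℝ] E) (d : E → E →L[ℝ] E)
    (hRR : ∀ u, R (R u) = R u) (hadj : ∀ u v, P.form (R u) v + P.form u (R v) = P.form u v)
    (hskew : ∀ z u v, P.form (d z u) v + P.form u (d z v) = 0)
    (hker : ∀ k z, R k = 0 → d z k = -R (lieBr D k z)) (hzero : ∀ k, R k = 0 → d k = 0)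
    (u v w : E) :
    P.form (lieBr D (R u) (R v)) (R w)
      + 1 / 2 * (P.form (d u v - d v u - R (lieBr D u v)) (R w)
        + P.form (R u) (d v w - d w v - R (lieBr D v w))
        - P.form (R v) (d u w - d w u - R (lieBr D u w)))
    = P.form (lieBr D u v) w - P.form w (R (lieBr D u v)) - P.form u (R (lieBr D v w))
      - P.form v (R (lieBr D w u)) - P.form v (d u w) + P.form u (d v w) - P.form u (d w v) := by
  have hiso : ∀ u v, P.form (R u) (R v) = 0 := by
    intro u v
    have h := hadj (R u) (R v)
    rw [hRR, hRR] at h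
    linarith
  have hk : ∀ u, R (u - R u) = 0 := fun u => by rw [map_sub, hRR, sub_self]
  -- Split `u` into `R u` and `u - R u`; on the kernel part the derivative is given by `hker`.
  have hd : ∀ z u, d z u = d z (R u) - R (lieBr D (u - R u) z) := by
    intro z u
    have h := hker _ z (hk u)
    rw [map_sub] at h
    rw [sub_eq_add_neg, ← h]
    abel
  have e1 : ∀ z u v, P.form (d z u) (R v) = P.form (d z (R u)) (R v) := by
    intro z u v
    rw [hd z u, map_sub, sub_apply, hiso, sub_zero]
  have e2 : ∀ z u v, P.form u (d z v)
      = -P.form (d z (R u)) (R v) - P.form u (R (lieBr D (v - R v) z)) := by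
    intro z u v
    have h := hskew z u (R v)
    rw [hd z v, map_sub, ← e1]
    linarith
  have e3 : ∀ u v, P.form u (R v) = P.form (u - R u) v := by
    intro u v
    rw [map_sub, sub_apply]
    linarith [hadj u v]
  have e4 : ∀ u v w, P.form (R u) (d v w - d w v - R (lieBr D v w))
      = P.form (d v (R w)) (R u) - P.form (d w (R v)) (R u) := by
    intro u v w
    rw [map_sub, map_sub, hiso, P.symm _ (d v w), P.symm _ (d w v), e1 v w u, e1 w v u, sub_zero]
  have e5 : ∀ z u v, P.form (d z (R u)) (R v) = -P.form (d z (R v)) (R u) := by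
    intro z u v
    have h := hskew z (R u) (R v)
    rw [P.symm (R u)] at h
    linarith
  -- The kernel of `R` is a subalgebra, by `hker` and `hzero`, and it is isotropic, by `hadj`.
  have hkkk : ∀ k k' k'', R k = 0 → R k' = 0 → R k'' = 0 → P.form (lieBr D k k') k'' = 0 := by
    intro k k' k'' h h' h''
    have h1 := hker k k' h
    rw [hzero k' h', zero_apply, eq_comm, neg_eq_zero] at h1
    have h2 := hadj (lieBr D k k') k''
    rw [h1, h'', map_zero, map_zero, zero_apply] at h2
    linarith
  have e6 := hkkk _ _ _ (hk u) (hk v) (hk w)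
  rw [P.symm (d u v - d v u - R (lieBr D u v)), e4, e4, e4, e2 u v w, e2 v u w, e2 w u v,
    e3 w, e3 u, e3 v, e3 v, e3 u, e3 u]
  have c1 := e5 u v w
  have c2 := e5 v u w
  have c3 := e5 w u v
  have s1 := P.form_lieBr_swap
  have s2 := P.form_lieBr_cycle
  have t : ∀ a b c : E, P.form a (lieBr D b c) = P.form (lieBr D b c) a := fun a b c => P.symm _ _
  -- After expansion there remain only values of the invariant trilinear form `⟨[·,·],·⟩` on `u, v,
  -- w, Ru, Rv, Rw` and terms `⟨d z (R ·), R ·⟩`. The rules `s1` and `s2` bring the first kind to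
  -- matching form; `e6` and the skewness relations supply the rest.
  simp only [t, lieBr_sub_left, lieBr_sub_right, map_sub, sub_apply] at e6 ⊢
  linarith [s2 u v w, s2 u v (R w), s2 v (R w) u, s1 (R w) v u, s1 w v u,
    s2 u (R v) (R w), s2 (R v) (R w) u, s1 w u (R v), s1 (R w) v (R u), s2 (R w) v (R u),
    s2 v (R u) (R w), s2 (R v) w u, s2 w u (R v), s2 v w u, s2 u (R v) w, s2 (R v) w (R u),
    s1 w v (R u), s2 v w (R u), s2 w (R u) v, s2 w (R u) (R v), s1 (R w) (R u) v,
    s2 (R u) v (R w), s2 (R u) v w, s2 w u v]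

end Algebra

/-! ### The projection `s ∘ ρ_S`, its derivative, and `φ_S` on dressing fields. -/

section Connection

variable {E : Type*} [NormedAddCommGroup E] [NormedSpace ℝ E]
  {D : Type*} [TopologicalSpace D] [ChartedSpace E D] [Group D]
  {F : Type*} [NormedAddCommGroup F] [NormedSpace ℝ F]
  {G : Subgroup D} [ChartedSpace F (D ⧸ G)] [IsManifold 𝓘(ℝ, F) ∞ (D ⧸ G)]
  {P : ManinPair E D} (s : ConnSplitting P F G)

namespace ConnSplitting

/-- The projection `s ∘ ρ_S` of `𝔡` onto the image of the connection splitting. -/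
def proj (y : D ⧸ G) : E →L[ℝ] E := (s.s y).comp (dressing E F y)

/-- The derivative of `proj` along the vector field `ρ_S(u)`. -/
def dproj (y : D ⧸ G) (u : E) : E →L[ℝ] E := diffl s.proj y (dressing E F y u)

theorem dressing_proj (y : D ⧸ G) (u : E) : dressing E F y (s.proj y u) = dressing E F y u :=
  s.split y _

theorem proj_proj (y : D ⧸ G) (u : E) : s.proj y (s.proj y u) = s.proj y u :=
  congrArg (s.s y) (s.dressing_proj y u)

theorem dressing_eq_zero {y : D ⧸ G} {u : E} (h : s.proj y u = 0) : dressing E F y u = 0 := by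
  rw [← s.dressing_proj, h, map_zero]

theorem s_injective (y : D ⧸ G) : Function.Injective (s.s y) := fun X Y h => by
  rw [← s.split y X, ← s.split y Y, h]

variable [LieGroup 𝓘(ℝ, E) ∞ D] [FiniteDimensional ℝ E] [T2Space D]

/-- Expand `⟨u - Ru, v - Rv⟩ = 0` and use `⟨Ru, Rv⟩ = 0`: kernel and image of `R` are both
isotropic. Equivalently, `(ρ_S, s^*)` carries the form of `𝔡` to the pairing on `TS ⊕ T^*S`. -/
theorem form_proj_add [ConnectedSpace D] (hG : P.IsIntegratedBy G)
    (hp : Manifold.IsSubmersion 𝓘(ℝ, E) 𝓘(ℝ, F) ∞ (QuotientGroup.mk : D → D ⧸ G))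
    (y : D ⧸ G) (u v : E) :
    P.form (s.proj y u) v + P.form u (s.proj y v) = P.form u v := by
  have hk : ∀ u, dressing E F y (u - s.proj y u) = 0 := fun u => by
    rw [map_sub, dressing_proj, sub_self]
  have h1 := form_eq_zero_of_dressing_eq_zero P hG hp y (hk u) (hk v)
  have h2 : P.form (s.proj y u) (s.proj y v) = 0 := s.isotropic y _ _
  rw [map_sub, map_sub, sub_apply, sub_apply, h2] at h1
  linarith

variable [FiniteDimensional ℝ F] [T2Space (D ⧸ G)]

theorem contMDiff_proj
    (hp : Manifold.IsSubmersion 𝓘(ℝ, E) 𝓘(ℝ, F) ∞ (QuotientGroup.mk : D → D ⧸ G)) :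
    ContMDiff 𝓘(ℝ, F) 𝓘(ℝ, E →L[ℝ] E) ∞ s.proj :=
  contMDiff_clm_of_apply fun u => s.smooth.apply (smoothVF_dressing hp u)

theorem diffl_proj_apply
    (hp : Manifold.IsSubmersion 𝓘(ℝ, E) 𝓘(ℝ, F) ∞ (QuotientGroup.mk : D → D ⧸ G))
    (y : D ⧸ G) (u v : E) :
    diffl (fun z => s.proj z v) y (dressing E F y u) = s.dproj y u v :=
  diffl_clm_comp (ContinuousLinearMap.apply ℝ E v) (mdiff (s.contMDiff_proj hp) y) _

/-- Differentiate `form_proj_add`, whose right-hand side is constant on `S`. -/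
theorem form_dproj_add [ConnectedSpace D]
    (hp : Manifold.IsSubmersion 𝓘(ℝ, E) 𝓘(ℝ, F) ∞ (QuotientGroup.mk : D → D ⧸ G))
    (hG : P.IsIntegratedBy G) (y : D ⧸ G) (z u v : E) :
    P.form (s.dproj y z u) v + P.form u (s.dproj y z v) = 0 := by
  let A : (E →L[ℝ] E) →L[ℝ] ℝ := (P.form.flip v).comp (ContinuousLinearMap.apply ℝ E u)
    + (P.form u).comp (ContinuousLinearMap.apply ℝ E v)
  have h := diffl_clm_comp A (mdiff (s.contMDiff_proj hp) y) (dressing E F y z)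
  have h1 : (fun y => A (s.proj y)) = fun _ => P.form u v :=
    funext fun y => s.form_proj_add hG hp y u v
  rw [h1, diffl_const] at h
  exact h.symm

/-- The exterior derivative of a connection splitting on the vector fields of the dressing
action. -/
theorem extd_dressing
    (hp : Manifold.IsSubmersion 𝓘(ℝ, E) 𝓘(ℝ, F) ∞ (QuotientGroup.mk : D → D ⧸ G))
    (y : D ⧸ G) (u v : E) :
    extd s.s y (dressing E F y u) (dressing E F y v)
      = s.dproj y u v - s.dproj y v u - s.proj y (lieBr D u v) := by
  have h := extd_apply s.smooth (smoothVF_dressing hp u) (smoothVF_dressing hp v) y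
  rw [mlieBracket_dressing hp] at h
  refine h.trans ?_
  rw [← s.diffl_proj_apply hp, ← s.diffl_proj_apply hp]
  rfl

/-- Since `ρ_S(k)` vanishes at `y`, both `ds(ρ_S k, ·)` and the derivative of `R` along `ρ_S k`
vanish there; `extd_dressing` then leaves this relation. -/
theorem dproj_ker
    (hp : Manifold.IsSubmersion 𝓘(ℝ, E) 𝓘(ℝ, F) ∞ (QuotientGroup.mk : D → D ⧸ G))
    (y : D ⧸ G) (k z : E) (hk : s.proj y k = 0) :
    s.dproj y z k = -s.proj y (lieBr D k z) := by
  have h := s.extd_dressing hp y k z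
  have h0 : s.dproj y k = 0 := by
    rw [dproj, s.dressing_eq_zero hk, map_zero]
  have h1 : extd s.s y (0 : Tan F y) = 0 := by
    have : ∀ (A : F →L[ℝ] F →L[ℝ] E), (A 0 - A.flip 0 : F →L[ℝ] E) = 0 := fun A => by simp
    exact this _
  rw [s.dressing_eq_zero hk, h1, h0] at h
  simp only [zero_apply, zero_sub] at h
  rw [eq_comm, ← sub_eq_zero] at h
  rw [← sub_eq_zero, ← neg_eq_zero, ← h]
  abel

/-- The 3-form of a connection splitting on the vector fields of the dressing action. -/
theorem phiS_dressing [ConnectedSpace D]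
    (hp : Manifold.IsSubmersion 𝓘(ℝ, E) 𝓘(ℝ, F) ∞ (QuotientGroup.mk : D → D ⧸ G))
    (hG : P.IsIntegratedBy G) (y : D ⧸ G) (u v w : E) :
    s.phiS y (dressing E F y u) (dressing E F y v) (dressing E F y w)
      = P.form (lieBr D u v) w - P.form w (s.proj y (lieBr D u v))
        - P.form u (s.proj y (lieBr D v w)) - P.form v (s.proj y (lieBr D w u))
        - P.form v (s.dproj y u w) + P.form u (s.dproj y v w) - P.form u (s.dproj y w v) := by
  rw [← P.three_form_identity (s.proj y) (s.dproj y) (s.proj_proj y) (s.form_proj_add hG hp y)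
    (s.form_dproj_add hp hG y) (s.dproj_ker hp y)
    (fun k hk => by rw [dproj, s.dressing_eq_zero hk, map_zero]) u v w,
    ← s.extd_dressing hp, ← s.extd_dressing hp, ← s.extd_dressing hp]
  rfl

end ConnSplitting

end Connection

/-! ### The Courant bracket in invariant form. -/

section Courant

variable {E : Type*} [NormedAddCommGroup E] [NormedSpace ℝ E] [FiniteDimensional ℝ E]
  {M : Type*} [TopologicalSpace M] [ChartedSpace E M] [IsManifold 𝓘(ℝ, E) ∞ M]

/-- Cartan's formula for `dα` and `dβ` replaces the chart derivatives by Lie brackets and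
derivatives of functions, with no isotropy assumed. -/
theorem pairing_courant (φ : ∀ x : M, Tan E x → Tan E x → Cot E x)
    {X Y Z : ∀ x : M, Tan E x} {α β : ∀ x : M, Cot E x} (hX : SmoothVF X) (hY : SmoothVF Y)
    (hZ : SmoothVF Z) (hα : SmoothForm α) (hβ : SmoothForm β) (x : M) (γ : Cot E x) :
    pairing (courant φ X α Y β x) (Z x, γ)
      = γ (VectorField.mlieBracket 𝓘(ℝ, E) X Y x)
        + diffl (fun y => β y (Z y)) x (X x) - β x (VectorField.mlieBracket 𝓘(ℝ, E) X Z x)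
        - diffl (fun y => α y (Z y)) x (Y x) + diffl (fun y => α y (Y y)) x (Z x)
        + α x (VectorField.mlieBracket 𝓘(ℝ, E) Y Z x) + φ x (X x) (Y x) (Z x) := by
  have h1 := extd_apply hβ hX hZ x
  have h2 := extd_apply hα hY hZ x
  have h3 : dfun (fun y => β y (X y)) x (Z x) = diffl (fun y => β y (X y)) x (Z x) := rfl
  simp only [pairing, courant, add_apply, sub_apply, h1, h2, h3]
  ring

end Courant

/-! ### Courant brackets of sections twisted by `J^* s^*`. -/

section Moment

variable {E : Type*} [NormedAddCommGroup E] [NormedSpace ℝ E]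
  {D : Type*} [TopologicalSpace D] [ChartedSpace E D] [Group D]
  {F : Type*} [NormedAddCommGroup F] [NormedSpace ℝ F]
  {G : Subgroup D} [ChartedSpace F (D ⧸ G)] [IsManifold 𝓘(ℝ, F) ∞ (D ⧸ G)]
  {P : ManinPair E D} (s : ConnSplitting P F G)
  {K : Type*} [NormedAddCommGroup K] [NormedSpace ℝ K]
  {M : Type*} [TopologicalSpace M] [ChartedSpace K M]

namespace ConnSplitting

/-- The pull-back `J^* s` of a connection splitting. -/
def pull (J : M → D ⧸ G) (x : M) : Tan K x →L[ℝ] E := (s.s (J x)).comp (dmap K F J x)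

/-- The 1-form `J^* s^*(u)`. -/
def pullDual (J : M → D ⧸ G) (x : M) : E →ₗ[ℝ] Cot K x := dmapDual K F J x ∘ₗ s.sDual (J x)

theorem pullDual_apply (J : M → D ⧸ G) (x : M) (u : E) (X : Tan K x) :
    s.pullDual J x u X = P.form u (s.pull J x X) := rfl

theorem pull_eq_iff {J : M → D ⧸ G} {x : M} {X : Tan K x} {u : E} :
    s.pull J x X = s.proj (J x) u ↔ dmap K F J x X = dressing E F (J x) u :=
  (s.s_injective (J x)).eq_iff

variable [IsManifold 𝓘(ℝ, K) ∞ M]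

theorem smoothForm_pull {J : M → D ⧸ G} (hJ : ContMDiff 𝓘(ℝ, K) 𝓘(ℝ, F) ∞ J) :
    SmoothForm (s.pull (K := K) J) := s.smooth.pullback hJ

theorem smoothForm_pullDual {J : M → D ⧸ G} (hJ : ContMDiff 𝓘(ℝ, K) 𝓘(ℝ, F) ∞ J) {w : M → E}
    (hw : ContMDiff 𝓘(ℝ, K) 𝓘(ℝ, E) ∞ w) :
    SmoothForm (fun x => s.pullDual (K := K) J x (w x)) :=
  (s.smoothForm_pull hJ).clm_comp ((ContinuousLinearMap.contMDiff P.form).comp hw)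

variable [FiniteDimensional ℝ E] [LieGroup 𝓘(ℝ, E) ∞ D] [T2Space D] [ConnectedSpace D]
  [FiniteDimensional ℝ F] [T2Space (D ⧸ G)] [FiniteDimensional ℝ K]

/-- The Courant bracket of two sections `(X, α + J^* s^*(w))`, with `X` related to `ρ_S(w)`, paired
with a third one. -/
theorem pairing_courant_pullDual
    (hp : Manifold.IsSubmersion 𝓘(ℝ, E) 𝓘(ℝ, F) ∞ (QuotientGroup.mk : D → D ⧸ G))
    (hG : P.IsIntegratedBy G) {J : M → D ⧸ G}
    (hJ : ContMDiff 𝓘(ℝ, K) 𝓘(ℝ, F) ∞ J)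
    {X Y Z : ∀ x : M, Tan K x} {α β : ∀ x : M, Cot K x} {u v w : M → E}
    (hX : SmoothVF X) (hY : SmoothVF Y) (hZ : SmoothVF Z) (hα : SmoothForm α) (hβ : SmoothForm β)
    (hu : ContMDiff 𝓘(ℝ, K) 𝓘(ℝ, E) ∞ u) (hv : ContMDiff 𝓘(ℝ, K) 𝓘(ℝ, E) ∞ v)
    (hw : ContMDiff 𝓘(ℝ, K) 𝓘(ℝ, E) ∞ w)
    (hXu : ∀ x, dmap K F J x (X x) = dressing E F (J x) (u x))
    (hYv : ∀ x, dmap K F J x (Y x) = dressing E F (J x) (v x))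
    (hZw : ∀ x, dmap K F J x (Z x) = dressing E F (J x) (w x)) (x : M) (γ : Cot K x) :
    pairing (courant (pullThree J s.phiS) X (fun y => α y + s.pullDual J y (u y))
        Y (fun y => β y + s.pullDual J y (v y)) x) (Z x, γ + s.pullDual J x (w x))
      = γ (VectorField.mlieBracket 𝓘(ℝ, K) X Y x)
        + diffl (fun y => β y (Z y)) x (X x) - β x (VectorField.mlieBracket 𝓘(ℝ, K) X Z x)
        - diffl (fun y => α y (Z y)) x (Y x) + diffl (fun y => α y (Y y)) x (Z x)
        + α x (VectorField.mlieBracket 𝓘(ℝ, K) Y Z x)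
        + P.form (lieBr D (u x) (v x)) (w x) + P.form (diffl v x (X x)) (w x)
        - P.form (diffl u x (Y x)) (w x) + P.form (diffl u x (Z x)) (v x) := by
  have hR := s.contMDiff_proj hp
  have hRJ : ContMDiff 𝓘(ℝ, K) 𝓘(ℝ, E →L[ℝ] E) ∞ (fun x => s.proj (J x)) := hR.comp hJ
  have hfa : ∀ {u w : M → E}, ContMDiff 𝓘(ℝ, K) 𝓘(ℝ, E) ∞ u → ContMDiff 𝓘(ℝ, K) 𝓘(ℝ, E) ∞ w →
      ContMDiff 𝓘(ℝ, K) 𝓘(ℝ, ℝ) ∞ (fun y => P.form (u y) (s.proj (J y) (w y))) := fun hu hw =>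
    ((ContinuousLinearMap.contMDiff P.form).comp hu).clm_apply (hRJ.clm_apply hw)
  -- Since `J^*s(Z) = R(w)`, the evaluated form is `α(Z) + ⟨u, R(w)⟩`, and the product rule produces
  -- the derivative of `R` along `ρ_S(z)`.
  have hder : ∀ {α : ∀ x : M, Cot K x} {u w z : M → E} {Z X : ∀ x : M, Tan K x},
      SmoothForm α → SmoothVF Z →
      ContMDiff 𝓘(ℝ, K) 𝓘(ℝ, E) ∞ u → ContMDiff 𝓘(ℝ, K) 𝓘(ℝ, E) ∞ w →
      (∀ x, dmap K F J x (Z x) = dressing E F (J x) (w x)) →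
      (∀ x, dmap K F J x (X x) = dressing E F (J x) (z x)) →
      diffl (fun y => (α y + s.pullDual (K := K) J y (u y)) (Z y)) x (X x)
        = diffl (fun y => α y (Z y)) x (X x) + (P.form (diffl u x (X x)) (s.proj (J x) (w x))
          + P.form (u x) (s.dproj (J x) (z x) (w x))
          + P.form (u x) (s.proj (J x) (diffl w x (X x)))) := by
    intro α u w z Z X hα hZ hu hw hZw hXz
    have h1 : (fun y => (α y + s.pullDual (K := K) J y (u y)) (Z y))
        = fun y => α y (Z y) + P.form (u y) (s.proj (J y) (w y)) := by
      funext y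
      rw [add_apply, pullDual_apply, s.pull_eq_iff.2 (hZw y)]
    rw [h1, diffl_add (mdiff (hα.apply hZ) x) (mdiff (hfa hu hw) x), add_apply,
      diffl_bilin P.form (mdiff hu x) (mdiff (hRJ.clm_apply hw) x),
      diffl_clm_apply (mdiff hRJ x) (mdiff hw x), diffl_comp (mdiff hR _) (mdiff hJ x), hXz, map_add]
    rw [dproj]
    ring
  have hbr : ∀ {X Y : ∀ x : M, Tan K x} {u v : M → E}, SmoothVF X → SmoothVF Y →
      ContMDiff 𝓘(ℝ, K) 𝓘(ℝ, E) ∞ u → ContMDiff 𝓘(ℝ, K) 𝓘(ℝ, E) ∞ v →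
      (∀ x, dmap K F J x (X x) = dressing E F (J x) (u x)) →
      (∀ x, dmap K F J x (Y x) = dressing E F (J x) (v x)) → ∀ w : E,
      s.pullDual J x w (VectorField.mlieBracket 𝓘(ℝ, K) X Y x)
        = P.form w (s.proj (J x) (lieBr D (u x) (v x))) + (P.form w (s.proj (J x) (diffl v x (X x)))
          - P.form w (s.proj (J x) (diffl u x (Y x)))) := by
    intro X Y u v hX hY hu hv hXu hYv w
    have h := dmap_mlieBracket (fun y : D ⧸ G => dressing E F y) (smoothVF_dressing hp) (lieBr D)
      (mlieBracket_dressing hp) hJ hX hY hu hv hXu hYv x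
    rw [pullDual_apply, s.pull_eq_iff.2 h]
    simp only [map_add, map_sub]
  rw [pairing_courant _ hX hY hZ (hα.add (s.smoothForm_pullDual hJ hu))
    (hβ.add (s.smoothForm_pullDual hJ hv)), hder hβ hZ hv hw hZw hXu, hder hα hZ hu hw hZw hYv,
    hder hα hY hu hv hYv hZw]
  simp only [add_apply]
  rw [hbr hX hY hu hv hXu hYv, hbr hX hZ hu hw hXu hZw, hbr hY hZ hv hw hYv hZw]
  have hφ : pullThree J s.phiS x (X x) (Y x) (Z x)
      = s.phiS (J x) (dressing E F (J x) (u x)) (dressing E F (J x) (v x))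
        (dressing E F (J x) (w x)) := by
    rw [← hXu, ← hYv, ← hZw]; rfl
  -- All terms with `R[·,·]` or with a derivative of `R` cancel against `φ_S`. The remaining `R`'s
  -- act on derivatives of the coefficients and combine in pairs by `form_proj_add`.
  rw [hφ, s.phiS_dressing hp hG, lieBr_swap (w x) (u x), map_neg, map_neg]
  have hadj := s.form_proj_add hG hp (J x)
  linarith [hadj (w x) (diffl v x (X x)), hadj (diffl v x (X x)) (w x),
    hadj (diffl u x (Y x)) (w x), hadj (diffl u x (Z x)) (v x),
    P.symm (w x) (s.proj (J x) (diffl v x (X x))), P.symm (w x) (s.proj (J x) (diffl u x (Y x))),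
    P.symm (v x) (s.proj (J x) (diffl u x (Z x)))]

end ConnSplitting

end Moment

/-! ### The decomposition `𝔡 = 𝔤 ⊕ j(𝔤^*)`. -/

section Splitting

variable {E : Type*} [NormedAddCommGroup E] [NormedSpace ℝ E]
  {D : Type*} [TopologicalSpace D] [ChartedSpace E D] [Group D] {P : ManinPair E D}

/-- The projection `𝔡 → 𝔤^*` given by the form. -/
def ManinPair.toDual (P : ManinPair E D) : E →ₗ[ℝ] Module.Dual ℝ P.g where
  toFun u := (P.form u : E →ₗ[ℝ] ℝ) ∘ₗ P.g.subtype
  map_add' u v := by ext; simp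
  map_smul' c u := by ext; simp

theorem ManinPair.toDual_apply (u : E) (v : P.g) : P.toDual u v = P.form u v := rfl

theorem ManinPair.toDual_coe (v : P.g) : P.toDual (v : E) = 0 := by
  ext w
  exact (P.lagrangian v).1 v.2 w w.2

theorem ManinPair.form_coe (v w : P.g) : P.form (v : E) w = 0 := (P.lagrangian v).1 v.2 w w.2

namespace ManinPair.Splitting

variable (j : P.Splitting)

theorem toDual_j (μ : Module.Dual ℝ P.g) : P.toDual (j.j μ) = μ := by
  ext v
  exact j.split μ v

/-- The projection `𝔡 → 𝔤` along the image of the splitting. -/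
def toG : E →ₗ[ℝ] P.g :=
  LinearMap.codRestrict P.g (LinearMap.id - j.j ∘ₗ P.toDual) fun u => by
    rw [P.lagrangian]
    intro v hv
    change P.form (u - j.j (P.toDual u)) v = 0
    rw [map_sub, sub_apply, j.split _ ⟨v, hv⟩, P.toDual_apply, sub_self]

theorem coe_toG (u : E) : (j.toG u : E) = u - j.j (P.toDual u) := rfl

theorem toG_add (u : E) : (j.toG u : E) + j.j (P.toDual u) = u := by
  rw [coe_toG, sub_add_cancel]

theorem form_j (μ : Module.Dual ℝ P.g) (u : E) : P.form (j.j μ) u = μ (j.toG u) := by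
  conv_lhs => rw [← j.toG_add u]
  rw [map_add, j.isotropic, add_zero, j.split]

end ManinPair.Splitting

end Splitting

/-! ### Fibrewise linear algebra: the lagrangian subspace of `(ρ_M, π)`. -/

section Pointwise

theorem tan_eq_of_cot {K : Type*} [NormedAddCommGroup K] [NormedSpace ℝ K]
    {M : Type*} [TopologicalSpace M] [ChartedSpace K M] {x : M} {X Y : Tan K x}
    (h : ∀ α : Cot K x, α X = α Y) : X = Y := by
  have h2 : ∀ a b : K, (∀ α : K →L[ℝ] ℝ, α a = α b) → a = b := fun a b hab =>
    (SeparatingDual.eq_iff_forall_dual_eq (R := ℝ)).2 hab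
  exact h2 X Y h

/-- A proper subspace lies in the kernel of a nonzero functional, which in finite dimension is
evaluation at a vector. -/
theorem submodule_dual_eq_top {K : Type*} [NormedAddCommGroup K] [NormedSpace ℝ K]
    [FiniteDimensional ℝ K] {W : Submodule ℝ (K →L[ℝ] ℝ)}
    (h : ∀ X : K, (∀ α ∈ W, α X = 0) → X = 0) : W = ⊤ := by
  by_contra hW
  obtain ⟨f, hf, hfW⟩ := Submodule.exists_le_ker_of_lt_top W (lt_top_iff_ne_top.2 hW)
  let e : Module.Dual ℝ K ≃ₗ[ℝ] (K →L[ℝ] ℝ) := LinearMap.toContinuousLinearMap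
  obtain ⟨X, hX⟩ := (Module.evalEquiv ℝ K).surjective (f ∘ₗ e.toLinearMap)
  have hfX : ∀ α, f α = α X := by
    intro α
    have := LinearMap.congr_fun hX (e.symm α)
    simp only [Module.evalEquiv_apply, Module.Dual.eval_apply, LinearMap.comp_apply,
      LinearEquiv.coe_coe, e.apply_symm_apply] at this
    exact this.symm
  have h0 : X = 0 := h X fun α hα => by
    rw [← hfX]; exact hfW hα
  exact hf (LinearMap.ext fun α => by rw [hfX, h0, map_zero]; rfl)

variable {E : Type*} [NormedAddCommGroup E] [NormedSpace ℝ E]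
  {D : Type*} [TopologicalSpace D] [ChartedSpace E D] [Group D]
  {F : Type*} [NormedAddCommGroup F] [NormedSpace ℝ F]
  {G : Subgroup D} [ChartedSpace F (D ⧸ G)] [IsManifold 𝓘(ℝ, F) ∞ (D ⧸ G)]
  {P : ManinPair E D}

theorem rhoDual_add {M : Mfd.{u}} {x : M.carrier} (r : P.g →ₗ[ℝ] Tan M.Model x)
    (α β : Cot M.Model x) : rhoDual r (α + β) = rhoDual r α + rhoDual r β := rfl

theorem rhoDual_smul {M : Mfd.{u}} {x : M.carrier} (r : P.g →ₗ[ℝ] Tan M.Model x) (c : ℝ)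
    (α : Cot M.Model x) : rhoDual r (c • α) = c • rhoDual r α := rfl

theorem rhoDual_apply {M : Mfd.{u}} {x : M.carrier} (r : P.g →ₗ[ℝ] Tan M.Model x)
    (α : Cot M.Model x) (v : P.g) : rhoDual r α v = α (r v) := rfl

theorem rhoDual_zero {M : Mfd.{u}} {x : M.carrier} (r : P.g →ₗ[ℝ] Tan M.Model x) :
    rhoDual r (0 : Cot M.Model x) = 0 := rfl

variable (s : ConnSplitting P F G) (j : P.Splitting) {M : Mfd.{u}}

namespace ConnSplitting

/-- The `𝔡`-valued coefficient `v - j(ρ_M^* α)` of `genSection`. -/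
def genCoeff {x : M.carrier} (r : P.g →ₗ[ℝ] Tan M.Model x) (v : P.g) (α : Cot M.Model x) : E :=
  v - j.j (rhoDual r α)

/-- The map `𝔤 ⊕ T^*_x M → T_x M ⊕ T^*_x M` whose image is the Dirac structure of `(ρ_M, π)`. -/
def genSection (J : M.carrier → D ⧸ G) (x : M.carrier) (r : P.g →ₗ[ℝ] Tan M.Model x)
    (p : Cot M.Model x →ₗ[ℝ] Tan M.Model x) : P.g × Cot M.Model x →ₗ[ℝ] Gen M.Model x where
  toFun e := (r e.1 + p e.2, e.2 + s.pullDual J x (genCoeff j r e.1 e.2))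
  map_add' e e' := by
    refine Prod.ext ?_ ?_
    · simp only [Prod.fst_add, Prod.snd_add, map_add]
      abel
    · simp only [genCoeff, Prod.fst_add, Prod.snd_add, map_add, map_sub, rhoDual_add,
        Submodule.coe_add]
      abel
  map_smul' c e := by
    refine Prod.ext ?_ ?_
    · simp only [Prod.smul_fst, Prod.smul_snd, map_smul, RingHom.id_apply, smul_add]
    · simp only [genCoeff, Prod.smul_fst, Prod.smul_snd, map_smul, map_sub, rhoDual_smul,
        Submodule.coe_smul, RingHom.id_apply, smul_add, smul_sub]

variable {s j} {J : M.carrier → D ⧸ G} {x : M.carrier} {r : P.g →ₗ[ℝ] Tan M.Model x}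
  {p : Cot M.Model x →ₗ[ℝ] Tan M.Model x}

theorem genSection_apply (v : P.g) (α : Cot M.Model x) :
    s.genSection j J x r p (v, α) = (r v + p α, α + s.pullDual J x (genCoeff j r v α)) := rfl

theorem form_proj_self (hadj : ∀ u v, P.form (s.proj (J x) u) v + P.form u (s.proj (J x) v)
    = P.form u v) (μ : Module.Dual ℝ P.g) : P.form (j.j μ) (s.proj (J x) (j.j μ)) = 0 := by
  have h := hadj (j.j μ) (j.j μ)
  rw [j.isotropic, P.symm] at h
  linarith

theorem pull_eq_proj_pull (X : Tan M.Model x) :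
    s.proj (J x) (s.pull J x X) = s.pull J x X := congrArg (s.s (J x)) (s.split (J x) _)

theorem form_pull_pull (X Y : Tan M.Model x) : P.form (s.pull J x X) (s.pull J x Y) = 0 :=
  s.isotropic (J x) _ _

theorem pullDual_pull (X : Tan M.Model x) : s.pullDual (K := M.Model) J x (s.pull J x X) = 0 := by
  ext Y
  exact form_pull_pull X Y

theorem pull_genSection (hr : ∀ v : P.g, s.pull J x (r v) = s.proj (J x) v)
    (hm : ∀ α, s.pull J x (p α) = -s.proj (J x) (j.j (rhoDual r α))) (v : P.g)
    (α : Cot M.Model x) : s.pull J x (r v + p α) = s.proj (J x) (genCoeff j r v α) := by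
  rw [map_add, hr, hm, genCoeff, map_sub, sub_eq_add_neg]

/-- Both `𝔤` and the image of `j` are isotropic, so only the cross terms survive. -/
theorem form_genCoeff (v v' : P.g) (α α' : Cot M.Model x) :
    P.form (genCoeff j r v α) (genCoeff j r v' α') = -α' (r v) - α (r v') := by
  rw [genCoeff, genCoeff]
  simp only [map_sub, sub_apply, P.form_coe, j.isotropic, j.split]
  rw [P.symm v, j.split]
  simp only [rhoDual_apply]
  ring

/-- The `π`-terms cancel by skewness. With coefficients `c, c'`, the pull-back terms give `⟨c, Rc'⟩
+ ⟨c', Rc⟩ = ⟨c, c'⟩`, which by `form_genCoeff` is minus the contribution of `ρ_M`. -/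
theorem pairing_genSection (hadj : ∀ u v, P.form (s.proj (J x) u) v + P.form u (s.proj (J x) v)
    = P.form u v) (hr : ∀ v : P.g, s.pull J x (r v) = s.proj (J x) v)
    (hm : ∀ α, s.pull J x (p α) = -s.proj (J x) (j.j (rhoDual r α)))
    (hp : ∀ α : Cot M.Model x, α (p α) = 0) (e e' : P.g × Cot M.Model x) :
    pairing (s.genSection j J x r p e) (s.genSection j J x r p e') = 0 := by
  obtain ⟨v, α⟩ := e
  obtain ⟨v', α'⟩ := e'
  have hs : α (p α') + α' (p α) = 0 := by
    have h := hp (α + α')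
    simp only [map_add, add_apply, hp] at h
    linarith
  simp only [genSection_apply, pairing, add_apply, pullDual_apply, pull_genSection hr hm]
  have h1 := form_genCoeff (j := j) (r := r) v v' α α'
  have h2 := hadj (genCoeff j r v α) (genCoeff j r v' α')
  rw [P.symm (s.proj (J x) (genCoeff j r v α))] at h2
  rw [map_add, map_add]
  linarith

/-- The hypothesis makes the coefficient of `e` equal to `J^*s(X)` itself, and `J^*s^*` vanishes on
such elements because the image of `s` is isotropic. -/
theorem genSection_eq {X : Tan M.Model x} {a : Cot M.Model x}
    (h : rhoDual r a = -P.toDual (s.pull J x X)) :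
    s.genSection j J x r p (j.toG (s.pull J x X), a)
      = (r (j.toG (s.pull J x X)) + p a, a) := by
  rw [genSection_apply, genCoeff, h, map_neg, sub_neg_eq_add, j.toG_add, pullDual_pull, add_zero]

/-- Elements orthogonal to the image of `genSection` are in it, with explicit preimage. -/
theorem eq_genSection_of_pairing (hp : ∀ α : Cot M.Model x, α (p α) = 0) {X : Tan M.Model x} {a : Cot M.Model x}
    (h : ∀ e, pairing (X, a) (s.genSection j J x r p e) = 0) :
    s.genSection j J x r p (j.toG (s.pull J x X), a) = (X, a) := by
  -- Orthogonality to `e(v, 0)` fixes the `𝔤^*`-component of `J^*s(X)`; orthogonality to `e(0, α)`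
  -- below then fixes `X`.
  have h1 : rhoDual r a = -P.toDual (s.pull J x X) := by
    ext v
    have h1 := h (v, 0)
    simp only [genSection_apply, pairing, genCoeff, rhoDual_zero, map_zero, sub_zero, add_zero,
      zero_add, pullDual_apply] at h1
    rw [rhoDual_apply, LinearMap.neg_apply, P.toDual_apply, P.symm]
    linarith
  rw [genSection_eq h1]
  refine Prod.ext (tan_eq_of_cot fun α => ?_) rfl
  have hs : a (p α) + α (p a) = 0 := by
    have h := hp (a + α)
    simp only [map_add, add_apply, hp] at h
    linarith
  have h2 := h (0, α)
  simp only [genSection_apply, pairing, genCoeff, map_zero, zero_add, add_apply, pullDual_apply,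
    Submodule.coe_zero, zero_sub, map_neg, neg_apply, j.form_j, rhoDual_apply] at h2
  change α (r (j.toG (s.pull J x X)) + p a) = α X
  rw [map_add]
  linarith

theorem mem_range_genSection_iff (hadj : ∀ u v, P.form (s.proj (J x) u) v
    + P.form u (s.proj (J x) v) = P.form u v)
    (hr : ∀ v : P.g, s.pull J x (r v) = s.proj (J x) v)
    (hm : ∀ α, s.pull J x (p α) = -s.proj (J x) (j.j (rhoDual r α)))
    (hp : ∀ α : Cot M.Model x, α (p α) = 0) (e : Gen M.Model x) :
    e ∈ LinearMap.range (s.genSection j J x r p) ↔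
      ∀ e' ∈ LinearMap.range (s.genSection j J x r p), pairing e e' = 0 := by
  constructor
  · rintro ⟨e, rfl⟩ _ ⟨e', rfl⟩
    exact pairing_genSection hadj hr hm hp e e'
  · intro h
    exact ⟨_, eq_genSection_of_pairing hp fun e' => h _ ⟨e', rfl⟩⟩

end ConnSplitting

end Pointwise

/-- A linear relation that is total and single-valued at `0` is the graph of a linear map. In this
way `ρ_M`, `π♯` and the 2-form are obtained from `L`. -/
theorem exists_linearMap_mem {A B : Type*} [AddCommGroup A] [Module ℝ A] [AddCommGroup B]
    [Module ℝ B] (Γ : Submodule ℝ (A × B)) (hex : ∀ a, ∃ b, (a, b) ∈ Γ)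
    (huni : ∀ b, ((0 : A), b) ∈ Γ → b = 0) : ∃ f : A →ₗ[ℝ] B, ∀ a, (a, f a) ∈ Γ := by
  have hu : ∀ a b b', (a, b) ∈ Γ → (a, b') ∈ Γ → b = b' := by
    intro a b b' h h'
    have := Γ.sub_mem h h'
    rw [Prod.mk_sub_mk, sub_self] at this
    exact sub_eq_zero.1 (huni _ this)
  choose f hf using hex
  exact ⟨{ toFun := f
           map_add' := fun a a' => hu _ _ _ (hf _) (Γ.add_mem (hf a) (hf a'))
           map_smul' := fun c a => hu _ _ _ (hf _) (Γ.smul_mem c (hf a)) }, hf⟩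

/-! ### Fibrewise linear algebra: the action and the bivector of a strong Dirac map. -/

section Pointwise

variable {E : Type*} [NormedAddCommGroup E] [NormedSpace ℝ E]
  {D : Type*} [TopologicalSpace D] [ChartedSpace E D] [Group D]
  {F : Type*} [NormedAddCommGroup F] [NormedSpace ℝ F]
  {G : Subgroup D} [ChartedSpace F (D ⧸ G)]
  {P : ManinPair E D} {j : P.Splitting} {M : Mfd.{u}} {J : M.carrier → D ⧸ G} {x : M.carrier}
  {r : P.g →ₗ[ℝ] Tan M.Model x} {p : Cot M.Model x →ₗ[ℝ] Tan M.Model x}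

theorem apply_sigmaBar [FiniteDimensional ℝ E] (y : D ⧸ G) (β : Cot F y)
    (μ : Module.Dual ℝ P.g) : μ (j.sigmaBar y β) = β (dressing E F y (j.j μ)) := by
  have h := LinearMap.congr_fun ((Module.evalEquiv ℝ P.g).apply_symm_apply
    ((β : Tan F y →ₗ[ℝ] ℝ) ∘ₗ (dressing E F y : E →ₗ[ℝ] Tan F y) ∘ₗ j.j)) μ
  exact h

theorem skew_pair (hp : ∀ α : Cot M.Model x, α (p α) = 0) (α β : Cot M.Model x) :
    α (p β) = -β (p α) := by
  have h := hp (α + β)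
  simp only [map_add, add_apply, hp] at h
  linarith

/-- The moment condition in its dual form. -/
theorem moment_iff [FiniteDimensional ℝ E] (hp : ∀ α : Cot M.Model x, α (p α) = 0) :
    (∀ β : Cot F (J x), p (dmapDual M.Model F J x β) = r (j.sigmaBar (J x) β)) ↔
      ∀ α, dmap M.Model F J x (p α) = -dressing E F (J x) (j.j (rhoDual r α)) := by
  have key : ∀ (α : Cot M.Model x) (β : Cot F (J x)),
      β (dmap M.Model F J x (p α)) - β (-dressing E F (J x) (j.j (rhoDual r α)))
        = α (r (j.sigmaBar (J x) β)) - α (p (dmapDual M.Model F J x β)) := by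
    intro α β
    have h1 : β (dmap M.Model F J x (p α)) = dmapDual M.Model F J x β (p α) := rfl
    rw [h1, skew_pair hp, map_neg, ← apply_sigmaBar, rhoDual_apply]
    ring
  constructor
  · intro h α
    refine tan_eq_of_cot fun β => ?_
    have := key α β
    rw [h β, sub_self] at this
    exact sub_eq_zero.1 this
  · intro h β
    refine tan_eq_of_cot fun α => ?_
    have := key α β
    rw [h α, sub_self] at this
    exact (sub_eq_zero.1 this.symm).symm

variable [IsManifold 𝓘(ℝ, F) ∞ (D ⧸ G)] {s : ConnSplitting P F G}

namespace ConnSplitting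

theorem pull_neg_iff {X : Tan M.Model x} {u : E} :
    s.pull J x X = -s.proj (J x) u ↔ dmap M.Model F J x X = -dressing E F (J x) u := by
  rw [← map_neg, pull_eq_iff, map_neg]

theorem pull_eq_zero_iff {X : Tan M.Model x} : s.pull J x X = 0 ↔ dmap M.Model F J x X = 0 := by
  have h := s.pull_eq_iff (J := J) (x := x) (X := X) (u := 0)
  rwa [map_zero, map_zero] at h

/-- If `Ru = 0` and `⟨u, R·⟩ = 0`, then `form_proj_add` makes `u` orthogonal to everything. -/
theorem ident_injective (hadj : ∀ u v, P.form (s.proj (J x) u) v + P.form u (s.proj (J x) v)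
    = P.form u v) : Function.Injective (s.ident (J x)) := by
  rw [← LinearMap.ker_eq_bot, LinearMap.ker_eq_bot']
  intro u hu
  have h1 : dressing E F (J x) u = 0 := congrArg Prod.fst hu
  have h2 : s.sDual (J x) u = 0 := congrArg Prod.snd hu
  refine P.nondegenerate u fun v => ?_
  have h3 : s.proj (J x) u = 0 := (congrArg (s.s (J x)) h1).trans (map_zero _)
  have h4 : P.form u (s.proj (J x) v) = 0 :=
    congrArg (fun A : Cot F (J x) => A (dressing E F (J x) v)) h2
  rw [← hadj, h3, h4, map_zero, add_zero]
  rfl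

section Strong

variable {L : Submodule ℝ (Gen M.Model x)}
  (hadj : ∀ u v, P.form (s.proj (J x) u) v + P.form u (s.proj (J x) v) = P.form u v)
  (lag : ∀ e : Gen M.Model x, e ∈ L ↔ ∀ e' ∈ L, pairing e e' = 0)
  (fwd : s.LS (J x) = forwardImage J x L)
  (tr : ∀ X : Tan M.Model x, dmap M.Model F J x X = 0 → (X, (0 : Cot M.Model x)) ∈ L → X = 0)
  (hr : ∀ v : P.g, s.pull J x (r v) = s.proj (J x) v)
  (hrL : ∀ v : P.g, (r v, s.pullDual J x v) ∈ L)
  (hm : ∀ α, s.pull J x (p α) = -s.proj (J x) (j.j (rhoDual r α)))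
  (hmL : ∀ α, (p α, α + s.pullDual J x (genCoeff j r 0 α)) ∈ L)

include tr in
-- The difference `(X - Y, 0)` lies in `L ∩ TM` and in the kernel of `dJ`. This uniqueness
-- identifies `ρ_M` and `π♯`, and gives their naturality under morphisms.
theorem eq_of_strong {X Y : Tan M.Model x} {a : Cot M.Model x} (hX : (X, a) ∈ L) (hY : (Y, a) ∈ L)
    (h : s.pull J x X = s.pull J x Y) : X = Y := by
  have h1 := L.sub_mem hX hY
  rw [Prod.mk_sub_mk, sub_self] at h1
  refine sub_eq_zero.1 (tr _ (pull_eq_zero_iff (s := s).1 ?_) h1)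
  rw [map_sub, h, sub_self]

include fwd tr in
/-- The infinitesimal action induced by a strong Dirac map. -/
theorem exists_rho : ∃ r : P.g →ₗ[ℝ] Tan M.Model x, (∀ v : P.g, s.pull J x (r v) = s.proj (J x) v) ∧
    ∀ v : P.g, (r v, s.pullDual J x v) ∈ L := by
  let A : P.g × Tan M.Model x →ₗ[ℝ] Gen M.Model x :=
    (LinearMap.snd ℝ _ _).prod ((s.pullDual J x ∘ₗ P.g.subtype) ∘ₗ LinearMap.fst ℝ _ _)
  let B : P.g × Tan M.Model x →ₗ[ℝ] E :=
    (s.pull (K := M.Model) J x : Tan M.Model x →ₗ[ℝ] E) ∘ₗ LinearMap.snd ℝ _ _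
      - ((s.proj (J x) : E →ₗ[ℝ] E) ∘ₗ P.g.subtype) ∘ₗ LinearMap.fst ℝ _ _
  have hex : ∀ v, ∃ X, (v, X) ∈ L.comap A ⊓ LinearMap.ker B := by
    intro v
    have h : s.ident (J x) v ∈ s.LS (J x) := ⟨v, v.2, rfl⟩
    rw [fwd, mem_forwardImage] at h
    obtain ⟨X, hX, hL⟩ := h
    exact ⟨X, hL, sub_eq_zero.2 (s.pull_eq_iff.2 hX)⟩
  have huni : ∀ X, ((0 : P.g), X) ∈ L.comap A ⊓ LinearMap.ker B → X = 0 := by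
    intro X hX
    have h1 : (X, s.pullDual J x ((0 : P.g) : E)) ∈ L := hX.1
    have h2 : s.pull J x X = s.proj (J x) ((0 : P.g) : E) := sub_eq_zero.1 hX.2
    rw [Submodule.coe_zero, map_zero] at h1 h2
    exact tr X (pull_eq_zero_iff.1 h2) h1
  obtain ⟨r, h⟩ := exists_linearMap_mem _ hex huni
  exact ⟨r, fun v => sub_eq_zero.1 (h v).2, fun v => (h v).1⟩

include lag hrL in
-- Orthogonality of `(X, a)` to the elements `(ρ_M(v), J^*σ(v))` of `L`.
theorem rhoDual_of_mem {X : Tan M.Model x} {a : Cot M.Model x} (h : (X, a) ∈ L) :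
    rhoDual r a = -P.toDual (s.pull J x X) := by
  ext v
  have h1 := (lag _).1 h _ (hrL v)
  simp only [pairing, pullDual_apply] at h1
  rw [rhoDual_apply, LinearMap.neg_apply, P.toDual_apply, P.symm]
  linarith

include hadj lag tr hr hrL in
/-- The bivector of a strong Dirac map. -/
theorem exists_pi : ∃ p : Cot M.Model x →ₗ[ℝ] Tan M.Model x,
    (∀ α, s.pull J x (p α) = -s.proj (J x) (j.j (rhoDual r α))) ∧
    ∀ α, (p α, α + s.pullDual J x (genCoeff j r 0 α)) ∈ L := by
  let N : Cot M.Model x →ₗ[ℝ] E :=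
    { toFun := fun α => genCoeff j r 0 α
      map_add' := fun α β => by
        simp only [genCoeff, rhoDual_add, map_add, Submodule.coe_zero, zero_sub, neg_add]
      map_smul' := fun c α => by
        simp only [genCoeff, rhoDual_smul, map_smul, Submodule.coe_zero, zero_sub, smul_neg,
          RingHom.id_apply] }
  let A : Cot M.Model x × Tan M.Model x →ₗ[ℝ] Gen M.Model x :=
    (LinearMap.snd ℝ _ _).prod ((LinearMap.id + s.pullDual J x ∘ₗ N) ∘ₗ LinearMap.fst ℝ _ _)
  let B : Cot M.Model x × Tan M.Model x →ₗ[ℝ] E :=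
    (s.pull (K := M.Model) J x : Tan M.Model x →ₗ[ℝ] E) ∘ₗ LinearMap.snd ℝ _ _
      - ((s.proj (J x) : E →ₗ[ℝ] E) ∘ₗ N) ∘ₗ LinearMap.fst ℝ _ _
  have hN : ∀ α, s.proj (J x) (N α) = -s.proj (J x) (j.j (rhoDual r α)) := fun α => by
    change s.proj (J x) (((0 : P.g) : E) - j.j (rhoDual r α)) = _
    rw [Submodule.coe_zero, zero_sub, map_neg]
  -- The covectors `α` for which some `X` satisfies both conditions on `π♯α`. By duality `W` is
  -- everything once no nonzero vector is annihilated by it.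
  let W : Submodule ℝ (Cot M.Model x) := (L.comap A ⊓ LinearMap.ker B).map (LinearMap.fst ℝ _ _)
  have hW : W = ⊤ := by
    have hcot : ∀ {X : Tan M.Model x} {a : Cot M.Model x}, (X, a) ∈ L → a ∈ W := by
      intro X a h
      have h1 := rhoDual_of_mem lag hrL h
      have h2 : genCoeff j r 0 a = s.pull J x X - j.toG (s.pull J x X) := by
        rw [genCoeff, h1, Submodule.coe_zero, map_neg, zero_sub, neg_neg, j.coe_toG, sub_sub_cancel]
      -- Subtracting `ρ_M` of the `𝔤`-component of `J^*s(X)` leaves the part along `j`, as required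
      -- of `π♯a`.
      refine ⟨(a, X - r (j.toG (s.pull J x X))), ⟨?_, ?_⟩, rfl⟩
      · have h3 := L.sub_mem h (hrL (j.toG (s.pull J x X)))
        have h4 : a + s.pullDual J x (genCoeff j r 0 a) = a - s.pullDual J x (j.toG (s.pull J x X)) := by
          rw [h2, map_sub, pullDual_pull, zero_sub, sub_eq_add_neg]
        change (X - r (j.toG (s.pull J x X)), a + s.pullDual J x (genCoeff j r 0 a)) ∈ L
        rw [h4]
        exact h3
      · change s.pull J x (X - r (j.toG (s.pull J x X))) - s.proj (J x) (genCoeff j r 0 a) = 0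
        rw [h2, map_sub, map_sub, pull_eq_proj_pull, hr, sub_self]
    have hpull : ∀ u : E, s.pullDual J x u ∈ W := by
      intro u
      obtain ⟨k, hk⟩ : ∃ k, k = u - s.proj (J x) u := ⟨_, rfl⟩
      have h1 : rhoDual r (s.pullDual J x u) = P.toDual k := by
        ext v
        rw [hk, rhoDual_apply, pullDual_apply, hr, P.toDual_apply, map_sub, sub_apply]
        linarith [hadj u v]
      have h2 : genCoeff j r 0 (s.pullDual J x u) = j.toG k - k := by
        rw [genCoeff, h1, Submodule.coe_zero, zero_sub, j.coe_toG, sub_sub_cancel_left]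
      have h3 : s.pullDual (K := M.Model) J x (s.proj (J x) u) = 0 := by
        ext Y
        exact s.isotropic (J x) _ _
      -- On a pulled-back covector the moment condition dictates the value `ρ_M(·)`. Its argument is
      -- the `𝔤`-component of `k = u - Ru`, which has the same image as `u` under `J^*s^*`.
      refine ⟨(s.pullDual J x u, r (j.toG k)), ⟨?_, ?_⟩, rfl⟩
      · change (r (j.toG k), s.pullDual J x u + s.pullDual J x (genCoeff j r 0 (s.pullDual J x u))) ∈ L
        have h4 : s.pullDual (K := M.Model) J x u + s.pullDual J x (genCoeff j r 0 (s.pullDual J x u))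
            = s.pullDual J x (j.toG k) := by
          have h5 : s.pullDual (K := M.Model) J x k = s.pullDual J x u := by
            rw [hk, map_sub, h3, sub_zero]
          rw [h2, map_sub, h5, add_sub_cancel]
        rw [h4]
        exact hrL _
      · change s.pull J x (r (j.toG k)) - s.proj (J x) (genCoeff j r 0 (s.pullDual J x u)) = 0
        have h5 : s.proj (J x) k = 0 := by rw [hk, map_sub, s.proj_proj, sub_self]
        rw [h2, hr, map_sub, h5, sub_zero, sub_self]
    refine submodule_dual_eq_top (K := M.Model) fun X hX => ?_
    -- A vector annihilated by the covectors of `L` lies in `L` because `L` is lagrangian.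
    -- Annihilated also by all `J^*s^*(u)`, it is in the kernel of `dJ`, so it is zero by
    -- strongness.
    have h1 : (X, (0 : Cot M.Model x)) ∈ L := by
      refine (lag _).2 ?_
      rintro ⟨Y, b⟩ h
      change b X + (0 : ℝ) = 0
      rw [add_zero]
      exact hX b (hcot h)
    have h2 : s.pull (K := M.Model) J x X = 0 := by
      refine P.nondegenerate _ fun v => ?_
      rw [P.symm]
      exact hX _ (hpull v)
    exact tr X (pull_eq_zero_iff.1 h2) h1
  have hex : ∀ α, ∃ X, (α, X) ∈ L.comap A ⊓ LinearMap.ker B := by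
    intro α
    have h : α ∈ W := hW ▸ Submodule.mem_top
    obtain ⟨⟨α', X⟩, h, rfl⟩ := h
    exact ⟨X, h⟩
  have huni : ∀ X, ((0 : Cot M.Model x), X) ∈ L.comap A ⊓ LinearMap.ker B → X = 0 := by
    intro X hX
    have h1 : (X, 0 + s.pullDual J x (N 0)) ∈ L := hX.1
    have h2 : s.pull J x X = s.proj (J x) (N 0) := sub_eq_zero.1 hX.2
    rw [map_zero, map_zero] at h1 h2
    rw [add_zero] at h1
    exact tr X (pull_eq_zero_iff.1 h2) h1
  obtain ⟨p, h⟩ := exists_linearMap_mem _ hex huni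
  exact ⟨p, fun α => (sub_eq_zero.1 (h α).2).trans (hN α), fun α => (h α).1⟩

include hadj lag hm hmL in
theorem skew_of_mem (α : Cot M.Model x) : α (p α) = 0 := by
  have h := (lag _).1 (hmL α) _ (hmL α)
  have h1 := form_proj_self (j := j) hadj (rhoDual r α)
  simp only [pairing, add_apply, pullDual_apply, hm, genCoeff, Submodule.coe_zero, zero_sub,
    map_neg, neg_apply, h1] at h
  linarith

include hrL hmL in
theorem genSection_mem (e : P.g × Cot M.Model x) : s.genSection j J x r p e ∈ L := by
  obtain ⟨v, α⟩ := e
  have h := L.add_mem (hrL v) (hmL α)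
  have h1 : s.pullDual (K := M.Model) J x v + (α + s.pullDual J x (genCoeff j r 0 α))
      = α + s.pullDual J x (genCoeff j r v α) := by
    rw [genCoeff, genCoeff, Submodule.coe_zero, zero_sub, map_neg, map_sub]
    abel
  rw [genSection_apply, ← h1]
  exact h

include hadj lag hrL hm hmL in
-- The image of `e` lies in `L`, so `L` is orthogonal to it; and whatever is orthogonal to the image
-- belongs to it by `eq_genSection_of_pairing`.
theorem eq_range_genSection : L = LinearMap.range (s.genSection j J x r p) := by
  apply le_antisymm
  · rintro ⟨X, a⟩ h
    exact ⟨_, eq_genSection_of_pairing (skew_of_mem hadj lag hm hmL) fun e =>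
      (lag _).1 h _ (genSection_mem hrL hmL e)⟩
  · rintro _ ⟨e, rfl⟩
    exact genSection_mem hrL hmL e

theorem mem_backwardImage_CS {e : Gen M.Model x} :
    e ∈ backwardImage J x (s.CS j (J x)) ↔
      ∃ μ, s.pull J x e.1 = s.proj (J x) (j.j μ) ∧ e.2 = s.pullDual J x (j.j μ) := by
  rw [mem_backwardImage]
  constructor
  · rintro ⟨β, h1, u, ⟨μ, rfl⟩, h2⟩
    have h3 := congrArg Prod.fst h2
    have h4 := congrArg Prod.snd h2
    refine ⟨μ, s.pull_eq_iff.2 h3.symm, ?_⟩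
    rw [← h1]
    exact congrArg (dmapDual M.Model F J x) h4.symm
  · rintro ⟨μ, h1, h2⟩
    exact ⟨s.sDual (J x) (j.j μ), h2.symm, j.j μ, ⟨μ, rfl⟩,
      Prod.ext (s.pull_eq_iff.1 h1).symm rfl⟩

include hadj fwd tr hr hrL hm hmL in
-- A common element maps forward to an element of `L_S ∩ C_S`, hence comes from `𝔤 ∩ j(𝔤^*) = 0`,
-- and strongness kills what is left. Spanning is by an explicit decomposition.
theorem isCompl_backwardImage : IsCompl L (backwardImage J x (s.CS j (J x))) := by
  constructor
  · rw [Submodule.disjoint_def]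
    rintro ⟨X, a⟩ hL hC
    obtain ⟨μ, h1, h2⟩ := mem_backwardImage_CS.1 hC
    change s.pull J x X = _ at h1
    change a = _ at h2
    have h3 : s.ident (J x) (j.j μ) ∈ s.LS (J x) := by
      rw [fwd, mem_forwardImage]
      refine ⟨X, s.pull_eq_iff.1 h1, ?_⟩
      rw [h2] at hL
      exact hL
    obtain ⟨v, hv, hvj⟩ := h3
    have h4 : v = j.j μ := ident_injective hadj hvj
    have h5 : μ = 0 := by
      rw [← j.toDual_j μ, ← h4]
      exact P.toDual_coe ⟨v, hv⟩
    rw [h5, map_zero, map_zero] at h1 h2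
    rw [h2] at hL ⊢
    rw [tr X (pull_eq_zero_iff.1 h1) hL]
    rfl
  · rw [codisjoint_iff, eq_top_iff]
    rintro ⟨Y, b⟩ -
    -- Chosen so that the coefficient of `e(v, b)` is `J^*s(Y) - jμ`. Then `(Y, b) - e(v, b)` has
    -- covector `J^*s^*(jμ)` and satisfies the tangent condition of `C`.
    let v := j.toG (s.pull J x Y)
    let μ := P.toDual (s.pull J x Y) + rhoDual r b
    have hw : genCoeff j r v b = s.pull J x Y - j.j μ := by
      rw [genCoeff, j.coe_toG, map_add]
      abel
    have h1 : (Y, b) = s.genSection j J x r p (v, b)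
        + (Y - (r v + p b), s.pullDual J x (j.j μ)) := by
      rw [genSection_apply, hw, map_sub, pullDual_pull]
      refine Prod.ext ?_ ?_
      · change Y = r v + p b + (Y - (r v + p b))
        abel
      · change b = b + (0 - s.pullDual J x (j.j μ)) + s.pullDual J x (j.j μ)
        abel
    rw [h1]
    refine Submodule.add_mem_sup (genSection_mem hrL hmL _) (mem_backwardImage_CS.2 ⟨μ, ?_, rfl⟩)
    change s.pull J x (Y - (r v + p b)) = _
    rw [map_sub, pull_genSection hr hm, hw, map_sub, pull_eq_proj_pull, sub_sub_cancel]

include hadj hm in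
-- This exhibits `π♯α` as the vector part of the element of `L` that represents `α ∘ pr_TM` on `C`,
-- as in the definition of `π` by the pair `(L, C)`.
theorem pairing_backwardImage (α : Cot M.Model x) {c : Gen M.Model x}
    (hc : c ∈ backwardImage J x (s.CS j (J x))) :
    pairing (p α, α + s.pullDual J x (genCoeff j r 0 α)) c = α c.1 := by
  obtain ⟨μ, h1, h2⟩ := mem_backwardImage_CS.1 hc
  have h3 := hadj (j.j (rhoDual r α)) (j.j μ)
  rw [j.isotropic, P.symm (s.proj (J x) _)] at h3
  simp only [pairing, h2, add_apply, pullDual_apply, h1, hm, genCoeff, Submodule.coe_zero, zero_sub,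
    map_neg, neg_apply]
  linarith

end Strong

/-- One inclusion is `e(v, 0)`. For the other, the moment condition turns `π♯ J^*β` into `ρ_M(σ̄
β)`, so that the vector is `ρ_M(v')` for some `v' ∈ 𝔤`, and `β` has to be `σ(v')`. -/
theorem forwardImage_range_genSection [FiniteDimensional ℝ E]
    (hadj : ∀ u v, P.form (s.proj (J x) u) v + P.form u (s.proj (J x) v) = P.form u v)
    (hr : ∀ v : P.g, s.pull J x (r v) = s.proj (J x) v)
    (hm : ∀ α, s.pull J x (p α) = -s.proj (J x) (j.j (rhoDual r α)))
    (hp : ∀ α : Cot M.Model x, α (p α) = 0) :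
    s.LS (J x) = forwardImage J x (LinearMap.range (s.genSection j J x r p)) := by
  apply le_antisymm
  · rintro _ ⟨v, hv, rfl⟩
    rw [mem_forwardImage]
    refine ⟨r ⟨v, hv⟩, s.pull_eq_iff.1 (hr ⟨v, hv⟩), (⟨v, hv⟩, 0), ?_⟩
    rw [genSection_apply, genCoeff, rhoDual_zero, map_zero, map_zero, sub_zero, add_zero, zero_add]
    rfl
  · rintro ⟨Y, β⟩ h
    obtain ⟨X, hX, h⟩ := mem_forwardImage.1 h
    change dmap M.Model F J x X = Y at hX
    subst hX
    have h0 := eq_genSection_of_pairing hp fun e =>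
      (mem_range_genSection_iff hadj hr hm hp _).1 h _ ⟨e, rfl⟩
    let v := j.toG (s.pull J x X)
    let v' : P.g := v + j.sigmaBar (J x) β
    have h1 : X = r v' := by
      have h1 := congrArg Prod.fst h0
      change r v + p (dmapDual M.Model F J x β) = X at h1
      rw [(moment_iff hp).2 (fun α => pull_neg_iff.1 (hm α)) β, ← map_add] at h1
      exact h1.symm
    have h2 : s.pull J x X = s.proj (J x) v' := by rw [h1, hr]
    -- Since `ρ_S` is onto, `β` is determined by its values on `ρ_S(u)`. The component of `u` in `𝔤`
    -- is handled by orthogonality to `e(·, 0)`, the component along `j` by the definition of `σ̄`.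
    have h3 : ∀ u, β (dressing E F (J x) u) = P.form v' (s.proj (J x) u) := by
      intro u
      rw [← j.toG_add u, map_add, map_add, map_add, map_add, ← apply_sigmaBar]
      congr 1
      · rw [← s.pull_eq_iff.1 (hr (j.toG u))]
        have h4 := (mem_range_genSection_iff hadj hr hm hp _).1 h _ ⟨(j.toG u, 0), rfl⟩
        simp only [genSection_apply, pairing, genCoeff, rhoDual_zero, map_zero, sub_zero, add_zero,
          zero_add, pullDual_apply, h2] at h4
        have h5 := hadj v' (j.toG u)
        rw [P.form_coe, P.symm] at h5
        have h6 : dmapDual M.Model F J x β (r (j.toG u)) = β (dmap M.Model F J x (r (j.toG u))) := rfl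
        rw [h6] at h4
        linarith
      · have h5 := hadj v' (j.j (P.toDual u))
        rw [P.symm (v' : E) (j.j _), j.split, P.symm, ← h2, j.form_j] at h5
        have h6 : P.toDual u v' = P.toDual u v + P.toDual u (j.sigmaBar (J x) β) := map_add _ _ _
        rw [h6] at h5
        linarith
    refine ⟨v', v'.2, Prod.ext ?_ ?_⟩
    · exact (s.pull_eq_iff.1 h2).symm
    · ext Y
      rw [← s.split (J x) Y]
      exact (h3 _).symm

/-- The explicit preimage of `(X, 0)` is `(𝔤-part of J^*s(X), 0)`, and this is zero when `dJ X = 0`.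
-/
theorem strong_range_genSection
    (hadj : ∀ u v, P.form (s.proj (J x) u) v + P.form u (s.proj (J x) v) = P.form u v)
    (hr : ∀ v : P.g, s.pull J x (r v) = s.proj (J x) v)
    (hm : ∀ α, s.pull J x (p α) = -s.proj (J x) (j.j (rhoDual r α)))
    (hp : ∀ α : Cot M.Model x, α (p α) = 0) (X : Tan M.Model x) (hX : dmap M.Model F J x X = 0)
    (h : (X, (0 : Cot M.Model x)) ∈ LinearMap.range (s.genSection j J x r p)) : X = 0 := by
  have h0 := eq_genSection_of_pairing hp fun e =>
    (mem_range_genSection_iff hadj hr hm hp _).1 h _ ⟨e, rfl⟩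
  rw [(pull_eq_zero_iff (s := s)).2 hX] at h0
  have h1 := congrArg Prod.fst h0
  change r (j.toG 0) + p 0 = X at h1
  rw [← h1, map_zero, map_zero, map_zero, add_zero]

end ConnSplitting

end Pointwise

/-! ### Smoothness of fields and forms defined by linear systems. -/

section Solve

variable {K : Type*} [NormedAddCommGroup K] [NormedSpace ℝ K]
  {M : Type*} [TopologicalSpace M] [ChartedSpace K M] [IsManifold 𝓘(ℝ, K) ∞ M]
  {W : Type*} [NormedAddCommGroup W] [NormedSpace ℝ W]

theorem formInChart_fieldInChart_chart (α : ∀ x : M, Tan K x →L[ℝ] W) (X : ∀ x : M, Tan K x)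
    (x₀ : M) : ∀ᶠ y in 𝓝 x₀, formInChart α x₀ (extChartAt 𝓘(ℝ, K) x₀ y)
      (fieldInChart X x₀ (extChartAt 𝓘(ℝ, K) x₀ y)) = α y (X y) := by
  filter_upwards [extChartAt_source_mem_nhds (I := 𝓘(ℝ, K)) x₀] with y hy
  rw [formInChart_fieldInChart α X ((extChartAt 𝓘(ℝ, K) x₀).map_source hy)]
  have key : ∀ z : M, z = y → α z (X z) = α y (X y) := by rintro z rfl; rfl
  exact key _ ((extChartAt 𝓘(ℝ, K) x₀).left_inv hy)

variable [FiniteDimensional ℝ K]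

theorem contMDiffAt_formInChart_chart {α : ∀ x : M, Tan K x →L[ℝ] W} (hα : SmoothForm α) (x₀ : M) :
    ContMDiffAt 𝓘(ℝ, K) 𝓘(ℝ, K →L[ℝ] W) ∞
      (fun y => formInChart α x₀ (extChartAt 𝓘(ℝ, K) x₀ y)) x₀ :=
  (contDiffAt_formInChart hα x₀).contMDiffAt.comp x₀ contMDiffAt_extChartAt

/-- A vector field is smooth near a point where a smooth form is injective, if the value of the form
on it is smooth. -/
theorem contMDiffAt_field_of_injective [FiniteDimensional ℝ W] [T2Space M]
    {β : ∀ x : M, Tan K x →L[ℝ] W} (hβ : SmoothForm β) {X : ∀ x : M, Tan K x} {x₀ : M}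
    (hb : ContMDiffAt 𝓘(ℝ, K) 𝓘(ℝ, W) ∞ (fun x => β x (X x)) x₀)
    (hinj : Function.Injective (β x₀)) :
    ContMDiffAt 𝓘(ℝ, K) (𝓘(ℝ, K)).tangent ∞
      (fun x => (⟨x, X x⟩ : TangentBundle 𝓘(ℝ, K) M)) x₀ := by
  have hc : ContMDiffAt 𝓘(ℝ, K) 𝓘(ℝ, K) ∞
      (fun y => fieldInChart X x₀ (extChartAt 𝓘(ℝ, K) x₀ y)) x₀ := by
    refine contMDiffAt_of_injective_apply_eq (contMDiffAt_formInChart_chart hβ x₀) hb ?_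
      (formInChart_fieldInChart_chart β X x₀)
    rw [formInChart_self]
    exact hinj
  refine contMDiffAt_field_of_diffl fun f hf => ?_
  refine ((contMDiffAt_formInChart_chart (smoothForm_diffl hf) x₀).clm_apply hc
    ).congr_of_eventuallyEq ?_
  filter_upwards [formInChart_fieldInChart_chart (fun y => diffl f y) X x₀] with y hy
  exact hy.symm

theorem contMDiffAt_fieldInChart_chart {X : ∀ x : M, Tan K x} (hX : SmoothVF X) (x₀ : M)
    [T2Space M] : ContMDiffAt 𝓘(ℝ, K) 𝓘(ℝ, K) ∞
      (fun y => fieldInChart X x₀ (extChartAt 𝓘(ℝ, K) x₀ y)) x₀ := by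
  obtain ⟨g, hg, hgx⟩ := exists_contMDiff_eq_chart (E := K) x₀
  refine contMDiffAt_of_injective_apply_eq
    (contMDiffAt_formInChart_chart (smoothForm_diffl hg) x₀)
    (((smoothForm_diffl hg).apply hX) x₀) ?_ (formInChart_fieldInChart_chart _ X x₀)
  rw [formInChart_self]
  have h1 : (diffl g x₀ : K →L[ℝ] K) = ContinuousLinearMap.id ℝ K :=
    (diffl_congr hgx).trans (mfderiv_chart_self x₀)
  intro a b hab
  have := (congrArg (fun A : K →L[ℝ] K => A a) h1).symm.trans
    (hab.trans (congrArg (fun A : K →L[ℝ] K => A b) h1))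
  exact this

/-- A 1-form is smooth if its values on vector fields that span the tangent space at a given point
are smooth. -/
theorem smoothForm_of_frame [T2Space M] {a : ∀ x : M, Cot K x}
    (h : ∀ x₀, ∃ (n : ℕ) (Y : Fin n → ∀ x : M, Tan K x), (∀ i, SmoothVF (Y i)) ∧
      (∀ i, ContMDiff 𝓘(ℝ, K) 𝓘(ℝ, ℝ) ∞ (fun x => a x (Y i x))) ∧
      ∀ α : Cot K x₀, (∀ i, α (Y i x₀) = 0) → α = 0) : SmoothForm a := by
  rintro ⟨x₀, v₀⟩
  obtain ⟨n, Y, hY, ha, hinj⟩ := h x₀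
  obtain ⟨g, hg, hgx⟩ := exists_contMDiff_eq_chart (E := K) x₀
  -- `A y` evaluates a covector on the chart representatives of the `Y i`; the chart representative
  -- of `a` solves the resulting smooth system, which is injective at `x₀`.
  let A : M → (K →L[ℝ] ℝ) →L[ℝ] (Fin n → ℝ) := fun y => ContinuousLinearMap.pi fun i =>
    ContinuousLinearMap.apply ℝ ℝ (fieldInChart (Y i) x₀ (extChartAt 𝓘(ℝ, K) x₀ y))
  have hA : ContMDiffAt 𝓘(ℝ, K) 𝓘(ℝ, (K →L[ℝ] ℝ) →L[ℝ] (Fin n → ℝ)) ∞ A x₀ := by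
    refine contMDiffAt_clm_of_apply fun α => ?_
    rw [contMDiffAt_pi_space]
    intro i
    exact (ContinuousLinearMap.contMDiff α).contMDiffAt.comp x₀
      (contMDiffAt_fieldInChart_chart (hY i) x₀)
  have hb : ContMDiffAt 𝓘(ℝ, K) 𝓘(ℝ, Fin n → ℝ) ∞ (fun y i => a y (Y i y)) x₀ :=
    contMDiffAt_pi_space.2 fun i => ha i x₀
  have hc : ContMDiffAt 𝓘(ℝ, K) 𝓘(ℝ, K →L[ℝ] ℝ) ∞
      (fun y => formInChart a x₀ (extChartAt 𝓘(ℝ, K) x₀ y)) x₀ := by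
    refine contMDiffAt_of_injective_apply_eq hA hb ?_ ?_
    · rw [injective_iff_map_eq_zero]
      intro α hα
      refine hinj α fun i => ?_
      have h1 := congrFun hα i
      change α (fieldInChart (Y i) x₀ (extChartAt 𝓘(ℝ, K) x₀ x₀)) = 0 at h1
      rw [fieldInChart_self] at h1
      exact h1
    · filter_upwards [Filter.eventually_all.2 fun i =>
        formInChart_fieldInChart_chart a (Y i) x₀] with y hy
      exact funext hy
  have h1 : ContMDiffAt (𝓘(ℝ, K)).tangent 𝓘(ℝ, K →L[ℝ] ℝ) ∞
      (fun q : TangentBundle 𝓘(ℝ, K) M => formInChart a x₀ (extChartAt 𝓘(ℝ, K) x₀ q.1)) ⟨x₀, v₀⟩ :=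
    ContMDiffAt.comp (I' := 𝓘(ℝ, K)) (⟨x₀, v₀⟩ : TangentBundle 𝓘(ℝ, K) M)
      (g := fun y => formInChart a x₀ (extChartAt 𝓘(ℝ, K) x₀ y)) hc
      (contMDiff_tangent_proj (E := K) (M := M) _)
  refine (h1.clm_apply (smoothForm_diffl hg _)).congr_of_eventuallyEq ?_
  have h2 := (contMDiff_tangent_proj (E := K) (M := M)).continuous.continuousAt
    (x := ⟨x₀, v₀⟩) |>.eventually ((eventually_eventually_nhds.2 hgx).and
      (extChartAt_source_mem_nhds (I := 𝓘(ℝ, K)) x₀))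
  filter_upwards [h2] with q hq
  obtain ⟨y, v⟩ := q
  have hq1 := hq.1
  have hq2 : y ∈ (extChartAt 𝓘(ℝ, K) x₀).source := hq.2
  change a y v = formInChart a x₀ (extChartAt 𝓘(ℝ, K) x₀ y) (diffl g y v)
  rw [diffl_congr (E := K) hq1]
  have h3 := (extChartAt 𝓘(ℝ, K) x₀).left_inv hq2
  have h4 : MDifferentiableAt 𝓘(ℝ, K) 𝓘(ℝ, K) (extChartAt 𝓘(ℝ, K) x₀) y :=
    (contMDiffAt_extChartAt' (n := ∞) (by simpa using hq2)).mdifferentiableAt (by simp)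
  have h5 := mfderiv_comp_apply (I' := 𝓘(ℝ, K)) y
    ((contMDiffAt_chart_symm x₀ ((extChartAt 𝓘(ℝ, K) x₀).map_source hq2)).mdifferentiableAt
      (by simp)) h4 v
  -- The chart is undone by its inverse near `y`, so `v` is recovered from its coordinates and `a y
  -- v` becomes the chart representative applied to them.
  have h6 : ((extChartAt 𝓘(ℝ, K) x₀).symm ∘ extChartAt 𝓘(ℝ, K) x₀ : M → M) =ᶠ[𝓝 y] id := by
    filter_upwards [(isOpen_extChartAt_source (I := 𝓘(ℝ, K)) x₀).mem_nhds hq2] with z hz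
    exact (extChartAt 𝓘(ℝ, K) x₀).left_inv hz
  rw [h6.mfderiv_eq] at h5
  have h7 : v = (mfderiv 𝓘(ℝ, K) 𝓘(ℝ, K) (extChartAt 𝓘(ℝ, K) x₀).symm (extChartAt 𝓘(ℝ, K) x₀ y) :
      K →L[ℝ] K) ((mfderiv 𝓘(ℝ, K) 𝓘(ℝ, K) (extChartAt 𝓘(ℝ, K) x₀) y : K →L[ℝ] K) v) :=
    (congrArg (fun A : K →L[ℝ] K => A v) (mfderiv_id (I := 𝓘(ℝ, K)) (x := y))).symm.trans h5
  have key : ∀ z : M, z = y → ∀ w : K, (a z : K →L[ℝ] ℝ) w = (a y : K →L[ℝ] ℝ) w := by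
    rintro z rfl w; rfl
  refine (congrArg (a y : K →L[ℝ] ℝ) h7).trans ?_
  exact (key _ h3 _).symm

end Solve

/-! ### Generating sections `e(v, df)` and their Courant brackets. -/

section Generators

variable {E : Type*} [NormedAddCommGroup E] [NormedSpace ℝ E] [FiniteDimensional ℝ E]
  {D : Type*} [TopologicalSpace D] [ChartedSpace E D] [Group D]
  {F : Type*} [NormedAddCommGroup F] [NormedSpace ℝ F]
  {G : Subgroup D} [ChartedSpace F (D ⧸ G)]
  {P : ManinPair E D} {j : P.Splitting} {M : Mfd.{u}}

theorem contMDiff_j_rhoDual {r : ∀ x : M.carrier, P.g →ₗ[ℝ] Tan M.Model x}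
    (hr : ∀ v, SmoothVF (fun x => r x v)) {α : ∀ x : M.carrier, Cot M.Model x} (hα : SmoothForm α) :
    ContMDiff 𝓘(ℝ, M.Model) 𝓘(ℝ, E) ∞ (fun x => j.j (rhoDual (r x) (α x))) := by
  let b := Module.finBasis ℝ P.g
  have h : (fun x => j.j (rhoDual (r x) (α x)))
      = fun x => ∑ i, (α x (r x (b i))) • j.j (b.dualBasis i) := by
    funext x
    conv_lhs => rw [← b.dualBasis.sum_repr (rhoDual (r x) (α x)), map_sum]
    simp only [map_smul]
    refine Finset.sum_congr rfl fun i _ => ?_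
    rw [b.dualBasis_repr, rhoDual_apply]
  rw [h]
  exact ContMDiff.sum fun i _ => (hα.apply (hr (b i))).smul contMDiff_const

theorem contMDiff_genCoeff {r : ∀ x : M.carrier, P.g →ₗ[ℝ] Tan M.Model x}
    (hr : ∀ v, SmoothVF (fun x => r x v)) (v : P.g) {α : ∀ x : M.carrier, Cot M.Model x}
    (hα : SmoothForm α) :
    ContMDiff 𝓘(ℝ, M.Model) 𝓘(ℝ, E) ∞ (fun x => ConnSplitting.genCoeff j (r x) v (α x)) :=
  contMDiff_const.sub (contMDiff_j_rhoDual hr hα)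

/-- The conditions on a Hamiltonian quasi-Poisson space that do not involve brackets. -/
structure IsPreHam (j : P.Splitting) (J : M.carrier → D ⧸ G)
    (r : ∀ x : M.carrier, P.g →ₗ[ℝ] Tan M.Model x)
    (p : ∀ x : M.carrier, Cot M.Model x →ₗ[ℝ] Tan M.Model x) : Prop where
  smooth_J : ContMDiff 𝓘(ℝ, M.Model) 𝓘(ℝ, F) ∞ J
  skew : ∀ x (α : Cot M.Model x), α (p x α) = 0
  smooth_p : ∀ α : ∀ x : M.carrier, Cot M.Model x, SmoothForm α → SmoothVF (fun x => p x (α x))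
  smooth_r : ∀ v, SmoothVF (fun x => r x v)
  equivariant : ∀ x (v : P.g), dmap M.Model F J x (r x v) = dressing E F (J x) v
  moment : ∀ x (α : Cot M.Model x),
    dmap M.Model F J x (p x α) = -dressing E F (J x) (j.j (rhoDual (r x) α))

theorem HamQP.isPreHam (B : HamQP j F G M) : IsPreHam (F := F) j B.J B.ρ B.π where
  smooth_J := B.smooth_J
  skew := B.skew
  smooth_p := B.smooth_π
  smooth_r := B.smooth_ρ
  equivariant := B.equivariant
  moment x := (moment_iff (B.skew x)).1 (B.moment x)

/-- The vector field `ρ_M(v) + π^♯(df)`. -/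
def genVec (r : ∀ x : M.carrier, P.g →ₗ[ℝ] Tan M.Model x)
    (p : ∀ x : M.carrier, Cot M.Model x →ₗ[ℝ] Tan M.Model x) (v : P.g) (f : M.carrier → ℝ)
    (x : M.carrier) : Tan M.Model x := r x v + p x (dfun f x)

variable [IsManifold 𝓘(ℝ, F) ∞ (D ⧸ G)]

/-- The 1-form component of `genSection` on `(v, df)`. -/
def ConnSplitting.genForm (s : ConnSplitting P F G) (j : P.Splitting) (J : M.carrier → D ⧸ G)
    (r : ∀ x : M.carrier, P.g →ₗ[ℝ] Tan M.Model x) (v : P.g) (f : M.carrier → ℝ)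
    (x : M.carrier) : Cot M.Model x :=
  dfun f x + s.pullDual J x (ConnSplitting.genCoeff j (r x) v (dfun f x))

namespace IsPreHam

variable {s : ConnSplitting P F G} {J : M.carrier → D ⧸ G}
  {r : ∀ x : M.carrier, P.g →ₗ[ℝ] Tan M.Model x}
  {p : ∀ x : M.carrier, Cot M.Model x →ₗ[ℝ] Tan M.Model x}

theorem pull_r (h : IsPreHam (F := F) j J r p) (x : M.carrier) (v : P.g) :
    s.pull J x (r x v) = s.proj (J x) v := s.pull_eq_iff.2 (h.equivariant x v)

theorem pull_p (h : IsPreHam (F := F) j J r p) (x : M.carrier) (α : Cot M.Model x) :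
    s.pull J x (p x α) = -s.proj (J x) (j.j (rhoDual (r x) α)) :=
  ConnSplitting.pull_neg_iff.2 (h.moment x α)

theorem smoothVF_genVec (h : IsPreHam (F := F) j J r p) (v : P.g) {f : M.carrier → ℝ}
    (hf : ContMDiff 𝓘(ℝ, M.Model) 𝓘(ℝ, ℝ) ∞ f) : SmoothVF (genVec r p v f) :=
  (h.smooth_r v).add (h.smooth_p _ (smoothForm_diffl hf))

theorem smoothForm_genForm (h : IsPreHam (F := F) j J r p) (v : P.g) {f : M.carrier → ℝ}
    (hf : ContMDiff 𝓘(ℝ, M.Model) 𝓘(ℝ, ℝ) ∞ f) : SmoothForm (s.genForm j J r v f) :=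
  SmoothForm.add (smoothForm_diffl hf)
    (s.smoothForm_pullDual h.smooth_J (contMDiff_genCoeff h.smooth_r v (smoothForm_diffl hf)))

theorem dmap_genVec (h : IsPreHam (F := F) j J r p) (v : P.g) (f : M.carrier → ℝ) (x : M.carrier) :
    dmap M.Model F J x (genVec r p v f x)
      = dressing E F (J x) (ConnSplitting.genCoeff j (r x) v (dfun f x)) := by
  rw [genVec, map_add, h.equivariant, h.moment, ConnSplitting.genCoeff, map_sub, sub_eq_add_neg]

/-- Only `-j(ρ_M^* df)` varies, and it pairs to zero with the image of `j`; against `v'` it gives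
the function `-df(ρ_M(v'))`. The derivatives of coefficients thus become iterated derivatives of
functions. -/
theorem form_diffl_genCoeff (h : IsPreHam (F := F) j J r p) (v : P.g) {f : M.carrier → ℝ}
    (hf : ContMDiff 𝓘(ℝ, M.Model) 𝓘(ℝ, ℝ) ∞ f) (x : M.carrier) (X : Tan M.Model x) (v' : P.g)
    (α : Cot M.Model x) :
    P.form (diffl (fun y => ConnSplitting.genCoeff j (r y) v (dfun f y)) x X)
      (ConnSplitting.genCoeff j (r x) v' α) = -diffl (fun y => diffl f y (r y v')) x X := by
  let c := ConnSplitting.genCoeff j (r x) v' α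
  have h1 := diffl_clm_comp (P.form.flip c)
    (mdiff (contMDiff_genCoeff (j := j) h.smooth_r v (smoothForm_diffl hf)) x) X
  have h2 : (fun y => P.form.flip c (ConnSplitting.genCoeff j (r y) v (diffl f y)))
      = fun y => P.form v c - diffl f y (r y v') := by
    funext y
    change P.form (ConnSplitting.genCoeff j (r y) v (diffl f y)) c = _
    rw [ConnSplitting.genCoeff, map_sub, sub_apply]
    change _ - P.form (j.j (rhoDual (r y) (diffl f y))) (v' - j.j (rhoDual (r x) α)) = _
    rw [map_sub, j.isotropic, j.split, rhoDual_apply, sub_zero]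
  rw [h2, diffl_sub (mdiff contMDiff_const x)
    (mdiff ((smoothForm_diffl hf).apply (h.smooth_r v')) x), diffl_const] at h1
  refine (h1.symm.trans ?_)
  rw [sub_apply, zero_apply, zero_sub]

variable [LieGroup 𝓘(ℝ, E) ∞ D] [T2Space D] [ConnectedSpace D]
  [FiniteDimensional ℝ F] [T2Space (D ⧸ G)]

/-- The Courant bracket of two generating sections paired with a third one. -/
theorem pairing_courant_gen
    (hp : Manifold.IsSubmersion 𝓘(ℝ, E) 𝓘(ℝ, F) ∞ (QuotientGroup.mk : D → D ⧸ G))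
    (hG : P.IsIntegratedBy G) (h : IsPreHam (F := F) j J r p) (v₁ v₂ v₃ : P.g)
    {f₁ f₂ f₃ : M.carrier → ℝ} (hf₁ : ContMDiff 𝓘(ℝ, M.Model) 𝓘(ℝ, ℝ) ∞ f₁)
    (hf₂ : ContMDiff 𝓘(ℝ, M.Model) 𝓘(ℝ, ℝ) ∞ f₂) (hf₃ : ContMDiff 𝓘(ℝ, M.Model) 𝓘(ℝ, ℝ) ∞ f₃)
    (x : M.carrier) :
    pairing (courant (pullThree J s.phiS) (genVec r p v₁ f₁) (s.genForm j J r v₁ f₁)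
        (genVec r p v₂ f₂) (s.genForm j J r v₂ f₂) x)
        (genVec r p v₃ f₃ x, s.genForm j J r v₃ f₃ x)
      = diffl (fun y => diffl f₃ y (genVec r p v₂ f₂ y)) x (genVec r p v₁ f₁ x)
        - diffl (fun y => diffl f₃ y (genVec r p v₁ f₁ y)) x (genVec r p v₂ f₂ x)
        + diffl (fun y => diffl f₂ y (genVec r p v₁ f₁ y)) x (genVec r p v₃ f₃ x)
        - diffl (fun y => diffl f₂ y (r y v₃)) x (genVec r p v₁ f₁ x)
        + diffl (fun y => diffl f₁ y (r y v₃)) x (genVec r p v₂ f₂ x)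
        - diffl (fun y => diffl f₁ y (r y v₂)) x (genVec r p v₃ f₃ x)
        + P.form (lieBr D (ConnSplitting.genCoeff j (r x) v₁ (dfun f₁ x))
          (ConnSplitting.genCoeff j (r x) v₂ (dfun f₂ x)))
          (ConnSplitting.genCoeff j (r x) v₃ (dfun f₃ x)) := by
  have hX₁ := h.smoothVF_genVec v₁ hf₁
  have hX₂ := h.smoothVF_genVec v₂ hf₂
  have hX₃ := h.smoothVF_genVec v₃ hf₃
  have h0 := s.pairing_courant_pullDual hp hG h.smooth_J hX₁ hX₂ hX₃ (smoothForm_diffl hf₁)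
    (smoothForm_diffl hf₂) (contMDiff_genCoeff h.smooth_r v₁ (smoothForm_diffl hf₁))
    (contMDiff_genCoeff h.smooth_r v₂ (smoothForm_diffl hf₂))
    (contMDiff_genCoeff h.smooth_r v₃ (smoothForm_diffl hf₃))
    (h.dmap_genVec v₁ f₁) (h.dmap_genVec v₂ f₂) (h.dmap_genVec v₃ f₃) x (diffl f₃ x)
  have e1 := h.form_diffl_genCoeff v₂ hf₂ x (genVec r p v₁ f₁ x) v₃ (dfun f₃ x)
  have e2 := h.form_diffl_genCoeff v₁ hf₁ x (genVec r p v₂ f₂ x) v₃ (dfun f₃ x)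
  have e3 := h.form_diffl_genCoeff v₁ hf₁ x (genVec r p v₃ f₃ x) v₂ (dfun f₂ x)
  have d1 := diffl_mlieBracket hf₃ hX₁ hX₂ x
  have d2 := diffl_mlieBracket hf₂ hX₁ hX₃ x
  have d3 := diffl_mlieBracket hf₁ hX₂ hX₃ x
  refine h0.trans ?_
  simp only [dfun_eq_diffl] at e1 e2 e3 ⊢
  rw [e1, e2, e3, d1, d2, d3]
  ring

end IsPreHam

end Generators

/-! ### Integrability of `L` and the quasi-Poisson axioms. -/

section Integrability

variable {E : Type*} [NormedAddCommGroup E] [NormedSpace ℝ E]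
  {D : Type*} [TopologicalSpace D] [ChartedSpace E D] [Group D]
  {F : Type*} [NormedAddCommGroup F] [NormedSpace ℝ F]
  {G : Subgroup D} [ChartedSpace F (D ⧸ G)] [IsManifold 𝓘(ℝ, F) ∞ (D ⧸ G)]
  {P : ManinPair E D} {j : P.Splitting} {M : Mfd.{u}}

theorem extd_swap {K V : Type*} [NormedAddCommGroup K] [NormedSpace ℝ K] [NormedAddCommGroup V]
    [NormedSpace ℝ V] {N : Type*} [TopologicalSpace N] [ChartedSpace K N]
    (α : ∀ x : N, Tan K x →L[ℝ] V) (x : N) (X Y : Tan K x) : extd α x X Y = -extd α x Y X := by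
  have : ∀ (A : K →L[ℝ] K →L[ℝ] V) (a b : K), (A a - A.flip a) b = -(A b - A.flip b) a := by
    intro A a b
    simp
  exact this _ _ _

/-- The bracket term is cyclic by invariance of the form, and the three `ds` terms are permuted
cyclically. -/
theorem ConnSplitting.phiS_cycle (s : ConnSplitting P F G) (y : D ⧸ G) (X Y Z : Tan F y) :
    s.phiS y X Y Z = s.phiS y Y Z X := by
  change P.form (lieBr D (s.s y X) (s.s y Y)) (s.s y Z)
      + 1 / 2 * (P.form (extd s.s y X Y) (s.s y Z) + P.form (s.s y X) (extd s.s y Y Z)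
        - P.form (s.s y Y) (extd s.s y X Z))
    = P.form (lieBr D (s.s y Y) (s.s y Z)) (s.s y X)
      + 1 / 2 * (P.form (extd s.s y Y Z) (s.s y X) + P.form (s.s y Y) (extd s.s y Z X)
        - P.form (s.s y Z) (extd s.s y Y X))
  rw [P.form_lieBr_cycle, extd_swap s.s y X Y, extd_swap s.s y X Z, map_neg, map_neg, neg_apply,
    P.symm (extd s.s y Y X), P.symm (extd s.s y Y Z)]
  ring

/-- On sections of an isotropic subbundle the Courant bracket paired with a third section is
cyclic. -/
theorem pairing_courant_cycle (s : ConnSplitting P F G) (J : M.carrier → D ⧸ G)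
    {X Y Z : ∀ x : M.carrier, Tan M.Model x} {α β γ : ∀ x : M.carrier, Cot M.Model x}
    (hX : SmoothVF X) (hY : SmoothVF Y)
    (hZ : SmoothVF Z) (hα : SmoothForm α) (hβ : SmoothForm β) (hγ : SmoothForm γ)
    (hXY : ∀ x, pairing (X x, α x) (Y x, β x) = 0)
    (hXZ : ∀ x, pairing (X x, α x) (Z x, γ x) = 0) (x : M.carrier) :
    pairing (courant (pullThree J s.phiS) X α Y β x) (Z x, γ x)
      = pairing (courant (pullThree J s.phiS) Y β Z γ x) (X x, α x) := by
  rw [pairing_courant _ hX hY hZ hα hβ, pairing_courant _ hY hZ hX hβ hγ]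
  have h1 : (fun y => γ y (X y)) = fun y => -α y (Z y) := funext fun y => by
    have := hXZ y
    simp only [pairing] at this
    linarith
  have h2 : (fun y => β y (X y)) = fun y => -α y (Y y) := funext fun y => by
    have := hXY y
    simp only [pairing] at this
    linarith
  have h3 : pullThree J s.phiS x (X x) (Y x) (Z x) = pullThree J s.phiS x (Y x) (Z x) (X x) :=
    s.phiS_cycle (J x) _ _ _
  have h4 : ∀ A B : ∀ x : M.carrier, Tan M.Model x, VectorField.mlieBracket 𝓘(ℝ, M.Model) A B x
      = -VectorField.mlieBracket 𝓘(ℝ, M.Model) B A x := fun A B =>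
    VectorField.mlieBracket_swap_apply
  rw [h1, h2, h3, diffl_neg, diffl_neg, h4 Y X, h4 Z X, map_neg, map_neg, neg_apply, neg_apply]
  ring

variable {s : ConnSplitting P F G} {J : M.carrier → D ⧸ G}
  {r : ∀ x : M.carrier, P.g →ₗ[ℝ] Tan M.Model x}
  {p : ∀ x : M.carrier, Cot M.Model x →ₗ[ℝ] Tan M.Model x}

theorem dfun_zero (x : M.carrier) : dfun (E := M.Model) (fun _ : M.carrier => (0 : ℝ)) x = 0 :=
  diffl_const 0 x

theorem genVec_const (v : P.g) : genVec r p v (fun _ => 0) = fun x => r x v := by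
  funext x
  rw [genVec, dfun_zero, map_zero, add_zero]

theorem genVec_zero (f : M.carrier → ℝ) : genVec r p 0 f = fun x => p x (dfun f x) := by
  funext x
  rw [genVec, map_zero, zero_add]

theorem genCoeff_const (v : P.g) (x : M.carrier) :
    ConnSplitting.genCoeff j (r x) v (0 : Cot M.Model x) = v := by
  rw [ConnSplitting.genCoeff, rhoDual_zero, map_zero, sub_zero]

theorem genCoeff_zero (x : M.carrier) (α : Cot M.Model x) :
    ConnSplitting.genCoeff j (r x) 0 α = -j.j (rhoDual (r x) α) := by
  rw [ConnSplitting.genCoeff, Submodule.coe_zero, zero_sub]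

variable [FiniteDimensional ℝ E] [LieGroup 𝓘(ℝ, E) ∞ D] [T2Space D] [ConnectedSpace D]
  [FiniteDimensional ℝ F] [T2Space (D ⧸ G)]

namespace IsPreHam

/-- The component with two arguments from `𝔤` and one differential: since `⟨[u, v], j ρ_M^*df⟩ =
df(ρ_M[u, v])`, it compares the two sides on `df`. -/
theorem action_of_integrable
    (hp : Manifold.IsSubmersion 𝓘(ℝ, E) 𝓘(ℝ, F) ∞ (QuotientGroup.mk : D → D ⧸ G))
    (hG : P.IsIntegratedBy G) (h : IsPreHam (F := F) j J r p) (u v : P.g) (x : M.carrier)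
    (hT : ∀ f₃, ContMDiff 𝓘(ℝ, M.Model) 𝓘(ℝ, ℝ) ∞ f₃ →
      pairing (courant (pullThree J s.phiS) (genVec r p u (fun _ => 0))
        (s.genForm j J r u (fun _ => 0)) (genVec r p v (fun _ => 0))
        (s.genForm j J r v (fun _ => 0)) x)
        (genVec r p 0 f₃ x, s.genForm j J r 0 f₃ x) = 0) :
    VectorField.mlieBracket 𝓘(ℝ, M.Model) (fun y => r y u) (fun y => r y v) x
      = r x (P.gBr u v) := by
  refine tan_ext fun f hf => ?_
  have h1 := hT f hf
  rw [h.pairing_courant_gen hp hG u v 0 contMDiff_const contMDiff_const hf] at h1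
  simp only [genVec_const, diffl_const, zero_apply, dfun_zero, genCoeff_const,
    genCoeff_zero, map_neg] at h1
  have h2 : P.form (lieBr D (u : E) (v : E)) (j.j (rhoDual (r x) (dfun f x)))
      = diffl f x (r x (P.gBr u v)) := by
    rw [P.symm]
    exact j.split _ (P.gBr u v)
  rw [diffl_mlieBracket hf (h.smooth_r u) (h.smooth_r v)]
  linarith

/-- The component with one argument from `𝔤` and two differentials; the cobracket appears after a
cyclic permutation of `⟨[v, jμ], jν⟩`. -/
theorem lieBiv_of_integrable
    (hp : Manifold.IsSubmersion 𝓘(ℝ, E) 𝓘(ℝ, F) ∞ (QuotientGroup.mk : D → D ⧸ G))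
    (hG : P.IsIntegratedBy G) (h : IsPreHam (F := F) j J r p) (v : P.g) {f g : M.carrier → ℝ}
    (hf : ContMDiff 𝓘(ℝ, M.Model) 𝓘(ℝ, ℝ) ∞ f) (hg : ContMDiff 𝓘(ℝ, M.Model) 𝓘(ℝ, ℝ) ∞ g)
    (x : M.carrier)
    (hT : pairing (courant (pullThree J s.phiS) (genVec r p v (fun _ => 0))
        (s.genForm j J r v (fun _ => 0)) (genVec r p 0 f) (s.genForm j J r 0 f) x)
        (genVec r p 0 g x, s.genForm j J r 0 g x) = 0) :
    lieBiv (fun y => r y v) p f g x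
      = -j.cobr v (rhoDual (r x) (dfun f x)) (rhoDual (r x) (dfun g x)) := by
  rw [h.pairing_courant_gen hp hG v 0 0 contMDiff_const hf hg] at hT
  simp only [genVec_const, genVec_zero, diffl_const, zero_apply, dfun_zero, genCoeff_const,
    genCoeff_zero, map_neg, map_zero, lieBr_neg_right, neg_apply, neg_neg] at hT
  rw [P.form_lieBr_cycle] at hT
  have h1 : pbr p (dirDer (fun y => r y v) f) g x
      = -diffl (fun y => diffl f y (r y v)) x (p x (dfun g x)) := skew_pair (h.skew x) _ _
  have h2 : pbr p f (dirDer (fun y => r y v) g) x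
      = diffl (fun y => diffl g y (r y v)) x (p x (dfun f x)) := rfl
  have h3 : dirDer (fun y => r y v) (pbr p f g) x
      = diffl (fun y => diffl g y (p y (dfun f y))) x (r x v) := rfl
  rw [lieBiv, h1, h2, h3, ManinPair.Splitting.cobr]
  linarith

/-- The component with three differentials. Skewness of `π` turns the iterated derivatives into the
Jacobiator of `{·,·}`. -/
theorem halfSchouten_of_integrable
    (hp : Manifold.IsSubmersion 𝓘(ℝ, E) 𝓘(ℝ, F) ∞ (QuotientGroup.mk : D → D ⧸ G))
    (hG : P.IsIntegratedBy G) (h : IsPreHam (F := F) j J r p) {f g k : M.carrier → ℝ}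
    (hf : ContMDiff 𝓘(ℝ, M.Model) 𝓘(ℝ, ℝ) ∞ f) (hg : ContMDiff 𝓘(ℝ, M.Model) 𝓘(ℝ, ℝ) ∞ g)
    (hk : ContMDiff 𝓘(ℝ, M.Model) 𝓘(ℝ, ℝ) ∞ k) (x : M.carrier)
    (hT : pairing (courant (pullThree J s.phiS) (genVec r p 0 f) (s.genForm j J r 0 f)
        (genVec r p 0 g) (s.genForm j J r 0 g) x)
        (genVec r p 0 k x, s.genForm j J r 0 k x) = 0) :
    halfSchouten p f g k x
      = j.tri (rhoDual (r x) (dfun f x)) (rhoDual (r x) (dfun g x)) (rhoDual (r x) (dfun k x)) := by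
  rw [h.pairing_courant_gen hp hG 0 0 0 hf hg hk] at hT
  simp only [genVec_zero, diffl_const, zero_apply, genCoeff_zero, map_neg, map_zero,
    lieBr_neg_left, lieBr_neg_right, neg_neg] at hT
  have h1 : pbr p k f = fun y => -diffl k y (p y (dfun f y)) := funext fun y =>
    skew_pair (h.skew y) _ _
  have h2 : pbr p g (pbr p k f) x
      = -diffl (fun y => diffl k y (p y (dfun f y))) x (p x (dfun g x)) := by
    rw [h1]
    change diffl (fun y => -diffl k y (p y (dfun f y))) x _ = _
    rw [diffl_neg]
    rfl
  have h3 : pbr p f (pbr p g k) x = diffl (fun y => diffl k y (p y (dfun g y))) x (p x (dfun f x)) :=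
    rfl
  have h4 : pbr p k (pbr p f g) x = diffl (fun y => diffl g y (p y (dfun f y))) x (p x (dfun k x)) :=
    rfl
  rw [halfSchouten, h2, h3, h4, ManinPair.Splitting.tri]
  linarith

end IsPreHam

/-- For a Hamiltonian quasi-Poisson space, the Courant brackets of generating sections are orthogonal
to generating sections. -/
theorem HamQP.pairing_courant_gen
    (hp : Manifold.IsSubmersion 𝓘(ℝ, E) 𝓘(ℝ, F) ∞ (QuotientGroup.mk : D → D ⧸ G))
    (hG : P.IsIntegratedBy G) (s : ConnSplitting P F G) (B : HamQP j F G M) (v₁ v₂ v₃ : P.g)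
    {f₁ f₂ f₃ : M.carrier → ℝ} (hf₁ : ContMDiff 𝓘(ℝ, M.Model) 𝓘(ℝ, ℝ) ∞ f₁)
    (hf₂ : ContMDiff 𝓘(ℝ, M.Model) 𝓘(ℝ, ℝ) ∞ f₂) (hf₃ : ContMDiff 𝓘(ℝ, M.Model) 𝓘(ℝ, ℝ) ∞ f₃)
    (x : M.carrier) :
    pairing (courant (pullThree B.J s.phiS) (genVec B.ρ B.π v₁ f₁) (s.genForm j B.J B.ρ v₁ f₁)
        (genVec B.ρ B.π v₂ f₂) (s.genForm j B.J B.ρ v₂ f₂) x)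
        (genVec B.ρ B.π v₃ f₃ x, s.genForm j B.J B.ρ v₃ f₃ x) = 0 := by
  rw [B.isPreHam.pairing_courant_gen hp hG v₁ v₂ v₃ hf₁ hf₂ hf₃]
  have hsp : ∀ {f g : M.carrier → ℝ}, ContMDiff 𝓘(ℝ, M.Model) 𝓘(ℝ, ℝ) ∞ f →
      ContMDiff 𝓘(ℝ, M.Model) 𝓘(ℝ, ℝ) ∞ g →
      ContMDiff 𝓘(ℝ, M.Model) 𝓘(ℝ, ℝ) ∞ (fun y => diffl g y (B.π y (dfun f y))) := fun hf hg =>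
    (smoothForm_diffl hg).apply (B.smooth_π _ (smoothForm_diffl hf))
  have hsr : ∀ {f : M.carrier → ℝ} (v : P.g), ContMDiff 𝓘(ℝ, M.Model) 𝓘(ℝ, ℝ) ∞ f →
      ContMDiff 𝓘(ℝ, M.Model) 𝓘(ℝ, ℝ) ∞ (fun y => diffl f y (B.ρ y v)) := fun v hf =>
    (smoothForm_diffl hf).apply (B.smooth_ρ v)
  have hd : ∀ {f g : M.carrier → ℝ} (v : P.g), ContMDiff 𝓘(ℝ, M.Model) 𝓘(ℝ, ℝ) ∞ f →
      ContMDiff 𝓘(ℝ, M.Model) 𝓘(ℝ, ℝ) ∞ g → ∀ X : Tan M.Model x,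
      diffl (fun y => diffl g y (genVec B.ρ B.π v f y)) x X
        = diffl (fun y => diffl g y (B.ρ y v)) x X
          + diffl (fun y => diffl g y (B.π y (dfun f y))) x X := by
    intro f g v hf hg X
    have h1 : (fun y => diffl g y (genVec B.ρ B.π v f y))
        = fun y => diffl g y (B.ρ y v) + diffl g y (B.π y (dfun f y)) := funext fun y =>
      map_add _ _ _
    rw [h1, diffl_add (mdiff (hsr v hg) x) (mdiff (hsp hf hg) x), add_apply]
  have hact : ∀ (u v : P.g) {f : M.carrier → ℝ}, ContMDiff 𝓘(ℝ, M.Model) 𝓘(ℝ, ℝ) ∞ f →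
      diffl (fun y => diffl f y (B.ρ y v)) x (B.ρ x u)
        - diffl (fun y => diffl f y (B.ρ y u)) x (B.ρ x v)
        = P.form (lieBr D (u : E) (v : E)) (j.j (rhoDual (B.ρ x) (dfun f x))) := by
    intro u v f hf
    rw [← diffl_mlieBracket hf (B.smooth_ρ u) (B.smooth_ρ v), B.action, P.symm]
    exact (j.split (rhoDual (B.ρ x) (dfun f x)) (P.gBr u v)).symm
  have hlie : ∀ (v : P.g) {f g : M.carrier → ℝ}, ContMDiff 𝓘(ℝ, M.Model) 𝓘(ℝ, ℝ) ∞ f →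
      ContMDiff 𝓘(ℝ, M.Model) 𝓘(ℝ, ℝ) ∞ g →
      diffl (fun y => diffl g y (B.π y (dfun f y))) x (B.ρ x v)
        + diffl (fun y => diffl f y (B.ρ y v)) x (B.π x (dfun g x))
        - diffl (fun y => diffl g y (B.ρ y v)) x (B.π x (dfun f x))
        = -P.form (lieBr D (j.j (rhoDual (B.ρ x) (dfun f x))) (j.j (rhoDual (B.ρ x) (dfun g x)))) v := by
    intro v f g hf hg
    have h1 : pbr B.π (dirDer (fun y => B.ρ y v) f) g x
        = -diffl (fun y => diffl f y (B.ρ y v)) x (B.π x (dfun g x)) := skew_pair (B.skew x) _ _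
    have h := B.lie_π v f g hf hg x
    rw [lieBiv, h1, sub_neg_eq_add] at h
    exact h
  have hneg : ∀ {f g : M.carrier → ℝ} (X : Tan M.Model x),
      diffl (fun y => diffl g y (B.π y (dfun f y))) x X
        = -diffl (fun y => diffl f y (B.π y (dfun g y))) x X := by
    intro f g X
    have h1 : (fun y => diffl g y (B.π y (dfun f y))) = fun y => -diffl f y (B.π y (dfun g y)) :=
      funext fun y => skew_pair (B.skew y) _ _
    rw [h1, diffl_neg]
    rfl
  have hsch : diffl (fun y => diffl f₃ y (B.π y (dfun f₂ y))) x (B.π x (dfun f₁ x))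
      + diffl (fun y => diffl f₁ y (B.π y (dfun f₃ y))) x (B.π x (dfun f₂ x))
      + diffl (fun y => diffl f₂ y (B.π y (dfun f₁ y))) x (B.π x (dfun f₃ x))
      = P.form (lieBr D (j.j (rhoDual (B.ρ x) (dfun f₁ x))) (j.j (rhoDual (B.ρ x) (dfun f₂ x))))
        (j.j (rhoDual (B.ρ x) (dfun f₃ x))) := B.schouten_π f₁ f₂ f₃ hf₁ hf₂ hf₃ x
  -- The component with three arguments from `𝔤` vanishes because `𝔤` is an isotropic subalgebra.
  have hv : P.form (lieBr D (v₁ : E) (v₂ : E)) v₃ = 0 := P.form_coe (P.gBr v₁ v₂) v₃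
  rw [hd v₂ hf₂ hf₃, hd v₁ hf₁ hf₃, hd v₁ hf₁ hf₂]
  -- `a1`–`a3` are the components with two arguments from `𝔤`, `l1`–`l3` those with one, `hsch` the
  -- one with none. `n1` and `n2` only reorient `π(df₁, df₃)`.
  have a1 := hact v₁ v₂ hf₃
  have a2 := hact v₃ v₁ hf₂
  have a3 := hact v₂ v₃ hf₁
  have l1 := hlie v₁ hf₂ hf₃
  have l2 := hlie v₂ hf₃ hf₁
  have l3 := hlie v₃ hf₁ hf₂
  have n1 := hneg (f := f₁) (g := f₃) (B.ρ x v₂)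
  have n2 := hneg (f := f₁) (g := f₃) (B.π x (dfun f₂ x))
  have c := P.form_lieBr_cycle
  simp only [genVec, map_add, ConnSplitting.genCoeff, lieBr_sub_left, lieBr_sub_right, map_sub,
    sub_apply]
  generalize j.j (rhoDual (B.ρ x) (dfun f₁ x)) = m₁ at *
  generalize j.j (rhoDual (B.ρ x) (dfun f₂ x)) = m₂ at *
  generalize j.j (rhoDual (B.ρ x) (dfun f₃ x)) = m₃ at *
  linarith [c v₁ v₂ m₃, c v₃ v₁ m₂, c v₁ m₂ v₃, c v₂ v₃ m₁, c m₁ v₂ v₃, c v₁ m₂ m₃, c m₁ v₂ m₃,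
    c m₁ m₂ v₃, c v₂ m₃ m₁]

/-- The Dirac structure of a Hamiltonian quasi-Poisson space. -/
def HamQP.diracL (s : ConnSplitting P F G) (B : HamQP j F G M) (x : M.carrier) :
    Submodule ℝ (Gen M.Model x) := LinearMap.range (s.genSection j B.J x (B.ρ x) (B.π x))

theorem HamQP.exists_gen_eq (s : ConnSplitting P F G) (B : HamQP j F G M) {x : M.carrier}
    {e : Gen M.Model x} (he : e ∈ B.diracL s x) : ∃ (v : P.g) (f : M.carrier → ℝ),
      ContMDiff 𝓘(ℝ, M.Model) 𝓘(ℝ, ℝ) ∞ f ∧ (genVec B.ρ B.π v f x, s.genForm j B.J B.ρ v f x) = e := by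
  obtain ⟨⟨v, α⟩, rfl⟩ := he
  obtain ⟨f, hf, rfl⟩ := exists_dfun_eq (E := M.Model) x α
  exact ⟨v, f, hf, rfl⟩

theorem HamQP.gen_mem (s : ConnSplitting P F G) (B : HamQP j F G M) (v : P.g) (f : M.carrier → ℝ)
    (x : M.carrier) : (genVec B.ρ B.π v f x, s.genForm j B.J B.ρ v f x) ∈ B.diracL s x :=
  ⟨(v, dfun f x), rfl⟩

theorem HamQP.isDirac
    (hp : Manifold.IsSubmersion 𝓘(ℝ, E) 𝓘(ℝ, F) ∞ (QuotientGroup.mk : D → D ⧸ G))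
    (hG : P.IsIntegratedBy G) (s : ConnSplitting P F G) (B : HamQP j F G M) :
    IsDirac (B.diracL s) (pullThree B.J s.phiS) := by
  have hB := B.isPreHam
  have hlag : ∀ (x : M.carrier) (e : Gen M.Model x), e ∈ B.diracL s x ↔
      ∀ e' ∈ B.diracL s x, pairing e e' = 0 := fun x =>
    ConnSplitting.mem_range_genSection_iff (s.form_proj_add hG hp (B.J x)) (hB.pull_r x)
      (hB.pull_p x) (hB.skew x)
  refine ⟨hlag, fun x₀ e he => ?_, fun X α Y β hX hα hY hβ hXL hYL x => ?_⟩
  · obtain ⟨v, f, hf, he⟩ := B.exists_gen_eq s he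
    exact ⟨_, _, hB.smoothVF_genVec v hf, hB.smoothForm_genForm v hf, B.gen_mem s v f, he⟩
  · rw [hlag]
    intro e he
    obtain ⟨v₁, f₁, hf₁, h₁⟩ := B.exists_gen_eq s (hXL x)
    obtain ⟨v₂, f₂, hf₂, h₂⟩ := B.exists_gen_eq s (hYL x)
    obtain ⟨v₃, f₃, hf₃, rfl⟩ := B.exists_gen_eq s he
    have hs : ∀ (v : P.g) {f : M.carrier → ℝ}, ContMDiff 𝓘(ℝ, M.Model) 𝓘(ℝ, ℝ) ∞ f →
      SmoothVF (genVec B.ρ B.π v f) := fun v _ hf => hB.smoothVF_genVec v hf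
    have hs' : ∀ (v : P.g) {f : M.carrier → ℝ}, ContMDiff 𝓘(ℝ, M.Model) 𝓘(ℝ, ℝ) ∞ f →
      SmoothForm (s.genForm j B.J B.ρ v f) := fun v _ hf => hB.smoothForm_genForm v hf
    have hm := B.gen_mem s
    have hi : ∀ {x : M.carrier} {e e' : Gen M.Model x}, e ∈ B.diracL s x → e' ∈ B.diracL s x →
      pairing e e' = 0 := fun he he' => (hlag _ _).1 he _ he'
    -- Cyclicity moves an arbitrary section out of the bracket into the paired slot, where only its
    -- value at `x` matters and it can be replaced by a generating section. Doing so twice leaves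
    -- only generating sections.
    rw [pairing_courant_cycle s B.J hX hY (hs v₃ hf₃) hα hβ (hs' v₃ hf₃)
      (fun y => hi (hXL y) (hYL y))
      (fun y => hi (hXL y) (hm v₃ f₃ y)), ← h₁,
      pairing_courant_cycle s B.J hY (hs v₃ hf₃) (hs v₁ hf₁) hβ (hs' v₃ hf₃) (hs' v₁ hf₁)
      (fun y => hi (hYL y) (hm v₃ f₃ y))
      (fun y => hi (hYL y) (hm v₁ f₁ y)), ← h₂]
    exact B.pairing_courant_gen hp hG s v₃ v₁ v₂ hf₃ hf₁ hf₂ x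

end Integrability

/-- The fibre over `x₀` is finite-dimensional, and a smooth section passes through each member of a
finite generating family. -/
theorem exists_smooth_sections {M : Mfd.{u}} {L : ∀ x : M.carrier, Submodule ℝ (Gen M.Model x)}
    {φ : ∀ x : M.carrier, Tan M.Model x → Tan M.Model x → Cot M.Model x} (hL : IsDirac L φ)
    (x₀ : M.carrier) : ∃ (n : ℕ) (Y : Fin n → ∀ x : M.carrier, Tan M.Model x)
      (b : Fin n → ∀ x : M.carrier, Cot M.Model x), (∀ i, SmoothVF (Y i)) ∧
      (∀ i, SmoothForm (b i)) ∧ (∀ i x, (Y i x, b i x) ∈ L x) ∧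
      Submodule.span ℝ (Set.range fun i => (Y i x₀, b i x₀)) = L x₀ := by
  let L' : Submodule ℝ (M.Model × (M.Model →L[ℝ] ℝ)) := L x₀
  obtain ⟨n, c, hc⟩ := Submodule.fg_iff_exists_fin_generating_family.1 (IsNoetherian.noetherian L')
  have hcL : ∀ i, c i ∈ L x₀ := fun i => by
    have h : c i ∈ L' := hc ▸ Submodule.subset_span ⟨i, rfl⟩
    exact h
  choose Y b hY hb hm he using fun i => hL.smooth x₀ (c i) (hcL i)
  refine ⟨n, Y, b, hY, hb, hm, ?_⟩
  have h1 : (fun i => (Y i x₀, b i x₀)) = c := funext he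
  rw [h1]
  exact hc

/-! ### The two constructions on objects and their mutual inverseness. -/

section Objects

variable {E : Type*} [NormedAddCommGroup E] [NormedSpace ℝ E] [FiniteDimensional ℝ E]
  {D : Type*} [TopologicalSpace D] [ChartedSpace E D] [Group D] [LieGroup 𝓘(ℝ, E) ∞ D]
  [T2Space D] [ConnectedSpace D]
  {F : Type*} [NormedAddCommGroup F] [NormedSpace ℝ F] [FiniteDimensional ℝ F]
  {G : Subgroup D} [ChartedSpace F (D ⧸ G)] [IsManifold 𝓘(ℝ, F) ∞ (D ⧸ G)] [T2Space (D ⧸ G)]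
  {P : ManinPair E D} {s : ConnSplitting P F G} {M : Mfd.{u}}

/-- A strong Dirac map determines smooth vector fields from smooth data. -/
theorem StrongDirac.smoothVF_of_mem (A : StrongDirac s.LS s.phiS M)
    {X : ∀ x : M.carrier, Tan M.Model x} {a : ∀ x : M.carrier, Cot M.Model x} (ha : SmoothForm a)
    (h : ∀ x, (X x, a x) ∈ A.L x)
    (hX : ContMDiff 𝓘(ℝ, M.Model) 𝓘(ℝ, E) ∞ (fun x => s.pull A.J x (X x))) : SmoothVF X := by
  intro x₀
  obtain ⟨n, Y, b, hY, hb, hm, hspan⟩ := exists_smooth_sections A.isDirac x₀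
  -- Covector parts of sections of `L` together with `J^*s`. Since `L` is isotropic, `b i (X) = -a(Y
  -- i)`, so `β(X)` is smooth, and `X` is recovered from it once `β` is injective at `x₀`.
  let β : ∀ x : M.carrier, Tan M.Model x →L[ℝ] (Fin n → ℝ) × E := fun x =>
    (ContinuousLinearMap.pi fun i => b i x).prod (s.pull A.J x)
  have hβ : SmoothForm β := by
    refine ContMDiff.prodMk_space ?_ (s.smoothForm_pull A.smooth_J)
    exact contMDiff_pi_space.2 hb
  refine contMDiffAt_field_of_injective hβ ?_ ?_
  · have h1 : (fun x => β x (X x)) = fun x => (fun i => -a x (Y i x), s.pull A.J x (X x)) := by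
      funext x
      refine Prod.ext (funext fun i => ?_) rfl
      have := (A.isDirac.lagrangian x _).1 (h x) _ (hm i x)
      simp only [pairing] at this
      change b i x (X x) = _
      linarith
    rw [h1]
    refine ContMDiffAt.prodMk_space ?_ (hX x₀)
    exact contMDiffAt_pi_space.2 fun i => ((ha.apply (hY i)).neg) x₀
  · rw [injective_iff_map_eq_zero]
    intro Z hZ
    have h1 : ∀ i, b i x₀ Z = 0 := fun i => congrFun (congrArg Prod.fst hZ) i
    have h2 : s.pull A.J x₀ Z = 0 := congrArg Prod.snd hZ
    -- A vector killed by all covectors of the lagrangian `L` lies in `L`, so injectivity of `β` at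
    -- `x₀` is the strong condition.
    refine A.transversal x₀ Z (ConnSplitting.pull_eq_zero_iff.1 h2) ?_
    rw [A.isDirac.lagrangian x₀]
    intro e he
    rw [← hspan] at he
    change e.2 Z + (0 : ℝ) = 0
    rw [add_zero]
    refine Submodule.span_induction ?_ ?_ ?_ ?_ he
    · rintro _ ⟨i, rfl⟩
      exact h1 i
    · rfl
    · intro e e' _ _ h h'
      change e.2 Z + e'.2 Z = 0
      rw [h, h', add_zero]
    · intro c e _ h
      change c • e.2 Z = 0
      rw [h, smul_zero]

variable (j : P.Splitting)
  (hp : Manifold.IsSubmersion 𝓘(ℝ, E) 𝓘(ℝ, F) ∞ (QuotientGroup.mk : D → D ⧸ G))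
  (hG : P.IsIntegratedBy G)

/-- The infinitesimal action on the source of a strong Dirac map. -/
def StrongDirac.rho (A : StrongDirac s.LS s.phiS M) (x : M.carrier) : P.g →ₗ[ℝ] Tan M.Model x :=
  Classical.choose (ConnSplitting.exists_rho (A.forward x) (A.transversal x))

theorem StrongDirac.pull_rho (A : StrongDirac s.LS s.phiS M) (x : M.carrier) (v : P.g) :
    s.pull A.J x (A.rho x v) = s.proj (A.J x) v :=
  (Classical.choose_spec (ConnSplitting.exists_rho (A.forward x) (A.transversal x))).1 v

theorem StrongDirac.rho_mem (A : StrongDirac s.LS s.phiS M) (x : M.carrier) (v : P.g) :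
    (A.rho x v, s.pullDual A.J x v) ∈ A.L x :=
  (Classical.choose_spec (ConnSplitting.exists_rho (A.forward x) (A.transversal x))).2 v

include hp hG in
theorem StrongDirac.exists_pi (A : StrongDirac s.LS s.phiS M) (x : M.carrier) :
    ∃ p : Cot M.Model x →ₗ[ℝ] Tan M.Model x,
    (∀ α, s.pull A.J x (p α) = -s.proj (A.J x) (j.j (rhoDual (A.rho x) α))) ∧
    ∀ α, (p α, α + s.pullDual A.J x (ConnSplitting.genCoeff j (A.rho x) 0 α)) ∈ A.L x :=
  ConnSplitting.exists_pi (s.form_proj_add hG hp (A.J x)) (A.isDirac.lagrangian x)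
    (A.transversal x) (A.pull_rho x) (A.rho_mem x)

/-- The bivector field on the source of a strong Dirac map. -/
def StrongDirac.bivector (A : StrongDirac s.LS s.phiS M) (x : M.carrier) :
    Cot M.Model x →ₗ[ℝ] Tan M.Model x := Classical.choose (A.exists_pi j hp hG x)

theorem StrongDirac.pull_bivector (A : StrongDirac s.LS s.phiS M) (x : M.carrier)
    (α : Cot M.Model x) : s.pull A.J x (A.bivector j hp hG x α)
      = -s.proj (A.J x) (j.j (rhoDual (A.rho x) α)) :=
  (Classical.choose_spec (A.exists_pi j hp hG x)).1 α

theorem StrongDirac.bivector_mem (A : StrongDirac s.LS s.phiS M) (x : M.carrier)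
    (α : Cot M.Model x) : (A.bivector j hp hG x α,
      α + s.pullDual A.J x (ConnSplitting.genCoeff j (A.rho x) 0 α)) ∈ A.L x :=
  (Classical.choose_spec (A.exists_pi j hp hG x)).2 α

theorem StrongDirac.isPreHam (A : StrongDirac s.LS s.phiS M) :
    IsPreHam (F := F) j A.J A.rho (A.bivector j hp hG) := by
  have hs : ∀ v, SmoothVF (fun x => A.rho x v) := by
    intro v
    refine A.smoothVF_of_mem (s.smoothForm_pullDual A.smooth_J (contMDiff_const (c := (v : E))))
      (fun x => A.rho_mem x v) ?_
    simp only [A.pull_rho]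
    exact (((s.contMDiff_proj hp).comp A.smooth_J).clm_apply contMDiff_const)
  refine ⟨A.smooth_J, fun x => ?_, fun α hα => ?_, hs, fun x v => s.pull_eq_iff.1 (A.pull_rho x v),
    fun x α => ConnSplitting.pull_neg_iff.1 (A.pull_bivector j hp hG x α)⟩
  · exact ConnSplitting.skew_of_mem (s.form_proj_add hG hp (A.J x)) (A.isDirac.lagrangian x)
      (A.pull_bivector j hp hG x) (A.bivector_mem j hp hG x)
  · refine A.smoothVF_of_mem (hα.add (s.smoothForm_pullDual A.smooth_J
      (contMDiff_genCoeff (j := j) hs 0 hα))) (fun x => A.bivector_mem j hp hG x (α x)) ?_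
    simp only [A.pull_bivector]
    exact (((s.contMDiff_proj hp).comp A.smooth_J).clm_apply (contMDiff_j_rhoDual hs hα)).neg

theorem StrongDirac.L_eq_range (A : StrongDirac s.LS s.phiS M) (x : M.carrier) :
    A.L x = LinearMap.range (s.genSection j A.J x (A.rho x) (A.bivector j hp hG x)) :=
  ConnSplitting.eq_range_genSection (s.form_proj_add hG hp (A.J x)) (A.isDirac.lagrangian x)
    (A.rho_mem x) (A.pull_bivector j hp hG x) (A.bivector_mem j hp hG x)

theorem StrongDirac.pairing_courant_gen (A : StrongDirac s.LS s.phiS M) (v₁ v₂ v₃ : P.g)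
    {f₁ f₂ : M.carrier → ℝ} (hf₁ : ContMDiff 𝓘(ℝ, M.Model) 𝓘(ℝ, ℝ) ∞ f₁)
    (hf₂ : ContMDiff 𝓘(ℝ, M.Model) 𝓘(ℝ, ℝ) ∞ f₂) (f₃ : M.carrier → ℝ) (x : M.carrier) :
    pairing (courant (pullThree A.J s.phiS) (genVec A.rho (A.bivector j hp hG) v₁ f₁)
      (s.genForm j A.J A.rho v₁ f₁) (genVec A.rho (A.bivector j hp hG) v₂ f₂)
      (s.genForm j A.J A.rho v₂ f₂) x)
      (genVec A.rho (A.bivector j hp hG) v₃ f₃ x, s.genForm j A.J A.rho v₃ f₃ x) = 0 := by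
  have h := A.isPreHam j hp hG
  have hm : ∀ v (f : M.carrier → ℝ) x, (genVec A.rho (A.bivector j hp hG) v f x,
      s.genForm j A.J A.rho v f x) ∈ A.L x := fun v f x => by
    rw [A.L_eq_range j hp hG]
    exact ⟨(v, dfun f x), rfl⟩
  exact (A.isDirac.lagrangian x _).1 (A.isDirac.integrable _ _ _ _ (h.smoothVF_genVec v₁ hf₁)
    (h.smoothForm_genForm v₁ hf₁) (h.smoothVF_genVec v₂ hf₂) (h.smoothForm_genForm v₂ hf₂)
    (hm v₁ f₁) (hm v₂ f₂) x) _ (hm v₃ f₃ x)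

/-- The Hamiltonian quasi-Poisson space of a strong Dirac map. -/
def StrongDirac.toHamQP (A : StrongDirac s.LS s.phiS M) : HamQP j F G M where
  π := A.bivector j hp hG
  ρ := A.rho
  J := A.J
  skew := (A.isPreHam j hp hG).skew
  smooth_π := (A.isPreHam j hp hG).smooth_p
  smooth_ρ := (A.isPreHam j hp hG).smooth_r
  action u v x := (A.isPreHam j hp hG).action_of_integrable (s := s) hp hG u v x fun f _ =>
    A.pairing_courant_gen j hp hG u v 0 contMDiff_const contMDiff_const f x
  lie_π v _ g hf hg x := (A.isPreHam j hp hG).lieBiv_of_integrable (s := s) hp hG v hf hg x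
    (A.pairing_courant_gen j hp hG v 0 0 contMDiff_const hf g x)
  schouten_π _ _ k hf hg hk x := (A.isPreHam j hp hG).halfSchouten_of_integrable (s := s) hp hG
    hf hg hk x (A.pairing_courant_gen j hp hG 0 0 0 hf hg k x)
  smooth_J := A.smooth_J
  equivariant := (A.isPreHam j hp hG).equivariant
  moment x := (moment_iff ((A.isPreHam j hp hG).skew x)).2 ((A.isPreHam j hp hG).moment x)

theorem StrongDirac.associated (A : StrongDirac s.LS s.phiS M) :
    Associated s A (A.toHamQP j hp hG) where
  moment_map := rfl
  action x v := ⟨s.pull_eq_iff.1 (A.pull_rho x v), A.rho_mem x v⟩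
  transversal x := ConnSplitting.isCompl_backwardImage (s.form_proj_add hG hp (A.J x))
    (A.forward x) (A.transversal x) (A.pull_rho x) (A.rho_mem x) (A.pull_bivector j hp hG x)
    (A.bivector_mem j hp hG x)
  bivector x α := ⟨_, A.bivector_mem j hp hG x α, fun _ hc =>
    ConnSplitting.pairing_backwardImage (s.form_proj_add hG hp (A.J x))
      (A.pull_bivector j hp hG x) α hc, rfl⟩

variable {j}

/-- The strong Dirac map of a Hamiltonian quasi-Poisson space. -/
def HamQP.toStrongDirac (s : ConnSplitting P F G) (B : HamQP j F G M) :
    StrongDirac s.LS s.phiS M where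
  L := B.diracL s
  J := B.J
  smooth_J := B.smooth_J
  isDirac := B.isDirac hp hG s
  forward x := ConnSplitting.forwardImage_range_genSection (s.form_proj_add hG hp (B.J x))
    (B.isPreHam.pull_r x) (B.isPreHam.pull_p x) (B.skew x)
  transversal x := ConnSplitting.strong_range_genSection (s.form_proj_add hG hp (B.J x))
    (B.isPreHam.pull_r x) (B.isPreHam.pull_p x) (B.skew x)

theorem StrongDirac.toStrongDirac_toHamQP (A : StrongDirac s.LS s.phiS M) :
    (A.toHamQP j hp hG).toStrongDirac hp hG s = A :=
  StrongDirac.ext (funext fun x => (A.L_eq_range j hp hG x).symm) rfl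

/-- The given data and the reconstructed ones satisfy the same membership in `L` and have the same
image under `dJ`; `eq_of_strong` allows only one solution, so the choices in the construction do not
matter. -/
theorem HamQP.toHamQP_toStrongDirac (B : HamQP j F G M) :
    (B.toStrongDirac hp hG s).toHamQP j hp hG = B := by
  have hρ : (B.toStrongDirac hp hG s).rho = B.ρ := by
    funext x
    ext v
    refine ConnSplitting.eq_of_strong (s := s) ((B.toStrongDirac hp hG s).transversal x)
      ((B.toStrongDirac hp hG s).rho_mem x v) ⟨(v, 0), ?_⟩
      (((B.toStrongDirac hp hG s).pull_rho x v).trans (B.isPreHam.pull_r x v).symm)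
    rw [ConnSplitting.genSection_apply, genCoeff_const, map_zero, add_zero, zero_add]
    rfl
  have hπ : (B.toStrongDirac hp hG s).bivector j hp hG = B.π := by
    funext x
    ext α
    have h1 := (B.toStrongDirac hp hG s).bivector_mem j hp hG x α
    have h2 := (B.toStrongDirac hp hG s).pull_bivector j hp hG x α
    rw [hρ] at h1 h2
    refine ConnSplitting.eq_of_strong (s := s) ((B.toStrongDirac hp hG s).transversal x)
      h1 ⟨(0, α), ?_⟩ (h2.trans (B.isPreHam.pull_p x α).symm)
    rw [ConnSplitting.genSection_apply, map_zero, zero_add]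
    rfl
  exact HamQP.ext hπ hρ rfl

end Objects

/-! ### Morphisms; presymplectic and transitive objects. -/

section Morphisms

variable {E : Type*} [NormedAddCommGroup E] [NormedSpace ℝ E]
  {D : Type*} [TopologicalSpace D] [ChartedSpace E D] [Group D]
  {F : Type*} [NormedAddCommGroup F] [NormedSpace ℝ F]
  {G : Subgroup D} [ChartedSpace F (D ⧸ G)] [IsManifold 𝓘(ℝ, F) ∞ (D ⧸ G)]
  {P : ManinPair E D} {s : ConnSplitting P F G} {j : P.Splitting} {M M' : Mfd.{u}}

theorem ConnSplitting.pull_comp {f : M.carrier → M'.carrier} {J' : M'.carrier → D ⧸ G}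
    {J : M.carrier → D ⧸ G} (hJ : J' ∘ f = J) (hf : ContMDiff 𝓘(ℝ, M.Model) 𝓘(ℝ, M'.Model) ∞ f)
    (hJ' : ContMDiff 𝓘(ℝ, M'.Model) 𝓘(ℝ, F) ∞ J') (x : M.carrier) (X : Tan M.Model x) :
    s.pull J' (f x) (dmap M.Model M'.Model f x X) = s.pull J x X := by
  subst hJ
  have h := mfderiv_comp_apply (I' := 𝓘(ℝ, M'.Model)) x (mdiff hJ' (f x)) (mdiff hf x) X
  exact (congrArg (s.s (J' (f x))) h).symm

theorem ConnSplitting.proj_comp {f : M.carrier → M'.carrier} {J' : M'.carrier → D ⧸ G}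
    {J : M.carrier → D ⧸ G} (hJ : J' ∘ f = J) (x : M.carrier) :
    s.proj (J' (f x)) = s.proj (J x) := by
  subst hJ
  rfl

theorem ConnSplitting.dmapDual_pullDual {f : M.carrier → M'.carrier} {J' : M'.carrier → D ⧸ G}
    {J : M.carrier → D ⧸ G} (hJ : J' ∘ f = J) (hf : ContMDiff 𝓘(ℝ, M.Model) 𝓘(ℝ, M'.Model) ∞ f)
    (hJ' : ContMDiff 𝓘(ℝ, M'.Model) 𝓘(ℝ, F) ∞ J') (x : M.carrier) (u : E) :
    dmapDual M.Model M'.Model f x (s.pullDual J' (f x) u) = s.pullDual J x u := by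
  ext X
  exact congrArg (P.form u) (ConnSplitting.pull_comp hJ hf hJ' x X)

theorem rhoDual_dmapDual {f : M.carrier → M'.carrier} {x : M.carrier}
    {r : P.g →ₗ[ℝ] Tan M.Model x} {r' : P.g →ₗ[ℝ] Tan M'.Model (f x)}
    (h : ∀ v, dmap M.Model M'.Model f x (r v) = r' v) (β : Cot M'.Model (f x)) :
    rhoDual r (dmapDual M.Model M'.Model f x β) = rhoDual r' β := by
  ext v
  exact congrArg β (h v)

variable [FiniteDimensional ℝ E] [LieGroup 𝓘(ℝ, E) ∞ D]
  [T2Space D] [ConnectedSpace D] [FiniteDimensional ℝ F] [T2Space (D ⧸ G)]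
  (hp : Manifold.IsSubmersion 𝓘(ℝ, E) 𝓘(ℝ, F) ∞ (QuotientGroup.mk : D → D ⧸ G))
  (hG : P.IsIntegratedBy G)

/-- The images under `df` of `ρ_M(v)` and `π♯ f^*β` satisfy in `M'` the two conditions that
characterise the corresponding vectors there, and `eq_of_strong` applies. -/
theorem IsDiracMor.isQPMor (j : P.Splitting) {A : StrongDirac s.LS s.phiS M}
    {A' : StrongDirac s.LS s.phiS M'} {f : M.carrier → M'.carrier} (h : IsDiracMor A A' f) :
    IsQPMor (A.toHamQP j hp hG) (A'.toHamQP j hp hG) f := by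
  have hfw : ∀ (x : M.carrier) {X : Tan M.Model x} {b : Cot M'.Model (f x)},
      (X, dmapDual M.Model M'.Model f x b) ∈ A.L x →
        (dmap M.Model M'.Model f x X, b) ∈ A'.L (f x) := by
    intro x X b hX
    rw [h.forward x, mem_forwardImage]
    exact ⟨X, rfl, hX⟩
  have hpull := ConnSplitting.pull_comp (s := s) h.comm h.smooth A'.smooth_J
  have hdual := ConnSplitting.dmapDual_pullDual (s := s) h.comm h.smooth A'.smooth_J
  have hproj := ConnSplitting.proj_comp (s := s) h.comm
  have heq : ∀ x (v : P.g), dmap M.Model M'.Model f x (A.rho x v) = A'.rho (f x) v := by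
    intro x v
    refine ConnSplitting.eq_of_strong (s := s) (A'.transversal (f x)) (hfw x ?_)
      (A'.rho_mem (f x) v) ?_
    · rw [hdual]
      exact A.rho_mem x v
    · rw [hpull, A.pull_rho, A'.pull_rho, hproj]
  refine ⟨h.smooth, h.comm, fun x β => ?_, heq⟩
  have hd := rhoDual_dmapDual (heq x) β
  refine ConnSplitting.eq_of_strong (s := s) (A'.transversal (f x)) (hfw x ?_)
    (A'.bivector_mem j hp hG (f x) β) ?_
  · rw [map_add, hdual, ConnSplitting.genCoeff, ← hd]
    exact A.bivector_mem j hp hG x _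
  · change s.pull A'.J (f x) (dmap M.Model M'.Model f x (A.bivector j hp hG x _)) = _
    rw [hpull, A.pull_bivector, hd, ← hproj]
    exact (A'.pull_bivector j hp hG (f x) β).symm

/-- The element `e(v, f^*β)` on `M` is related by `f` to `e'(v, β)`, which gives one inclusion. For
the other, `(X, f^*b)` has the explicit preimage with `𝔤`-part from `J^*s(X)`, and this part is
unchanged under `f` because `J' ∘ f = J`. -/
theorem IsQPMor.isDiracMor (s : ConnSplitting P F G) {B : HamQP j F G M} {B' : HamQP j F G M'}
    {f : M.carrier → M'.carrier} (h : IsQPMor B B' f) :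
    IsDiracMor (B.toStrongDirac hp hG s) (B'.toStrongDirac hp hG s) f := by
  have hpull := ConnSplitting.pull_comp (s := s) h.comm h.smooth B'.smooth_J
  have hdual := ConnSplitting.dmapDual_pullDual (s := s) h.comm h.smooth B'.smooth_J
  refine ⟨h.smooth, h.comm, fun x => ?_⟩
  have hd := rhoDual_dmapDual (h.equivariant x)
  apply le_antisymm
  · rintro _ ⟨⟨v, β⟩, rfl⟩
    rw [mem_forwardImage]
    refine ⟨B.ρ x v + B.π x (dmapDual M.Model M'.Model f x β), ?_,
      (v, dmapDual M.Model M'.Model f x β), ?_⟩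
    · rw [map_add, h.equivariant, h.push]
      rfl
    · rw [ConnSplitting.genSection_apply, ConnSplitting.genSection_apply]
      refine Prod.ext rfl ?_
      change _ = dmapDual M.Model M'.Model f x (β + s.pullDual B'.J (f x) _)
      rw [map_add, hdual, ConnSplitting.genCoeff, ConnSplitting.genCoeff, hd]
  · rintro ⟨Y, b⟩ he
    obtain ⟨X, hX, hL⟩ := mem_forwardImage.1 he
    change dmap M.Model M'.Model f x X = Y at hX
    subst hX
    have h1 : ∀ e ∈ B.diracL s x, pairing (X, dmapDual M.Model M'.Model f x b) e = 0 :=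
      ((B.isDirac hp hG s).lagrangian x _).1 hL
    have h2 := ConnSplitting.eq_genSection_of_pairing (B.skew x) fun e => h1 _ ⟨e, rfl⟩
    have h3 : rhoDual (B'.ρ (f x)) b
        = -P.toDual (s.pull B'.J (f x) (dmap M.Model M'.Model f x X)) := by
      rw [hpull, ← hd]
      refine ConnSplitting.rhoDual_of_mem ((B.isDirac hp hG s).lagrangian x) (fun v => ?_) hL
      refine ⟨(v, 0), ?_⟩
      rw [ConnSplitting.genSection_apply, genCoeff_const, map_zero, add_zero, zero_add]
    refine ⟨_, (ConnSplitting.genSection_eq h3).trans (Prod.ext ?_ rfl)⟩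
    change _ = dmap M.Model M'.Model f x X
    have h4 := congrArg Prod.fst h2
    change B.ρ x _ + B.π x _ = X at h4
    conv_rhs => rw [← h4]
    rw [map_add, h.equivariant, h.push, hpull]

/-- A presymplectic realization has a transitive Lie algebroid. -/
theorem anchor_surjective_of_isTwoForm (B : HamQP j F G M) (h : IsTwoForm (B.diracL s))
    (x : M.carrier) : Function.Surjective (B.anchor x) := by
  obtain ⟨w, -, -, hw⟩ := h
  intro X
  have h1 : (X, w x X) ∈ B.diracL s x := by
    rw [hw x]
    exact LinearMap.mem_graph_iff (f := w x) (x := (X, w x X)) |>.2 rfl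
  obtain ⟨e, he⟩ := h1
  exact ⟨e, congrArg Prod.fst he⟩

include hp hG in
-- The tangent component of `e` is the anchor, so `L` projects onto `TM`. Being isotropic, `L` then
-- contains no nonzero pure covector and is a graph.
theorem isTwoForm_of_anchor_surjective (s : ConnSplitting P F G) (B : HamQP j F G M)
    (h : ∀ x, Function.Surjective (B.anchor x)) : IsTwoForm (B.diracL s) := by
  have hL := B.isDirac hp hG s
  have hex : ∀ x (X : Tan M.Model x), ∃ a, (X, a) ∈ B.diracL s x := by
    intro x X
    obtain ⟨e, rfl⟩ := h x X
    exact ⟨_, e, rfl⟩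
  have hiso : ∀ {x : M.carrier} {X Y : Tan M.Model x} {a b : Cot M.Model x},
      (X, a) ∈ B.diracL s x → (Y, b) ∈ B.diracL s x → a Y = -b X := by
    intro x X Y a b h1 h2
    have h3 := (hL.lagrangian x _).1 h1 _ h2
    simp only [pairing] at h3
    linarith
  have huni : ∀ x (a : Cot M.Model x), ((0 : Tan M.Model x), a) ∈ B.diracL s x → a = 0 := by
    intro x a ha
    ext X
    obtain ⟨b, hb⟩ := hex x X
    rw [hiso ha hb, map_zero, neg_zero]
    rfl
  choose w hw using fun x => exists_linearMap_mem (B.diracL s x) (hex x) (huni x)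
  refine ⟨w, fun x X => ?_, fun X hX => ?_, fun x => ?_⟩
  · have := hiso (hw x X) (hw x X)
    linarith
  -- On the tangent parts `Y i` of sections of `L` the form takes the values `-b i (X)`, and these
  -- `Y i` span at `x₀` because `L` projects onto the tangent space.
  · refine smoothForm_of_frame fun x₀ => ?_
    obtain ⟨n, Y, b, hY, hb, hm, hspan⟩ := exists_smooth_sections hL x₀
    refine ⟨n, Y, hY, fun i => ?_, fun α hα => ?_⟩
    · have h1 : (fun x => w x (X x) (Y i x)) = fun x => -b i x (X x) := funext fun x =>
        hiso (hw x (X x)) (hm i x)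
      rw [h1]
      exact ((hb i).apply hX).neg
    · ext Z
      obtain ⟨a, ha⟩ := hex x₀ Z
      rw [← hspan] at ha
      let ℓ : Gen M.Model x₀ →ₗ[ℝ] ℝ := (α : Tan M.Model x₀ →ₗ[ℝ] ℝ) ∘ₗ LinearMap.fst ℝ _ _
      have h1 : Submodule.span ℝ (Set.range fun i => (Y i x₀, b i x₀)) ≤ LinearMap.ker ℓ := by
        rw [Submodule.span_le]
        rintro _ ⟨i, rfl⟩
        exact hα i
      exact h1 ha
  · ext e
    rw [LinearMap.mem_graph_iff]
    constructor
    · intro he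
      have h1 := (B.diracL s x).sub_mem he (hw x e.1)
      have h2 : e - (e.1, w x e.1) = (0, e.2 - w x e.1) := Prod.ext (sub_self _) rfl
      rw [h2] at h1
      exact sub_eq_zero.1 (huni x _ h1)
    · intro he
      have h1 := hw x e.1
      rw [← he] at h1
      exact h1

end Morphisms

/-! ### Strict isomorphisms of categories and their restriction to full subcategories. -/

section CatIso

/-- The inclusion of a full subcategory is injective on objects and faithful, so equality of
functors can be tested in the ambient category. -/
theorem functor_eq_of_comp_ι {C A : Type*} [Category C] [Category A] {Q : ObjectProperty A}
    {Φ Ψ : C ⥤ Q.FullSubcategory} (h : Φ ⋙ Q.ι = Ψ ⋙ Q.ι) : Φ = Ψ := by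
  have hobj : ∀ X, Φ.obj X = Ψ.obj X := fun X =>
    ObjectProperty.FullSubcategory.ext (Functor.congr_obj h X)
  refine CategoryTheory.Functor.ext hobj fun X Y f => Q.ι.map_injective ?_
  have h1 := Functor.congr_hom h f
  rw [Functor.map_comp, Functor.map_comp, eqToHom_map, eqToHom_map]
  exact h1

/-- An isomorphism of categories restricts to full subcategories that correspond to each other. -/
theorem isCatIso_lift {A B : Type*} [Category A] [Category B] {Φ : A ⥤ B} {Ψ : B ⥤ A}
    (h₁ : Φ ⋙ Ψ = 𝟭 A) (h₂ : Ψ ⋙ Φ = 𝟭 B) {Q : ObjectProperty A} {R : ObjectProperty B}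
    (hQ : ∀ X, Q X → R (Φ.obj X)) (hR : ∀ Y, R Y → Q (Ψ.obj Y)) :
    IsCatIso (R.lift (Q.ι ⋙ Φ) (fun X => hQ X.obj X.property)) := by
  refine ⟨Q.lift (R.ι ⋙ Ψ) (fun Y => hR Y.obj Y.property), functor_eq_of_comp_ι ?_,
    functor_eq_of_comp_ι ?_⟩
  · change Q.ι ⋙ (Φ ⋙ Ψ) = Q.ι
    rw [h₁]
    rfl
  · change R.ι ⋙ (Ψ ⋙ Φ) = R.ι
    rw [h₂]
    rfl

variable {E : Type*} [NormedAddCommGroup E] [NormedSpace ℝ E] [FiniteDimensional ℝ E]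
  {D : Type*} [TopologicalSpace D] [ChartedSpace E D] [Group D]
  {F : Type*} [NormedAddCommGroup F] [NormedSpace ℝ F]
  {G : Subgroup D} [ChartedSpace F (D ⧸ G)]
  {P : ManinPair E D} {j : P.Splitting}

/-- A round trip returns an equal but not definitionally equal object. Once the equalities of
structures are substituted, a morphism is the same underlying map. -/
theorem HamDirac.heq_hom {S : Type*} [TopologicalSpace S] [ChartedSpace F S]
    {LS : ∀ y : S, Submodule ℝ (Gen F y)} {φS : ∀ y : S, Tan F y → Tan F y → Cot F y}
    {M M' : Mfd.{u}} {a b : StrongDirac LS φS M} {a' b' : StrongDirac LS φS M'} (h : a = b)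
    (h' : a' = b') {f : M.carrier → M'.carrier} (hf : IsDiracMor a a' f) (hf' : IsDiracMor b b' f) :
    HEq (⟨f, hf⟩ : (HamDirac.mk M a : HamDirac LS φS) ⟶ HamDirac.mk M' a')
      (⟨f, hf'⟩ : (HamDirac.mk M b : HamDirac LS φS) ⟶ HamDirac.mk M' b') := by
  subst h h'
  rfl

theorem HamQPoisson.heq_hom {M M' : Mfd.{u}} {a b : HamQP j F G M} {a' b' : HamQP j F G M'}
    (h : a = b) (h' : a' = b') {f : M.carrier → M'.carrier} (hf : IsQPMor a a' f)
    (hf' : IsQPMor b b' f) :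
    HEq (⟨f, hf⟩ : (HamQPoisson.mk M a : HamQPoisson j F G) ⟶ HamQPoisson.mk M' a')
      (⟨f, hf'⟩ : (HamQPoisson.mk M b : HamQPoisson j F G) ⟶ HamQPoisson.mk M' b') := by
  subst h h'
  rfl

variable [LieGroup 𝓘(ℝ, E) ∞ D] [T2Space D] [ConnectedSpace D] [FiniteDimensional ℝ F]
  [T2Space (D ⧸ G)] [IsManifold 𝓘(ℝ, F) ∞ (D ⧸ G)]

/-- The functor from Hamiltonian quasi-Poisson spaces to strong Dirac maps. -/
def inverseFunctor
    (hp : Manifold.IsSubmersion 𝓘(ℝ, E) 𝓘(ℝ, F) ∞ (QuotientGroup.mk : D → D ⧸ G))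
    (hG : P.IsIntegratedBy G) (s : ConnSplitting P F G) (j : P.Splitting) :
    HamQPoisson.{u} j F G ⥤ HamDirac.{u} s.LS s.phiS where
  obj B := ⟨B.M, B.str.toStrongDirac hp hG s⟩
  map f := ⟨f.1, f.2.isDiracMor hp hG s⟩

end CatIso

end ManinHam

end

theorem corollary5p5
    {E : Type*} [NormedAddCommGroup E] [NormedSpace ℝ E] [FiniteDimensional ℝ E]
    {D : Type*} [TopologicalSpace D] [ChartedSpace E D] [Group D] [LieGroup 𝓘(ℝ, E) ∞ D]
    [T2Space D] [SecondCountableTopology D] [ConnectedSpace D]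
    (P : ManinHam.ManinPair E D) (G : Subgroup D) (hG : P.IsIntegratedBy G)
    {F : Type*} [NormedAddCommGroup F] [NormedSpace ℝ F] [FiniteDimensional ℝ F]
    [ChartedSpace F (D ⧸ G)] [IsManifold 𝓘(ℝ, F) ∞ (D ⧸ G)]
    (hp : Manifold.IsSubmersion 𝓘(ℝ, E) 𝓘(ℝ, F) ∞ (QuotientGroup.mk : D → D ⧸ G))
    (s : ManinHam.ConnSplitting P F G) (j : P.Splitting) :
    ∃ (T : ∀ M : ManinHam.Mfd.{u},
        ManinHam.StrongDirac s.LS s.phiS M → ManinHam.HamQP j F G M)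
      (hT : ∀ (M M' : ManinHam.Mfd.{u}) (A : ManinHam.StrongDirac s.LS s.phiS M)
        (A' : ManinHam.StrongDirac s.LS s.phiS M') (f : M.carrier → M'.carrier),
        ManinHam.IsDiracMor A A' f → ManinHam.IsQPMor (T M A) (T M' A') f),
      (∀ (M : ManinHam.Mfd.{u}) (A : ManinHam.StrongDirac s.LS s.phiS M),
        ManinHam.Associated s A (T M A)) ∧
      ManinHam.IsCatIso (ManinHam.functorOf s T hT) ∧
      ∃ h : ∀ A : ManinHam.HamDirac.{u} s.LS s.phiS, ManinHam.presymplectic A →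
          ManinHam.transitive ((ManinHam.functorOf s T hT).obj A),
        ManinHam.IsCatIso
          (ManinHam.transitive.lift
            (ManinHam.presymplectic.ι ⋙ ManinHam.functorOf s T hT)
            (fun A => h A.obj A.property)) := by
  have : T2Space (D ⧸ G) := ManinHam.t2Space_quotient (E := E) hG.closed
  have h₁ : ManinHam.functorOf s (fun _ A => A.toHamQP j hp hG)
      (fun _ _ _ _ _ h => h.isQPMor hp hG j) ⋙ ManinHam.inverseFunctor.{u} hp hG s j = 𝟭 _ :=
    CategoryTheory.Functor.hext (fun A => congrArg (ManinHam.HamDirac.mk A.M) (A.str.toStrongDirac_toHamQP hp hG))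
      fun A A' f => ManinHam.HamDirac.heq_hom (A.str.toStrongDirac_toHamQP hp hG)
        (A'.str.toStrongDirac_toHamQP hp hG) _ f.2
  have h₂ : ManinHam.inverseFunctor.{u} hp hG s j ⋙
      ManinHam.functorOf s (fun _ A => A.toHamQP j hp hG)
        (fun _ _ _ _ _ h => h.isQPMor hp hG j) = 𝟭 _ :=
    CategoryTheory.Functor.hext
      (fun B => congrArg (ManinHam.HamQPoisson.mk B.M) (B.str.toHamQP_toStrongDirac hp hG))
      fun B B' f => ManinHam.HamQPoisson.heq_hom (B.str.toHamQP_toStrongDirac hp hG)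
        (B'.str.toHamQP_toStrongDirac hp hG) _ f.2
  have h₃ : ∀ A : ManinHam.HamDirac.{u} s.LS s.phiS, ManinHam.presymplectic A →
      ManinHam.transitive ((ManinHam.functorOf s (fun _ A => A.toHamQP j hp hG)
        (fun _ _ _ _ _ h => h.isQPMor hp hG j)).obj A) := by
    intro A hA
    refine ManinHam.anchor_surjective_of_isTwoForm (s := s) _ ?_
    -- The structure `L` rebuilt from the quasi-Poisson space is the original one, so the 2-form
    -- condition transfers to it.
    have h := congrArg ManinHam.StrongDirac.L (A.str.toStrongDirac_toHamQP (j := j) hp hG)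
    change ManinHam.IsTwoForm ((A.str.toHamQP j hp hG).toStrongDirac hp hG s).L
    rw [h]
    exact hA
  exact ⟨fun _ A => A.toHamQP j hp hG, fun _ _ _ _ _ h => h.isQPMor hp hG j,
    fun _ A => A.associated j hp hG, ⟨ManinHam.inverseFunctor hp hG s j, h₁, h₂⟩, h₃,
    ManinHam.isCatIso_lift h₁ h₂ h₃ fun B hB =>
      ManinHam.isTwoForm_of_anchor_surjective hp hG s B.str hB⟩
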